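/- Let $m\ge 2$, $a\neq 0$, $l>0$, $m_0>0$ with $a^2l^2<1$. Consider the generalized Boyer–Lindquist form of the $(2m+1)$-dimensional Kerr-AdS metric with equal rotation parameters $a_i=a$ (cosmological constant $\Lambda=-m(2m-1)l^2$, mass $m_0$), $$ \begin{aligned} d\bar s^2={}&-\frac{1+l^2r^2}{1-a^2l^2}\,d\tau^2+\frac{U r^2\,dr^2}{(1+l^2r^2)(r^2+a^2)U-2m_0r^2} +\frac{r^2+a^2}{1-a^2l^2}\sum_{i=1}^m\bigl(d\mu_i^2+\mu_i^2(d\varphi_i+a\,l^2\,d\tau)^2\bigr)\\ &+\frac{2m_0}{U}\Bigl(d\tau-\frac{a}{1-a^2l^2}\sum_{i=1}^m\mu_i^2\,d\varphi_i\Bigr)^2, \qquad U=(r^2+a^2)^{m-1},\quad \sum_i\mu_i^2=1 . \end{aligned} $$ Put $\rho=r^2$, $z_i=\mu_ie^{i\varphi_i}$, $\Phi(\rho)=(1+l^2\rho)(\rho+a^2)^m-2m_0\rho$ (its zeros are the horizons), and $N=\{(\tau,\rho,z)\in\mathbb R\times(-a^2,\infty)\times\mathbb C^m:\ |z|=1\}$.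 (a) In the coordinate $\rho$ the metric, originally given for $\rho=r^2>0$, extends to a smooth Lorentzian metric $\bar g$ on $\{p\in N:\Phi(\rho)\ne0\}$, given by the same formula with $r^2$ replaced by $\rho$ and $r^2\,dr^2$ by $\tfrac14 d\rho^2$. There are no horizons in $-a^2<\rho\le 0$; there $\Phi>0$. (b) There is a smooth Lorentzian metric $g$ on all of $N$, i.e. for $-a^2<\rho<\infty$, that equals $\bar g$ for $-a^2<\rho\le0$ and that off the horizons equals $\bar g$ up to a change of coordinates $(\tau,\rho,\varphi_i)\mapsto(\tau+F(\rho),\rho,\varphi_i+H(\rho))$, with $F,H$ smooth where $\Phi\ne 0$, such that the extended spacetime $(N,g)$ has a timelike curvature singularity in $\rho=-a^2$ in the following sense: - (timelike) at every point with $\Phi(\rho)>0$, in particular for all $-a^2<\rho\le 0$, the metric induced by $g$ on the hypersurface $\{\rho=\mathrm{const}\}$ is Lorentzian; - (curvature, $m\ge3$) the sectional curvatures of $(N,g)$ of the planes tangent to the latitudinal spheres $\{\tau,\rho,\varphi_1,\dots,\varphi_m=\mathrm{const}\}$ tend to infinity in absolute value as $\rho\to-a^2$, uniformly in the point and in the plane;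 - (curvature, $m=2$) the Kretschmann scalar $R_{\alpha\beta\gamma\delta}R^{\alpha\beta\gamma\delta}$ of $(N,g)$ tends to $+\infty$ as $\rho\to-a^2$, uniformly in the point. (c) For $m=2$ the Kretschmann scalar of $\bar g$ is, wherever $\rho>-a^2$ and $\Phi(\rho)\neq0$, $$ R_{\alpha\beta\gamma\delta}R^{\alpha\beta\gamma\delta}=\frac{96m_0^2(3a^2-\rho)(a^2-3\rho)}{(\rho+a^2)^6}+40\,l^4 . $$ -/

import Mathlib

open scoped ContDiff

noncomputable section

namespace KerrAdS

/-! ### Curvature of a metric given in a coordinate patch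

`V` is a finite-dimensional real vector space, and `G : V → (V →L[ℝ] V →L[ℝ] ℝ)` is a
(pseudo-Riemannian) metric in the coordinates `x ∈ V`: `G x u v` is the metric at the point `x`
applied to the vectors `u` and `v`. -/

section Curvature

variable {V : Type*} [NormedAddCommGroup V] [NormedSpace ℝ V]

/-- The Christoffel symbols of the first kind, as the linear form
`w ↦ (∂_u G(v, w) + ∂_v G(u, w) - ∂_w G(u, v)) / 2`. -/
def christoffelFst (G : V → V →L[ℝ] V →L[ℝ] ℝ) (x u v : V) : V →L[ℝ] ℝ :=
  (1 / 2 : ℝ) • (fderiv ℝ G x u v + fderiv ℝ G x v u - ((fderiv ℝ G x).flip u).flip v)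

/-- The Christoffel symbols of the second kind: `christoffel G x u v` is the vector `Γ(u, v)` with
`G x (Γ(u, v)) w = christoffelFst G x u v w` for all `w` (for nondegenerate `G x`). -/
def christoffel (G : V → V →L[ℝ] V →L[ℝ] ℝ) (x u v : V) : V :=
  (G x).inverse (christoffelFst G x u v)

/-- The Riemann curvature `R(u, v) w = ∇_u ∇_v w - ∇_v ∇_u w` (for constant `u`, `v`, `w`). -/
def riemann (G : V → V →L[ℝ] V →L[ℝ] ℝ) (x u v w : V) : V :=
  fderiv ℝ (fun y => christoffel G y v w) x u - fderiv ℝ (fun y => christoffel G y u w) x v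
    + christoffel G x u (christoffel G x v w) - christoffel G x v (christoffel G x u w)

/-- The covariant curvature tensor `Rm(u, v, w, z) = ⟨R(u, v) w, z⟩`. -/
def riemannLow (G : V → V →L[ℝ] V →L[ℝ] ℝ) (x u v w z : V) : ℝ :=
  G x (riemann G x u v w) z

/-- The sectional curvature of the plane spanned by `u` and `v`. -/
def sectional (G : V → V →L[ℝ] V →L[ℝ] ℝ) (x u v : V) : ℝ :=
  riemannLow G x u v v u / (G x u u * G x v v - G x u v ^ 2)

/-- The vectors `e^i` of the basis dual to `b` with respect to the metric:
`G x (e^i) (b j) = δ_ij`. -/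
def raisedBasis [FiniteDimensional ℝ V] {ι : Type*} (G : V → V →L[ℝ] V →L[ℝ] ℝ) (x : V)
    (b : Module.Basis ι ℝ V) (i : ι) : V :=
  (G x).inverse (LinearMap.toContinuousLinearMap (b.coord i))

/-- The Kretschmann scalar `R_{αβγδ} R^{αβγδ}`, computed in the basis `b`. -/
def kretschmann [FiniteDimensional ℝ V] {ι : Type*} [Fintype ι]
    (G : V → V →L[ℝ] V →L[ℝ] ℝ) (x : V) (b : Module.Basis ι ℝ V) : ℝ :=
  ∑ i, ∑ j, ∑ k, ∑ n, riemannLow G x (b i) (b j) (b k) (b n) *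
    riemannLow G x (raisedBasis G x b i) (raisedBasis G x b j)
      (raisedBasis G x b k) (raisedBasis G x b n)

/-- The bilinear form `B` is a Lorentzian inner product on the subspace `W`: it is symmetric
there, and there is a vector with negative square on whose orthogonal complement `B` is positive
definite (signature `(-, +, …, +)`). -/
def IsLorentzianOn (B : V →L[ℝ] V →L[ℝ] ℝ) (W : Submodule ℝ V) : Prop :=
  (∀ u ∈ W, ∀ v ∈ W, B u v = B v u) ∧
    ∃ u ∈ W, B u u < 0 ∧ ∀ v ∈ W, B u v = 0 → v ≠ 0 → 0 < B v v

end Curvature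

/-! ### The manifold `N = ℝ × (-a², ∞) × S^{2m-1}` -/

/-- The ambient space `ℝ × ℝ × ℂ^m` with coordinates `(τ, ρ, z)`, where
`z_i = μ_i e^{i φ_i}`. -/
abbrev Amb (m : ℕ) : Type := ℝ × ℝ × (Fin m → ℂ)

/-- The manifold `N = {(τ, ρ, z) : -a² < ρ, |z|² = 1}` of dimension `2m + 1`. -/
def spacetime (m : ℕ) (a : ℝ) : Set (Amb m) :=
  {p | -a ^ 2 < p.2.1 ∧ ∑ i, ‖p.2.2 i‖ ^ 2 = 1}

/-- The linear form `Re ⟨z, dz⟩`, where `z` is the last component of `p`. -/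
def radialForm {m : ℕ} (p : Amb m) : Amb m →ₗ[ℝ] ℝ where
  toFun v := ∑ i, ((p.2.2 i).re * (v.2.2 i).re + (p.2.2 i).im * (v.2.2 i).im)
  map_add' u v := by
    simp only [← Finset.sum_add_distrib, Prod.snd_add, Pi.add_apply, Complex.add_re,
      Complex.add_im]
    exact Finset.sum_congr rfl fun i _ => by ring
  map_smul' c v := by
    simp only [Finset.mul_sum, Prod.smul_snd, Pi.smul_apply, Complex.real_smul, Complex.mul_re,
      Complex.mul_im, Complex.ofReal_re, Complex.ofReal_im, RingHom.id_apply, smul_eq_mul]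
    exact Finset.sum_congr rfl fun i _ => by ring

/-- The tangent space of `N` at `p`, as a subspace of the ambient space. -/
def tangent {m : ℕ} (p : Amb m) : Submodule ℝ (Amb m) := LinearMap.ker (radialForm p)

/-- The tangent space at `p` of the hypersurface `{ρ = const}` of `N`. -/
def levelTangent {m : ℕ} (p : Amb m) : Submodule ℝ (Amb m) :=
  tangent p ⊓ LinearMap.ker
    ((ContinuousLinearMap.fst ℝ ℝ (Fin m → ℂ)).comp
      (ContinuousLinearMap.snd ℝ ℝ (ℝ × (Fin m → ℂ)))).toLinearMap

/-- The coordinate patch of `N` around `p = (τ₀, ρ₀, z₀)` whose coordinate domain is a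
neighbourhood of `0` in the tangent space at `p`:
`(t, s, w) ↦ (τ₀ + t, ρ₀ + s, (z₀ + w) / |z₀ + w|)`. It sends `0` to `p`, and its derivative at `0`
is the inclusion of the tangent space. -/
def patch {m : ℕ} (p : Amb m) (x : tangent p) : Amb m :=
  (p.1 + (x : Amb m).1, p.2.1 + (x : Amb m).2.1,
    (Real.sqrt (∑ i, ‖p.2.2 i + (x : Amb m).2.2 i‖ ^ 2))⁻¹ • (p.2.2 + (x : Amb m).2.2))

/-- A tensor field of type `(0, 2)`, given on the ambient space. Only its values on vectors tangent
to `N` are meaningful as a tensor field on `N`. -/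
abbrev MetricField (m : ℕ) : Type := Amb m → Amb m →L[ℝ] Amb m →L[ℝ] ℝ

/-- The metric induced by `g` on `N`, expressed in the coordinate patch around `p`. -/
def localMetric {m : ℕ} (g : MetricField m) (p : Amb m) (x : tangent p) :
    tangent p →L[ℝ] tangent p →L[ℝ] ℝ :=
  (g (patch p x)).bilinearComp (fderiv ℝ (patch p) x) (fderiv ℝ (patch p) x)

/-- The sectional curvature of `(N, g)` at `p` of the plane spanned by the tangent vectors `u`
and `v`. -/
def sectionalAt {m : ℕ} (g : MetricField m) (p : Amb m) (u v : tangent p) : ℝ :=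
  sectional (localMetric g p) 0 u v

/-- The Kretschmann scalar of `(N, g)` at `p`, computed in the basis `b` of the tangent space. -/
def kretschmannAt {m : ℕ} (g : MetricField m) (p : Amb m)
    (b : Module.Basis (Fin (2 * m + 1)) ℝ (tangent p)) : ℝ :=
  kretschmann (localMetric g p) 0 b

/-! ### The generalized Boyer-Lindquist metric -/

/-- The polynomial `Φ(ρ) = (1 + l² ρ)(ρ + a²)^m - 2 m₀ ρ`, whose zeros are the horizons. -/
def horizonPoly (m : ℕ) (a l m₀ ρ : ℝ) : ℝ :=
  (1 + l ^ 2 * ρ) * (ρ + a ^ 2) ^ m - 2 * m₀ * ρ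

/-- The coordinates `(τ, r, μ, φ)`, or tangent vectors `(dτ, dr, dμ, dφ)` in these coordinates. -/
abbrev BL (m : ℕ) : Type := ℝ × ℝ × (Fin m → ℝ) × (Fin m → ℝ)

/-- The line element `ds²` of the Kerr-AdS spacetime in generalized Boyer-Lindquist coordinates
`q = (τ, r, μ, φ)`, evaluated on the vector `X = (dτ, dr, dμ, dφ)`, where
`U = (r² + a²)^(m - 1)`. -/
def blLineElement (m : ℕ) (a l m₀ : ℝ) (q X : BL m) : ℝ :=
  let r := q.2.1
  let μ := q.2.2.1
  let dτ := X.1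
  let dr := X.2.1
  let dμ := X.2.2.1
  let dφ := X.2.2.2
  let U := (r ^ 2 + a ^ 2) ^ (m - 1);
  (-((1 + l ^ 2 * r ^ 2) / (1 - a ^ 2 * l ^ 2))) * dτ ^ 2
    + U * r ^ 2 * dr ^ 2 / ((1 + l ^ 2 * r ^ 2) * (r ^ 2 + a ^ 2) * U - 2 * m₀ * r ^ 2)
    + (r ^ 2 + a ^ 2) / (1 - a ^ 2 * l ^ 2) *
        ∑ i, (dμ i ^ 2 + μ i ^ 2 * (dφ i + a * l ^ 2 * dτ) ^ 2)
    + 2 * m₀ / U * (dτ - a / (1 - a ^ 2 * l ^ 2) * ∑ i, μ i ^ 2 * dφ i) ^ 2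

/-- The change of coordinates `(τ, r, μ, φ) ↦ (τ, r², (μ_i e^{i φ_i})_i)`. -/
def blMap {m : ℕ} (q : BL m) : Amb m :=
  (q.1, q.2.1 ^ 2, fun i => (q.2.2.1 i : ℂ) * Complex.exp (q.2.2.2 i * Complex.I))

/-- The coordinate form `dτ`. -/
def dτ (m : ℕ) : Amb m →L[ℝ] ℝ := ContinuousLinearMap.fst ℝ ℝ (ℝ × (Fin m → ℂ))

/-- The coordinate form `dρ`. -/
def dρ (m : ℕ) : Amb m →L[ℝ] ℝ :=
  (ContinuousLinearMap.fst ℝ ℝ (Fin m → ℂ)).comp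
    (ContinuousLinearMap.snd ℝ ℝ (ℝ × (Fin m → ℂ)))

/-- The complex coordinate form `dz_i`. -/
def dz {m : ℕ} (i : Fin m) : Amb m →L[ℝ] ℂ :=
  (ContinuousLinearMap.proj (R := ℝ) (φ := fun _ : Fin m => ℂ) i).comp
    ((ContinuousLinearMap.snd ℝ ℝ (Fin m → ℂ)).comp
      (ContinuousLinearMap.snd ℝ ℝ (ℝ × (Fin m → ℂ))))

/-- The tensor product `α ⊗ β` of linear forms: `(u, v) ↦ α u * β v`. -/
def tensorForm {m : ℕ} (α β : Amb m →L[ℝ] ℝ) : Amb m →L[ℝ] Amb m →L[ℝ] ℝ := α.smulRight β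

/-- The form `dz_i + i a l² z_i dτ`; its squared modulus is
`dμ_i² + μ_i² (dφ_i + a l² dτ)²`. -/
def twistedForm {m : ℕ} (a l : ℝ) (p : Amb m) (i : Fin m) : Amb m →L[ℝ] ℂ :=
  dz i + (dτ m).smulRight (((a * l ^ 2 : ℝ) : ℂ) * Complex.I * p.2.2 i)

/-- The form `∑ μ_i² dφ_i = ∑ Im (conj z_i dz_i)`. -/
def azimuthalForm {m : ℕ} (p : Amb m) : Amb m →L[ℝ] ℝ :=
  ∑ i, ((p.2.2 i).re • Complex.imCLM.comp (dz i) - (p.2.2 i).im • Complex.reCLM.comp (dz i))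

/-- The Boyer-Lindquist metric in the coordinate `ρ = r²` at `p = (τ, ρ, z)`, for all
`ρ > -a²` with `Φ(ρ) ≠ 0`. -/
def kerrAdS (m : ℕ) (a l m₀ : ℝ) : MetricField m := fun p =>
  let ρ := p.2.1
  let U := (ρ + a ^ 2) ^ (m - 1)
  let κ := dτ m - (a / (1 - a ^ 2 * l ^ 2)) • azimuthalForm p;
  (-((1 + l ^ 2 * ρ) / (1 - a ^ 2 * l ^ 2))) • tensorForm (dτ m) (dτ m)
    + (U / (4 * horizonPoly m a l m₀ ρ)) • tensorForm (dρ m) (dρ m)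
    + ((ρ + a ^ 2) / (1 - a ^ 2 * l ^ 2)) •
        ∑ i, (tensorForm (Complex.reCLM.comp (twistedForm a l p i))
                (Complex.reCLM.comp (twistedForm a l p i))
              + tensorForm (Complex.imCLM.comp (twistedForm a l p i))
                  (Complex.imCLM.comp (twistedForm a l p i)))
    + (2 * m₀ / U) • tensorForm κ κ

/-- The change of coordinates `(τ, ρ, φ_i) ↦ (τ + F(ρ), ρ, φ_i + H(ρ))`, i.e.
`(τ, ρ, z) ↦ (τ + F(ρ), ρ, e^{i H(ρ)} z)`. -/
def shift {m : ℕ} (F H : ℝ → ℝ) (p : Amb m) : Amb m :=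
  (p.1 + F p.2.1, p.2.1, Complex.exp (H p.2.1 * Complex.I) • p.2.2)

/-- `g` is a metric of the extended Kerr-AdS spacetime `N`: a Lorentzian metric which is smooth
for all `-a² < ρ < ∞`, which is the Boyer-Lindquist metric for `-a² < ρ ≤ 0`, and which away from
the horizons is the Boyer-Lindquist metric up to a change of the coordinates `τ` and `φ_i`
depending on `ρ` only. -/
structure IsExtendedMetric (m : ℕ) (a l m₀ : ℝ) (g : MetricField m) : Prop where
  smooth : ContDiffOn ℝ ∞ g {p | -a ^ 2 < p.2.1}
  lorentzian : ∀ p ∈ spacetime m a, IsLorentzianOn (g p) (tangent p)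
  eq_kerrAdS : ∀ p ∈ spacetime m a, p.2.1 ≤ 0 →
    ∀ u ∈ tangent p, ∀ v ∈ tangent p, g p u v = kerrAdS m a l m₀ p u v
  isometric : ∃ F H : ℝ → ℝ,
    ContDiffOn ℝ ∞ F {ρ | -a ^ 2 < ρ ∧ horizonPoly m a l m₀ ρ ≠ 0} ∧
    ContDiffOn ℝ ∞ H {ρ | -a ^ 2 < ρ ∧ horizonPoly m a l m₀ ρ ≠ 0} ∧
    ∀ p ∈ spacetime m a, horizonPoly m a l m₀ p.2.1 ≠ 0 →
      ∀ u ∈ tangent p, ∀ v ∈ tangent p,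
        g (shift F H p) (fderiv ℝ (shift F H) p u) (fderiv ℝ (shift F H) p v) =
          kerrAdS m a l m₀ p u v

/-- The vector with components `dτ = 0`, `dρ = 0`, `dμ = ν`, `dφ = 0` at a point with azimuthal
coordinates `φ`. -/
def latitudinal {m : ℕ} (φ ν : Fin m → ℝ) : Amb m :=
  (0, 0, fun i => (ν i : ℂ) * Complex.exp (φ i * Complex.I))

end KerrAdS

end

/-! The metric depends on the point of the sphere only through the Hopf fibration: it is built from
`dτ`, `dρ`, the contact form θ = ∑ μ_i² dφ_i and the horizontal part of the round metric. With κ =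
dτ - a θ / (1 - a² l²), η = θ + a l² dτ and U = (ρ + a²)^(m-1) it becomes P κ² + 2 Q κ η + ρ η² + (U
/ (4 Φ)) dρ² + ((ρ + a²) / (1 - a² l²)) |horizontal|², see `metricForm_normalForm`, and the κ, η
block satisfies (P ρ - Q²) U = -Φ (`det_coeff`). So where Φ > 0 this block is Lorentzian and the
rest positive, which settles both the metric and its restriction to {ρ = const}. Where ρ > 0,
completing the square in η leaves a κ, dρ block whose determinant is negative for either sign of Φ.

For the extension, allow a coefficient ψ of dρ² and a cross term -2σ dρ κ. Replacing κ by κ - ρ q dρ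
and η by η + Q q dρ, which is the effect of a change of coordinates with shifts F(ρ) and H(ρ),
produces no η dρ term. With q = U σ / Φ it removes the κ dρ term, and the coefficient of dρ² comes
out right exactly if Φ ψ + ρ U σ² = U / 4 (`metricForm_shift`). At a horizon this asks for σ² = 1 /
(4ρ), which is possible because all horizons have ρ > 0. A cutoff χ, zero for ρ ≤ 0 and one near
every horizon, gives the regular solution σ = χ / (2√ρ), ψ = (1 - χ²) U / (4 Φ)
(`exists_regular_coefficients`).

Curvature is determined by the second-order jet of the metric (`riemannLow_eq`), which is computed
at the centre of each patch (`hasJet_modelMetric`). On latitudinal planes the symplectic form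
vanishes, and a Gauss equation gives the sectional curvature -l² + 2 m₀ ρ / (ρ + a²)^(m+1), which
tends to -∞ (`sectionalAt_kerrAdS_of_latitudinal`). For m = 2 the latitudinal spheres are circles
and contain no planes. There the curvature operator on two-forms is a 10 × 10 matrix in a frame dual
to κ, dρ, η and the horizontal directions: l² times the identity plus a trace-free part of size m₀ /
(ρ + a²)³ (`frameRiemann_eq`). The trace of its square is the Kretschmann scalar
(`kretschmannAt_kerrAdS`). The extended metric coincides with the original one near every point with
ρ < 0, so it inherits both singularities. -/

section

set_option maxSynthPendingDepth 4
set_option linter.unusedSectionVars false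

noncomputable section

namespace KerrAdS

/-! ### The curvature tensor from the first two derivatives of the metric -/

section Curvature

variable {V : Type*} [NormedAddCommGroup V] [NormedSpace ℝ V]

/-- The second derivatives `∂_b ∂_a G(u, v)`. -/
def metricHessian (G : V → V →L[ℝ] V →L[ℝ] ℝ) (x b a u v : V) : ℝ :=
  fderiv ℝ (fun y => fderiv ℝ G y a u v) x b

variable {G : V → V →L[ℝ] V →L[ℝ] ℝ} {x : V}

theorem apply_inverse_of_isInvertible {E F : Type*} [NormedAddCommGroup E] [NormedSpace ℝ E]
    [NormedAddCommGroup F] [NormedSpace ℝ F] {A : E →L[ℝ] F} (hA : A.IsInvertible) (y : F) :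
    A (A.inverse y) = y := by
  obtain ⟨e, rfl⟩ := hA
  simp

theorem inverse_apply_of_isInvertible {E F : Type*} [NormedAddCommGroup E] [NormedSpace ℝ E]
    [NormedAddCommGroup F] [NormedSpace ℝ F] {A : E →L[ℝ] F} (hA : A.IsInvertible) (y : E) :
    A.inverse (A y) = y := by
  obtain ⟨e, rfl⟩ := hA
  simp

theorem differentiableAt_fderiv (hG : ContDiffAt ℝ 2 G x) :
    DifferentiableAt ℝ (fderiv ℝ G) x :=
  (hG.fderiv_right (m := 1) (by norm_num)).differentiableAt (by norm_num)

theorem differentiableAt_fderiv_apply (hG : ContDiffAt ℝ 2 G x) (a u v : V) :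
    DifferentiableAt ℝ (fun y => fderiv ℝ G y a u v) x := by
  have := differentiableAt_fderiv hG
  fun_prop

theorem differentiableAt_christoffelFst (hG : ContDiffAt ℝ 2 G x) (u v : V) :
    DifferentiableAt ℝ (fun y => christoffelFst G y u v) x := by
  have h := differentiableAt_fderiv hG
  have hf : ∀ u v, DifferentiableAt ℝ (fun y => fderiv ℝ G y u v) x := fun u v => by fun_prop
  have h2 : DifferentiableAt ℝ (fun y => ((fderiv ℝ G y).flip u).flip v) x := by
    have e : (fun y => ((fderiv ℝ G y).flip u).flip v) =
        fun y => (ContinuousLinearMap.compL ℝ V (V →L[ℝ] ℝ) ℝ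
          (ContinuousLinearMap.apply ℝ ℝ v)) ((ContinuousLinearMap.compL ℝ V (V →L[ℝ] V →L[ℝ] ℝ)
            (V →L[ℝ] ℝ) (ContinuousLinearMap.apply ℝ (V →L[ℝ] ℝ) u)) (fderiv ℝ G y)) := by
      ext y z
      simp
    rw [e]
    fun_prop
  exact (((hf u v).add (hf v u)).sub h2).const_smul (1 / 2 : ℝ)

theorem christoffelFst_apply (u v w : V) : christoffelFst G x u v w =
    (fderiv ℝ G x u v w + fderiv ℝ G x v u w - fderiv ℝ G x w u v) / 2 := by
  simp [christoffelFst]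
  ring

theorem fderiv_christoffelFst (hG : ContDiffAt ℝ 2 G x) (u v w z : V) :
    fderiv ℝ (fun y => christoffelFst G y v w) x u z =
      (metricHessian G x u v w z + metricHessian G x u w v z - metricHessian G x u z v w) / 2 := by
  have h1 : fderiv ℝ (fun y => christoffelFst G y v w) x u z =
      fderiv ℝ (fun y => christoffelFst G y v w z) x u := by
    rw [fderiv_clm_apply (differentiableAt_christoffelFst hG v w) (differentiableAt_const z)]
    simp
  have d := differentiableAt_fderiv_apply hG
  rw [h1]
  simp only [christoffelFst_apply, metricHessian]
  have : HasFDerivAt (fun y => (fderiv ℝ G y v w z + fderiv ℝ G y w v z - fderiv ℝ G y z v w) / 2)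
      ((2 : ℝ)⁻¹ • (fderiv ℝ (fun y => fderiv ℝ G y v w z) x
        + fderiv ℝ (fun y => fderiv ℝ G y w v z) x
        - fderiv ℝ (fun y => fderiv ℝ G y z v w) x)) x := by
    simp only [div_eq_inv_mul]
    exact (((d v w z).hasFDerivAt.add (d w v z).hasFDerivAt).sub
      (d z v w).hasFDerivAt).const_mul _
  rw [this.fderiv]
  simp
  ring

theorem eventually_isInvertible [FiniteDimensional ℝ V] (hG : ContinuousAt G x) (hinv : (G x).IsInvertible) :
    ∀ᶠ y in nhds x, (G y).IsInvertible := by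
  obtain ⟨e, he⟩ := hinv
  have := ContinuousLinearEquiv.nhds e
  rw [he] at this
  filter_upwards [hG this] with y hy
  obtain ⟨e', he'⟩ := hy
  exact ⟨e', he'⟩

theorem differentiableAt_christoffel [FiniteDimensional ℝ V] (hG : ContDiffAt ℝ 2 G x) (hinv : (G x).IsInvertible)
    (v w : V) : DifferentiableAt ℝ (fun y => christoffel G y v w) x := by
  obtain ⟨e, he⟩ := hinv
  have h1 : ContDiffAt ℝ 1 (ContinuousLinearMap.inverse : (V →L[ℝ] V →L[ℝ] ℝ) → _) (G x) := by
    rw [← he]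
    exact contDiffAt_map_inverse e
  have h2 : DifferentiableAt ℝ (fun y => (G y).inverse) x :=
    (h1.differentiableAt (by norm_num)).comp x (hG.differentiableAt (by norm_num))
  exact h2.clm_apply (differentiableAt_christoffelFst hG v w)

/-- Obtained from the product rule applied to G(Γ(v, w)) = `christoffelFst`, which holds near `x`
because invertibility is an open condition. The derivative of the inverse metric never has to be
computed. -/
theorem apply_fderiv_christoffel [FiniteDimensional ℝ V] (hG : ContDiffAt ℝ 2 G x) (hinv : (G x).IsInvertible)
    (u v w z : V) : G x (fderiv ℝ (fun y => christoffel G y v w) x u) z =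
      fderiv ℝ (fun y => christoffelFst G y v w) x u z
        - fderiv ℝ G x u (christoffel G x v w) z := by
  have e : (fun y => G y (christoffel G y v w)) =ᶠ[nhds x] fun y => christoffelFst G y v w := by
    filter_upwards [eventually_isInvertible hG.continuousAt hinv] with y hy
    exact apply_inverse_of_isInvertible hy _
  have h := e.fderiv_eq (𝕜 := ℝ)
  rw [fderiv_clm_apply (hG.differentiableAt (by norm_num))
    (differentiableAt_christoffel hG hinv v w)] at h
  rw [← h]
  simp

theorem fderiv_metric_symm (hG : DifferentiableAt ℝ G x) (hsymm : ∀ y u v, G y u v = G y v u)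
    (a u v : V) : fderiv ℝ G x a u v = fderiv ℝ G x a v u := by
  have h : ∀ u v : V, fderiv ℝ G x a u v = fderiv ℝ (fun y => G y u v) x a := by
    intro u v
    rw [fderiv_clm_apply (by fun_prop) (by fun_prop), fderiv_clm_apply (by fun_prop) (by fun_prop)]
    simp
  rw [h, h]
  simp only [hsymm _ u v]

/-- The covariant curvature tensor in terms of the derivatives of the metric at a point. -/
theorem riemannLow_eq [FiniteDimensional ℝ V] (hG : ContDiffAt ℝ 2 G x) (hinv : (G x).IsInvertible)
    (hsymm : ∀ y u v, G y u v = G y v u)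
    (hschwarz : ∀ a b u v, metricHessian G x a b u v = metricHessian G x b a u v) (u v w z : V) :
    riemannLow G x u v w z =
      (metricHessian G x u w v z - metricHessian G x u z v w
        - metricHessian G x v w u z + metricHessian G x v z u w) / 2
      - christoffelFst G x u z (christoffel G x v w)
      + christoffelFst G x v z (christoffel G x u w) := by
  have hs := fderiv_metric_symm (hG.differentiableAt (by norm_num)) hsymm
  have hΓ : ∀ a b, G x (christoffel G x a b) = christoffelFst G x a b := fun a b =>
    apply_inverse_of_isInvertible hinv _
  -- ∂_u ∂_v G(w, z) occurs in both differentiated Christoffel symbols and cancels once the order of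
  -- differentiation is exchanged.
  have hsym2 : metricHessian G x u v w z = metricHessian G x v u w z := hschwarz _ _ _ _
  simp only [riemannLow, riemann, map_add, map_sub, add_apply,
    sub_apply, apply_fderiv_christoffel hG hinv, fderiv_christoffelFst hG, hΓ]
  simp only [christoffelFst_apply, hsym2]
  rw [hs u (christoffel G x v w) z, hs v (christoffel G x u w) z]
  rw [hs z u, hs z v, hs u z _, hs v z]
  ring

end Curvature

end KerrAdS

end

noncomputable section

namespace KerrAdS

/-! ### Second-order jets of real functions and of metric components -/

section Jets

variable {V : Type*} [NormedAddCommGroup V] [NormedSpace ℝ V]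

/-- The second-order jet of a real function at a point: its value, its first derivatives `d a` and
its second derivatives `h b a = ∂_b ∂_a f`. -/
structure HasJet (f : V → ℝ) (x : V) (c : ℝ) (d : V → ℝ) (h : V → V → ℝ) : Prop where
  smooth : ContDiffAt ℝ 2 f x
  val : f x = c
  fst : ∀ a, fderiv ℝ f x a = d a
  snd : ∀ b a, fderiv ℝ (fun y => fderiv ℝ f y a) x b = h b a

namespace HasJet

variable {f g : V → ℝ} {x : V} {c c' : ℝ} {d d' : V → ℝ} {h h' : V → V → ℝ}

theorem congr (hf : HasJet f x c d h) (hc : c = c') (hd : ∀ a, d a = d' a)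
    (hh : ∀ b a, h b a = h' b a) : HasJet f x c' d' h' :=
  ⟨hf.smooth, hf.val.trans hc, fun a => (hf.fst a).trans (hd a),
    fun b a => (hf.snd b a).trans (hh b a)⟩

theorem congr_fun (hf : HasJet f x c d h) (e : g =ᶠ[nhds x] f) : HasJet g x c d h where
  smooth := hf.smooth.congr_of_eventuallyEq e
  val := e.eq_of_nhds.trans hf.val
  fst a := by rw [e.fderiv_eq, hf.fst]
  snd b a := by
    have : (fun y => fderiv ℝ g y a) =ᶠ[nhds x] fun y => fderiv ℝ f y a := by
      filter_upwards [e.fderiv (𝕜 := ℝ)] with y hy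
      rw [hy]
    rw [this.fderiv_eq, hf.snd]

theorem eventually_differentiableAt (hf : HasJet f x c d h) :
    ∀ᶠ y in nhds x, DifferentiableAt ℝ f y := by
  have := hf.smooth.eventually (by simp)
  filter_upwards [this] with y hy
  exact hy.differentiableAt (by norm_num)

theorem differentiableAt_fderiv_apply (hf : HasJet f x c d h) (a : V) :
    DifferentiableAt ℝ (fun y => fderiv ℝ f y a) x := by
  have : DifferentiableAt ℝ (fderiv ℝ f) x :=
    (hf.smooth.fderiv_right (m := 1) (by norm_num)).differentiableAt (by norm_num)
  fun_prop

theorem differentiableAt (hf : HasJet f x c d h) : DifferentiableAt ℝ f x :=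
  hf.smooth.differentiableAt (by norm_num)

theorem const (c : ℝ) (x : V) : HasJet (fun _ => c) x c (fun _ => 0) (fun _ _ => 0) where
  smooth := contDiffAt_const
  val := rfl
  fst a := by simp
  snd b a := by simp

theorem linear [FiniteDimensional ℝ V] (L : V →ₗ[ℝ] ℝ) (x : V) :
    HasJet (fun y => L y) x (L x) (fun a => L a) (fun _ _ => 0) := by
  have e : (fun y => L y) = (LinearMap.toContinuousLinearMap L : V → ℝ) := by ext y; simp
  rw [e]
  refine ⟨ContinuousLinearMap.contDiff _ |>.contDiffAt, rfl, fun a => ?_, fun b a => ?_⟩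
  · rw [ContinuousLinearMap.fderiv]
  · simp only [ContinuousLinearMap.fderiv]
    simp

theorem add (hf : HasJet f x c d h) (hg : HasJet g x c' d' h') :
    HasJet (fun y => f y + g y) x (c + c') (fun a => d a + d' a) (fun b a => h b a + h' b a) where
  smooth := hf.smooth.add hg.smooth
  val := by rw [hf.val, hg.val]
  fst a := by
    rw [fderiv_fun_add hf.differentiableAt hg.differentiableAt, add_apply, hf.fst, hg.fst]
  snd b a := by
    have e : (fun y => fderiv ℝ (fun y => f y + g y) y a) =ᶠ[nhds x]
        fun y => fderiv ℝ f y a + fderiv ℝ g y a := by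
      filter_upwards [hf.eventually_differentiableAt, hg.eventually_differentiableAt] with y h1 h2
      rw [fderiv_fun_add h1 h2, add_apply]
    rw [e.fderiv_eq, fderiv_fun_add (hf.differentiableAt_fderiv_apply a)
      (hg.differentiableAt_fderiv_apply a), add_apply, hf.snd, hg.snd]

theorem mul (hf : HasJet f x c d h) (hg : HasJet g x c' d' h') :
    HasJet (fun y => f y * g y) x (c * c') (fun a => c * d' a + c' * d a)
      (fun b a => c * h' b a + d b * d' a + (c' * h b a + d' b * d a)) where
  smooth := hf.smooth.mul hg.smooth
  val := by rw [hf.val, hg.val]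
  fst a := by
    rw [fderiv_fun_mul hf.differentiableAt hg.differentiableAt]
    simp [hf.fst, hg.fst, hf.val, hg.val]
  snd b a := by
    have e : (fun y => fderiv ℝ (fun y => f y * g y) y a) =ᶠ[nhds x]
        fun y => f y * fderiv ℝ g y a + g y * fderiv ℝ f y a := by
      filter_upwards [hf.eventually_differentiableAt, hg.eventually_differentiableAt] with y h1 h2
      rw [fderiv_fun_mul h1 h2]
      simp
    have df := hf.differentiableAt_fderiv_apply a
    have dg := hg.differentiableAt_fderiv_apply a
    rw [e.fderiv_eq, fderiv_fun_add (hf.differentiableAt.fun_mul dg)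
      (hg.differentiableAt.fun_mul df), fderiv_fun_mul hf.differentiableAt dg,
      fderiv_fun_mul hg.differentiableAt df]
    simp only [add_apply, smul_apply, smul_eq_mul, hf.fst, hg.fst, hf.snd, hg.snd, hf.val, hg.val]
    ring

theorem const_mul (hf : HasJet f x c d h) (k : ℝ) :
    HasJet (fun y => k * f y) x (k * c) (fun a => k * d a) (fun b a => k * h b a) :=
  ((const k x).mul hf).congr rfl (fun a => by ring) (fun b a => by ring)

theorem sub (hf : HasJet f x c d h) (hg : HasJet g x c' d' h') :
    HasJet (fun y => f y - g y) x (c - c') (fun a => d a - d' a) (fun b a => h b a - h' b a) := by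
  have := (hf.add (hg.const_mul (-1))).congr (c' := c - c') (d' := fun a => d a - d' a)
    (h' := fun b a => h b a - h' b a) (by ring) (fun a => by ring) (fun b a => by ring)
  exact this.congr_fun (Filter.Eventually.of_forall fun y => by ring)

theorem sum {ι : Type*} (s : Finset ι) {f : ι → V → ℝ} {c : ι → ℝ} {d : ι → V → ℝ}
    {h : ι → V → V → ℝ} (hf : ∀ i ∈ s, HasJet (f i) x (c i) (d i) (h i)) :
    HasJet (fun y => ∑ i ∈ s, f i y) x (∑ i ∈ s, c i) (fun a => ∑ i ∈ s, d i a)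
      (fun b a => ∑ i ∈ s, h i b a) := by
  classical
  induction s using Finset.induction_on with
  | empty => simpa using const (0 : ℝ) x
  | insert i s his ih =>
    simp only [Finset.sum_insert his]
    exact (hf i (by simp)).add (ih fun j hj => hf j (by simp [hj]))

/-- The jet of a composition with a function of one real variable. -/
theorem comp {φ φ' : ℝ → ℝ} {φ'' : ℝ} (hf : HasJet f x c d h) (hφ : ContDiffAt ℝ 2 φ c)
    (h1 : ∀ᶠ t in nhds c, HasDerivAt φ (φ' t) t) (h2 : HasDerivAt φ' φ'' c) :
    HasJet (fun y => φ (f y)) x (φ c) (fun a => φ' c * d a)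
      (fun b a => φ' c * h b a + φ'' * d b * d a) where
  smooth := ContDiffAt.comp x (by rw [hf.val]; exact hφ) hf.smooth
  val := by rw [hf.val]
  fst a := by
    have := HasDerivAt.comp_hasFDerivAt x (by rw [hf.val]; exact h1.self_of_nhds)
      hf.differentiableAt.hasFDerivAt
    have e : fderiv ℝ (fun y => φ (f y)) x = _ := this.fderiv
    rw [e]
    simp [hf.fst]
  snd b a := by
    have hc : Filter.Tendsto f (nhds x) (nhds c) := by
      have := hf.differentiableAt.continuousAt.tendsto
      rwa [hf.val] at this
    have e : (fun y => fderiv ℝ (fun y => φ (f y)) y a) =ᶠ[nhds x]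
        fun y => φ' (f y) * fderiv ℝ f y a := by
      filter_upwards [hf.eventually_differentiableAt, hc.eventually h1] with y hy hy1
      have e' : fderiv ℝ (fun y => φ (f y)) y = _ :=
        (HasDerivAt.comp_hasFDerivAt y hy1 hy.hasFDerivAt).fderiv
      rw [e']
      simp
    have h2' : HasFDerivAt (fun y => φ' (f y)) (φ'' • fderiv ℝ f x) x :=
      HasDerivAt.comp_hasFDerivAt x (by rw [hf.val]; exact h2) hf.differentiableAt.hasFDerivAt
    rw [e.fderiv_eq, fderiv_fun_mul h2'.differentiableAt (hf.differentiableAt_fderiv_apply a),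
      h2'.fderiv]
    simp only [add_apply, smul_apply, smul_eq_mul, hf.fst, hf.snd, hf.val]
    ring

end HasJet

/-- A linear map on a finite-dimensional space corresponds, through a continuous linear equivalence,
to the tuple of its values on a basis, so smoothness can be tested vector by vector. -/
theorem contDiffAt_clm_apply {F : Type*} [NormedAddCommGroup F] [NormedSpace ℝ F]
    [FiniteDimensional ℝ V] {A : V → V →L[ℝ] F} {x : V} {n : WithTop ℕ∞}
    (hA : ∀ u, ContDiffAt ℝ n (fun y => A y u) x) : ContDiffAt ℝ n A x := by
  let d := Module.finrank ℝ V
  have hd : d = Module.finrank ℝ (Fin d → ℝ) := (Module.finrank_fin_fun ℝ).symm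
  let e₁ := ContinuousLinearEquiv.ofFinrankEq hd
  let e₂ := (e₁.arrowCongr (1 : F ≃L[ℝ] F)).trans (ContinuousLinearEquiv.piRing (Fin d))
  rw [← Function.id_comp A, ← e₂.symm_comp_self]
  exact e₂.symm.contDiff.contDiffAt.comp x (contDiffAt_pi.mpr fun i => hA _)

/-- A metric is twice differentiable if all its components are. -/
theorem contDiffAt_of_hasJet [FiniteDimensional ℝ V] {G : V → V →L[ℝ] V →L[ℝ] ℝ} {x : V}
    {g₀ : V → V → ℝ} {g₁ : V → V → V → ℝ} {g₂ : V → V → V → V → ℝ}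
    (hG : ∀ u v, HasJet (fun y => G y u v) x (g₀ u v) (fun a => g₁ a u v)
      (fun b a => g₂ b a u v)) : ContDiffAt ℝ 2 G x :=
  contDiffAt_clm_apply fun u => contDiffAt_clm_apply fun v => (hG u v).smooth

/-- Evaluation on fixed vectors is continuous and linear, hence commutes with differentiation; the
jets of the scalar components therefore give the derivatives of the metric. -/
theorem fderiv_metric_of_hasJet {G : V → V →L[ℝ] V →L[ℝ] ℝ} {x : V}
    {g₀ : V → V → ℝ} {g₁ : V → V → V → ℝ} {g₂ : V → V → V → V → ℝ}
    (hG : ∀ u v, HasJet (fun y => G y u v) x (g₀ u v) (fun a => g₁ a u v)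
      (fun b a => g₂ b a u v)) (hs : DifferentiableAt ℝ G x) (a u v : V) :
    fderiv ℝ G x a u v = g₁ a u v := by
  rw [← (hG u v).fst, fderiv_clm_apply (by fun_prop) (by fun_prop),
    fderiv_clm_apply (by fun_prop) (by fun_prop)]
  simp

theorem metricHessian_of_hasJet {G : V → V →L[ℝ] V →L[ℝ] ℝ} {x : V}
    {g₀ : V → V → ℝ} {g₁ : V → V → V → ℝ} {g₂ : V → V → V → V → ℝ}
    (hG : ∀ u v, HasJet (fun y => G y u v) x (g₀ u v) (fun a => g₁ a u v)
      (fun b a => g₂ b a u v)) (hs : ContDiffAt ℝ 2 G x) (b a u v : V) :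
    metricHessian G x b a u v = g₂ b a u v := by
  rw [← (hG u v).snd, metricHessian]
  refine congrArg (fun A : V →L[ℝ] ℝ => A b) (Filter.EventuallyEq.fderiv_eq ?_)
  filter_upwards [hs.eventually (by simp)] with y hy
  have hd : DifferentiableAt ℝ G y := hy.differentiableAt (by norm_num)
  rw [fderiv_clm_apply (by fun_prop) (by fun_prop),
    fderiv_clm_apply (by fun_prop) (by fun_prop)]
  simp

end Jets

end KerrAdS

end

noncomputable section

namespace KerrAdS

/-! ### The real and imaginary parts of the Hermitian product on ℂ^m -/

section Hermitian

variable {m : ℕ}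

/-- The real part of the Hermitian inner product on `ℂ^m`. -/
def realInner : (Fin m → ℂ) →ₗ[ℝ] (Fin m → ℂ) →ₗ[ℝ] ℝ :=
  LinearMap.mk₂ ℝ (fun w v => ∑ i, ((w i).re * (v i).re + (w i).im * (v i).im))
    (fun _ _ _ => by
      rw [← Finset.sum_add_distrib]
      exact Finset.sum_congr rfl fun i _ => by simp; ring)
    (fun _ _ _ => by
      rw [smul_eq_mul, Finset.mul_sum]
      exact Finset.sum_congr rfl fun i _ => by simp; ring)
    (fun _ _ _ => by
      rw [← Finset.sum_add_distrib]
      exact Finset.sum_congr rfl fun i _ => by simp; ring)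
    (fun _ _ _ => by
      rw [smul_eq_mul, Finset.mul_sum]
      exact Finset.sum_congr rfl fun i _ => by simp; ring)

/-- The imaginary part of the Hermitian inner product on `ℂ^m`. -/
def symp : (Fin m → ℂ) →ₗ[ℝ] (Fin m → ℂ) →ₗ[ℝ] ℝ :=
  LinearMap.mk₂ ℝ (fun w v => ∑ i, ((w i).re * (v i).im - (w i).im * (v i).re))
    (fun _ _ _ => by
      rw [← Finset.sum_add_distrib]
      exact Finset.sum_congr rfl fun i _ => by simp; ring)
    (fun _ _ _ => by
      rw [smul_eq_mul, Finset.mul_sum]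
      exact Finset.sum_congr rfl fun i _ => by simp; ring)
    (fun _ _ _ => by
      rw [← Finset.sum_add_distrib]
      exact Finset.sum_congr rfl fun i _ => by simp; ring)
    (fun _ _ _ => by
      rw [smul_eq_mul, Finset.mul_sum]
      exact Finset.sum_congr rfl fun i _ => by simp; ring)

theorem realInner_apply (w v : Fin m → ℂ) :
    realInner w v = ∑ i, ((w i).re * (v i).re + (w i).im * (v i).im) := rfl

theorem symp_apply (w v : Fin m → ℂ) :
    symp w v = ∑ i, ((w i).re * (v i).im - (w i).im * (v i).re) := rfl

theorem realInner_comm (w v : Fin m → ℂ) : realInner w v = realInner v w := by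
  simp only [realInner_apply]
  exact Finset.sum_congr rfl fun i _ => by ring

theorem symp_antisymm (w v : Fin m → ℂ) : symp w v = -symp v w := by
  simp only [symp_apply, ← Finset.sum_neg_distrib]
  exact Finset.sum_congr rfl fun i _ => by ring

theorem symp_self (w : Fin m → ℂ) : symp w w = 0 := by
  have := symp_antisymm w w
  linarith

theorem realInner_I_smul (w v : Fin m → ℂ) : realInner (Complex.I • w) v = symp w v := by
  simp only [realInner_apply, symp_apply]
  exact Finset.sum_congr rfl fun i _ => by simp; ring

theorem symp_I_smul (w v : Fin m → ℂ) : symp (Complex.I • w) v = -realInner w v := by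
  simp only [realInner_apply, symp_apply, ← Finset.sum_neg_distrib]
  exact Finset.sum_congr rfl fun i _ => by simp; ring

theorem realInner_smul_I (w v : Fin m → ℂ) : realInner w (Complex.I • v) = -symp w v := by
  rw [realInner_comm, realInner_I_smul, symp_antisymm]

theorem symp_smul_I (w v : Fin m → ℂ) : symp w (Complex.I • v) = realInner w v := by
  rw [symp_antisymm, symp_I_smul, neg_neg, realInner_comm]

theorem realInner_unit_smul {c : ℂ} (hc : ‖c‖ = 1) (w v : Fin m → ℂ) :
    realInner (c • w) (c • v) = realInner w v := by
  have h : c.re * c.re + c.im * c.im = 1 := by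
    rw [← Complex.normSq_apply, Complex.normSq_eq_norm_sq, hc, one_pow]
  simp only [realInner_apply]
  refine Finset.sum_congr rfl fun i _ => ?_
  simp only [Pi.smul_apply, smul_eq_mul, Complex.mul_re, Complex.mul_im]
  linear_combination ((w i).re * (v i).re + (w i).im * (v i).im) * h

theorem symp_unit_smul {c : ℂ} (hc : ‖c‖ = 1) (w v : Fin m → ℂ) :
    symp (c • w) (c • v) = symp w v := by
  rw [← realInner_I_smul, smul_comm, realInner_unit_smul hc, realInner_I_smul]

theorem realInner_self (w : Fin m → ℂ) : realInner w w = ∑ i, ‖w i‖ ^ 2 := by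
  rw [realInner_apply]
  refine Finset.sum_congr rfl fun i _ => ?_
  rw [← Complex.normSq_eq_norm_sq, Complex.normSq_apply]

theorem realInner_self_nonneg (w : Fin m → ℂ) : 0 ≤ realInner w w := by
  rw [realInner_self]
  positivity

theorem realInner_self_pos {w : Fin m → ℂ} (hw : w ≠ 0) : 0 < realInner w w := by
  obtain ⟨i, hi⟩ := Function.ne_iff.mp hw
  rw [realInner_self]
  exact Finset.sum_pos' (fun j _ => by positivity)
    ⟨i, Finset.mem_univ i, pow_pos (norm_pos_iff.mpr hi) 2⟩

theorem mem_spacetime_iff {a : ℝ} {p : Amb m} :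
    p ∈ spacetime m a ↔ -a ^ 2 < p.2.1 ∧ realInner p.2.2 p.2.2 = 1 := by
  rw [realInner_self]
  rfl

theorem mem_tangent_iff {p v : Amb m} : v ∈ tangent p ↔ realInner p.2.2 v.2.2 = 0 := Iff.rfl

theorem realInner_tangent {p : Amb m} (v : tangent p) : realInner p.2.2 (v : Amb m).2.2 = 0 := v.2

theorem mem_levelTangent_iff {p v : Amb m} :
    v ∈ levelTangent p ↔ realInner p.2.2 v.2.2 = 0 ∧ v.2.1 = 0 := Iff.rfl

/-- The azimuthal form is the contact form of the sphere, so the whole metric can be handled through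
`realInner` and `symp`. -/
theorem azimuthalForm_apply (p v : Amb m) : azimuthalForm p v = symp p.2.2 v.2.2 := by
  simp [azimuthalForm, symp_apply, dz]

end Hermitian

/-! ### A family containing both the original and the extended metric -/

section MetricForms

variable (m : ℕ) (a l m₀ : ℝ)

/-- The metrics which agree with the Boyer-Lindquist metric except for the `dρ dρ` component,
which is `ψ(ρ)`, and the additional term `-σ(ρ) (dρ κ + κ dρ)`, where
`κ = dτ - a / (1 - a² l²) ∑ μ_i² dφ_i`. -/
def metricForm (ψ σ : ℝ → ℝ) : MetricField m := fun p =>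
  let ρ := p.2.1
  let U := (ρ + a ^ 2) ^ (m - 1)
  let κ := dτ m - (a / (1 - a ^ 2 * l ^ 2)) • azimuthalForm p;
  (-((1 + l ^ 2 * ρ) / (1 - a ^ 2 * l ^ 2))) • tensorForm (dτ m) (dτ m)
    + ψ ρ • tensorForm (dρ m) (dρ m)
    + ((ρ + a ^ 2) / (1 - a ^ 2 * l ^ 2)) •
        ∑ i, (tensorForm (Complex.reCLM.comp (twistedForm a l p i))
                (Complex.reCLM.comp (twistedForm a l p i))
              + tensorForm (Complex.imCLM.comp (twistedForm a l p i))
                  (Complex.imCLM.comp (twistedForm a l p i)))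
    + (2 * m₀ / U) • tensorForm κ κ
    - σ ρ • (tensorForm (dρ m) κ + tensorForm κ (dρ m))

/-- The coefficient of `dρ dρ` in the Boyer-Lindquist metric. -/
def radialCoeff (ρ : ℝ) : ℝ := (ρ + a ^ 2) ^ (m - 1) / (4 * horizonPoly m a l m₀ ρ)

theorem kerrAdS_eq_metricForm :
    kerrAdS m a l m₀ = metricForm m a l m₀ (radialCoeff m a l m₀) (fun _ => 0) := by
  ext1 p
  simp only [kerrAdS, metricForm, radialCoeff, zero_smul, sub_zero]

variable {m}

/-- The form `κ = dτ - a / (1 - a² l²) ∑ μ_i² dφ_i`. -/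
def kappa (p v : Amb m) : ℝ := v.1 - a / (1 - a ^ 2 * l ^ 2) * symp p.2.2 v.2.2

variable {a l m₀}

theorem realInner_twistedForm (p u v : Amb m) :
    ∑ i, ((twistedForm a l p i u).re * (twistedForm a l p i v).re
      + (twistedForm a l p i u).im * (twistedForm a l p i v).im) =
      realInner u.2.2 v.2.2 + a * l ^ 2 * (u.1 * symp p.2.2 v.2.2 + v.1 * symp p.2.2 u.2.2)
        + (a * l ^ 2) ^ 2 * (u.1 * v.1) * realInner p.2.2 p.2.2 := by
  simp only [realInner_apply, symp_apply, Finset.mul_sum, ← Finset.sum_add_distrib]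
  refine Finset.sum_congr rfl fun i _ => ?_
  simp only [twistedForm]
  generalize a * l ^ 2 = k
  simp [dz, dτ]
  ring

theorem metricForm_apply (ψ σ : ℝ → ℝ) (p u v : Amb m) :
    metricForm m a l m₀ ψ σ p u v =
      -((1 + l ^ 2 * p.2.1) / (1 - a ^ 2 * l ^ 2)) * (u.1 * v.1) + ψ p.2.1 * (u.2.1 * v.2.1)
      + (p.2.1 + a ^ 2) / (1 - a ^ 2 * l ^ 2) * (realInner u.2.2 v.2.2
        + a * l ^ 2 * (u.1 * symp p.2.2 v.2.2 + v.1 * symp p.2.2 u.2.2)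
        + (a * l ^ 2) ^ 2 * (u.1 * v.1) * realInner p.2.2 p.2.2)
      + 2 * m₀ / (p.2.1 + a ^ 2) ^ (m - 1) * (kappa a l p u * kappa a l p v)
      - σ p.2.1 * (u.2.1 * kappa a l p v + kappa a l p u * v.2.1) := by
  rw [← realInner_twistedForm]
  simp [metricForm, tensorForm, dτ, dρ, kappa, azimuthalForm_apply]
  ring

end MetricForms

end KerrAdS

end

noncomputable section

namespace KerrAdS

/-! ### Normal form of the metric with respect to the Hopf fibration -/

section NormalForm

variable {m : ℕ} {a l m₀ : ℝ}

variable (a l) in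
/-- The form `∑ μ_i² (dφ_i + a l² dτ)`. -/
def etaTilde (p v : Amb m) : ℝ := symp p.2.2 v.2.2 + a * l ^ 2 * v.1

/-- The horizontal part of a vector of the sphere with respect to the Hopf fibration. -/
def horizontal (z w : Fin m → ℂ) : Fin m → ℂ := w - symp z w • (Complex.I • z)

/-- Since |z| = 1, the vector i z is a unit vector and `symp z w` is the component of `w` along it;
this is Pythagoras for the Hopf fibre. -/
theorem realInner_horizontal {z : Fin m → ℂ} (hz : realInner z z = 1) (u v : Fin m → ℂ) :
    realInner (horizontal z u) (horizontal z v) = realInner u v - symp z u * symp z v := by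
  simp only [horizontal, map_sub, map_smul, LinearMap.sub_apply, LinearMap.smul_apply,
    realInner_I_smul, realInner_smul_I, symp_I_smul, smul_eq_mul, hz,
    symp_antisymm u z]
  ring

variable (m a l m₀) in
/-- The coefficient of `κ²`. -/
def coeffP (ρ : ℝ) : ℝ :=
  -(1 + l ^ 2 * ρ) * (1 - a ^ 2 * l ^ 2) + 2 * m₀ / (ρ + a ^ 2) ^ (m - 1)

variable (a l) in
/-- The coefficient of `2 κ η`. -/
def coeffQ (ρ : ℝ) : ℝ := -(a * (1 + l ^ 2 * ρ))

/-- The point of κ and η: the mass enters only through the coefficient of κ², and the coefficient of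
η² is just ρ. -/
theorem metricForm_normalForm (hΞ : 1 - a ^ 2 * l ^ 2 ≠ 0) (ψ σ : ℝ → ℝ) {p : Amb m}
    (hp : realInner p.2.2 p.2.2 = 1) (u v : Amb m) :
    metricForm m a l m₀ ψ σ p u v =
      coeffP m a l m₀ p.2.1 * (kappa a l p u * kappa a l p v)
      + coeffQ a l p.2.1 * (kappa a l p u * etaTilde a l p v + etaTilde a l p u * kappa a l p v)
      + p.2.1 * (etaTilde a l p u * etaTilde a l p v)
      + ψ p.2.1 * (u.2.1 * v.2.1)
      - σ p.2.1 * (u.2.1 * kappa a l p v + kappa a l p u * v.2.1)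
      + (p.2.1 + a ^ 2) / (1 - a ^ 2 * l ^ 2) *
        realInner (horizontal p.2.2 u.2.2) (horizontal p.2.2 v.2.2) := by
  rw [metricForm_apply, realInner_horizontal hp, hp]
  simp only [coeffP, coeffQ, etaTilde, kappa]
  generalize 2 * m₀ / (p.2.1 + a ^ 2) ^ (m - 1) = M
  generalize symp p.2.2 u.2.2 = s
  generalize symp p.2.2 v.2.2 = t
  generalize realInner u.2.2 v.2.2 = r
  generalize ψ p.2.1 = ψ'
  generalize σ p.2.1 = σ'
  have hΞ' : 1 - l ^ 2 * a ^ 2 ≠ 0 := by rwa [mul_comm]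
  field_simp
  ring

/-- This ties the horizons to the signature: the κ, η block is Lorentzian exactly where Φ > 0. -/
theorem det_coeff (hm : 1 ≤ m) {ρ : ℝ} (hρ : -a ^ 2 < ρ) :
    (coeffP m a l m₀ ρ * ρ - coeffQ a l ρ ^ 2) * (ρ + a ^ 2) ^ (m - 1) =
      -horizonPoly m a l m₀ ρ := by
  obtain ⟨k, rfl⟩ : ∃ k, m = k + 1 := ⟨m - 1, by omega⟩
  have h : (ρ + a ^ 2) ^ k ≠ 0 := pow_ne_zero _ (by linarith)
  simp only [coeffP, coeffQ, horizonPoly, Nat.add_sub_cancel, pow_succ (ρ + a ^ 2) k]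
  field_simp
  ring

theorem metricForm_symm (ψ σ : ℝ → ℝ) (p u v : Amb m) :
    metricForm m a l m₀ ψ σ p u v = metricForm m a l m₀ ψ σ p v u := by
  rw [metricForm_apply, metricForm_apply, realInner_comm u.2.2]
  ring

/-- In this range 1 + l² ρ > 1 - a² l² > 0, so the first term of Φ is positive, while -2 m₀ ρ ≥ 0.
-/
theorem horizonPoly_pos_of_nonpos (hal : a ^ 2 * l ^ 2 < 1) (hm₀ : 0 < m₀) {ρ : ℝ}
    (h1 : -a ^ 2 < ρ) (h2 : ρ ≤ 0) : 0 < horizonPoly m a l m₀ ρ := by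
  have h3 : 0 < (ρ + a ^ 2) ^ m := pow_pos (by linarith) _
  have h4 : 0 < 1 + l ^ 2 * ρ := by nlinarith [sq_nonneg l]
  have h5 : m₀ * ρ ≤ 0 := mul_nonpos_of_nonneg_of_nonpos hm₀.le h2
  have := mul_pos h4 h3
  simp only [horizonPoly]
  linarith

end NormalForm

/-! ### Linear algebra of Lorentzian forms -/

section Lorentzian

/-- A symmetric `2 × 2` matrix of negative determinant takes a negative value. -/
theorem exists_neg_of_det_neg {P Q R : ℝ} (h : P * R - Q ^ 2 < 0) :
    ∃ s t : ℝ, P * s ^ 2 + 2 * Q * (s * t) + R * t ^ 2 < 0 := by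
  rcases lt_trichotomy P 0 with hP | rfl | hP
  · exact ⟨1, 0, by simpa⟩
  · have hQ : Q ≠ 0 := by
      rintro rfl
      simp at h
    refine ⟨-(1 + R) / (2 * Q), 1, ?_⟩
    -- With P = 0 the form at (s, 1) is 2 Q s + R; this `s` makes it equal to -1.
    have : 2 * Q * (-(1 + R) / (2 * Q) * 1) = -(1 + R) := by field_simp
    rw [this]
    linarith
  -- The vector (-Q, P) is orthogonal to (1, 0), which has positive square.
  · refine ⟨-Q, P, ?_⟩
    have : P * (-Q) ^ 2 + 2 * Q * (-Q * P) + R * P ^ 2 = P * (P * R - Q ^ 2) := by ring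
    rw [this]
    exact mul_neg_of_pos_of_neg hP h

variable {V : Type*} [NormedAddCommGroup V] [NormedSpace ℝ V]

/-- The sum of a two-dimensional Lorentzian form in the linear forms `x` and `y` and of a form `N`
which is positive on their common kernel is Lorentzian. -/
theorem isLorentzianOn_of_decomposition {B : V →L[ℝ] V →L[ℝ] ℝ} {W : Submodule ℝ V}
    {x y : V → ℝ} {N : V → V → ℝ} {P Q R : ℝ} (hdet : P * R - Q ^ 2 < 0)
    (hB : ∀ u ∈ W, ∀ v ∈ W, B u v = P * (x u * x v) + Q * (x u * y v + y u * x v)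
      + R * (y u * y v) + N u v)
    (hN : ∀ u ∈ W, ∀ v ∈ W, N u v = N v u)
    (hpos : ∀ v ∈ W, 0 ≤ N v v)
    (hpos' : ∀ v ∈ W, x v = 0 → y v = 0 → v ≠ 0 → 0 < N v v)
    (hsurj : ∀ s t : ℝ, ∃ e ∈ W, x e = s ∧ y e = t ∧ ∀ v ∈ W, N e v = 0) :
    IsLorentzianOn B W := by
  refine ⟨fun u hu v hv => by rw [hB u hu v hv, hB v hv u hu, hN u hu v hv]; ring, ?_⟩
  obtain ⟨s, t, hst⟩ := exists_neg_of_det_neg hdet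
  obtain ⟨e, he, hx, hy, hNe⟩ := hsurj s t
  have hee : B e e = P * s ^ 2 + 2 * Q * (s * t) + R * t ^ 2 := by
    rw [hB e he e he, hx, hy, hNe e he]
    ring
  refine ⟨e, he, by rw [hee]; exact hst, fun v hv hev hv0 => ?_⟩
  rw [hB e he v hv, hx, hy, hNe v hv] at hev
  rw [hB v hv v hv]
  set X := x v with hX
  set Y := y v with hY
  -- Lagrange's identity q(e) q(v) - b(e, v)² = det · (s Y - t X)² for the planar form, with b(e, v)
  -- = 0.
  have key : (P * s ^ 2 + 2 * Q * (s * t) + R * t ^ 2) *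
      (P * (X * X) + Q * (X * Y + Y * X) + R * (Y * Y)) =
      (P * R - Q ^ 2) * (s * Y - t * X) ^ 2 := by
    have : P * (s * X) + Q * (s * Y + t * X) + R * (t * Y) = 0 := by linarith
    linear_combination (P * (s * X) + Q * (s * Y + t * X) + R * (t * Y)) * this
  -- If (X, Y) is proportional to (s, t), orthogonality to a vector of nonzero square forces it to
  -- vanish, and `N` alone gives positivity. Otherwise the identity makes q(v) positive, as q(e) and
  -- the determinant are negative.
  by_cases h0 : s * Y - t * X = 0
  · have hXY : X = 0 ∧ Y = 0 := by
      by_cases hs : s = 0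
      · subst hs
        have ht : t ≠ 0 := by
          rintro rfl
          simp at hst
        have hX0 : X = 0 := by simpa [ht] using h0
        have hR : R ≠ 0 := by
          rintro rfl
          simp at hst
        refine ⟨hX0, ?_⟩
        rw [hX0] at hev
        simpa [hR, ht] using hev
      · have hYt : Y = t * X / s := by
          field_simp
          linarith
        rw [hYt] at hev
        have hX0 : X * (P * s ^ 2 + 2 * Q * (s * t) + R * t ^ 2) = 0 := by
          field_simp at hev
          linarith
        have hX0' : X = 0 := by
          rcases mul_eq_zero.mp hX0 with h | h
          · exact h
          · exact absurd h hst.ne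
        exact ⟨hX0', by rw [hYt, hX0']; simp⟩
    have := hpos' v hv hXY.1 hXY.2 hv0
    rw [hXY.1, hXY.2]
    linarith
  · have h1 : (P * R - Q ^ 2) * (s * Y - t * X) ^ 2 < 0 :=
      mul_neg_of_neg_of_pos hdet (by positivity)
    have h2 : 0 < P * (X * X) + Q * (X * Y + Y * X) + R * (Y * Y) := by
      by_contra hcon
      nlinarith
    have := hpos v hv
    linarith

end Lorentzian

/-! ### Signature of the metrics and of the hypersurfaces {ρ = const} -/

section LorentzianMetrics

variable {m : ℕ} {a l m₀ : ℝ}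

/-- The vector lies in the span of ∂_τ, ∂_ρ and the Hopf field i z; its components come from solving
for dτ = (1 - a² l²) κ + a η and θ = (1 - a² l²) (η - a l² κ). -/
theorem exists_tangent_of_forms (hΞ : 1 - a ^ 2 * l ^ 2 ≠ 0) {p : Amb m}
    (hp : realInner p.2.2 p.2.2 = 1) (s r t : ℝ) :
    ∃ e ∈ tangent p, kappa a l p e = s ∧ e.2.1 = r ∧ etaTilde a l p e = t ∧
      horizontal p.2.2 e.2.2 = 0 := by
  refine ⟨((1 - a ^ 2 * l ^ 2) * s + a * t, r,
    ((1 - a ^ 2 * l ^ 2) * t - a * l ^ 2 * (1 - a ^ 2 * l ^ 2) * s) • (Complex.I • p.2.2)),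
    ?_, ?_, rfl, ?_, ?_⟩
  · rw [mem_tangent_iff, map_smul, realInner_smul_I, symp_self, neg_zero, smul_zero]
  · simp only [kappa, map_smul, symp_smul_I, hp, smul_eq_mul, mul_one]
    field_simp
    ring
  · simp only [etaTilde, map_smul, symp_smul_I, hp, smul_eq_mul, mul_one]
    ring
  · simp [horizontal, map_smul, symp_smul_I, hp]

theorem eq_zero_of_forms (hΞ : 1 - a ^ 2 * l ^ 2 ≠ 0) {p v : Amb m}
    (h1 : kappa a l p v = 0) (h2 : v.2.1 = 0) (h3 : etaTilde a l p v = 0)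
    (h4 : horizontal p.2.2 v.2.2 = 0) : v = 0 := by
  simp only [kappa, etaTilde] at h1 h3
  have hs : symp p.2.2 v.2.2 = 0 := by
    have : v.1 = a / (1 - a ^ 2 * l ^ 2) * symp p.2.2 v.2.2 := by linarith
    rw [this] at h3
    field_simp at h3
    linarith
  have h5 : v.1 = 0 := by
    rw [hs] at h1
    simpa using h1
  have h6 : v.2.2 = 0 := by simpa [horizontal, hs] using h4
  exact Prod.ext h5 (Prod.ext h2 h6)

/-- The metric is Lorentzian where `ρ > 0` provided that the determinant of its `κ`, `ρ` block
modulo `η` is negative. -/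
theorem isLorentzianOn_metricForm_of_pos (hm : 1 ≤ m) (hΞ : 0 < 1 - a ^ 2 * l ^ 2)
    {ψ σ : ℝ → ℝ} {p : Amb m} (hp : p ∈ spacetime m a) (hρ : 0 < p.2.1)
    (hdet : 0 < horizonPoly m a l m₀ p.2.1 * ψ p.2.1
      + p.2.1 * (p.2.1 + a ^ 2) ^ (m - 1) * σ p.2.1 ^ 2) :
    IsLorentzianOn (metricForm m a l m₀ ψ σ p) (tangent p) := by
  obtain ⟨hp1, hp2⟩ := mem_spacetime_iff.mp hp
  set ρ := p.2.1 with hρdef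
  have hX : 0 < ρ + a ^ 2 := by linarith
  have hC : 0 < (ρ + a ^ 2) / (1 - a ^ 2 * l ^ 2) := div_pos hX hΞ
  set Q := coeffQ a l ρ
  -- Completing the square in η is possible because its coefficient ρ is positive. The square joins
  -- the positive part, and κ and dρ form the Lorentzian block.
  refine isLorentzianOn_of_decomposition (P := coeffP m a l m₀ ρ - Q ^ 2 / ρ) (Q := -σ ρ)
    (R := ψ ρ) (x := kappa a l p) (y := fun v => v.2.1)
    (N := fun u v => ρ * ((etaTilde a l p u + Q / ρ * kappa a l p u) *
      (etaTilde a l p v + Q / ρ * kappa a l p v)) + (ρ + a ^ 2) / (1 - a ^ 2 * l ^ 2) *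
        realInner (horizontal p.2.2 u.2.2) (horizontal p.2.2 v.2.2)) ?_ ?_ ?_ ?_ ?_ ?_
  · have h := det_coeff (m₀ := m₀) (l := l) hm hp1
    have hU : 0 < (ρ + a ^ 2) ^ (m - 1) := pow_pos hX _
    -- Multiplied by ρ U, the determinant of the κ, dρ block is -(Φ ψ + ρ U σ²), by `det_coeff`.
    have e : ((coeffP m a l m₀ ρ - Q ^ 2 / ρ) * ψ ρ - (-σ ρ) ^ 2) * (ρ * (ρ + a ^ 2) ^ (m - 1)) =
        -(horizonPoly m a l m₀ ρ * ψ ρ + ρ * (ρ + a ^ 2) ^ (m - 1) * σ ρ ^ 2) := by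
      field_simp
      linear_combination ψ ρ * h
    by_contra hcon
    have := mul_nonneg (not_lt.mp hcon) (mul_pos hρ hU).le
    linarith
  · intro u _ v _
    rw [metricForm_normalForm hΞ.ne' ψ σ hp2]
    field_simp
    ring
  · intro u _ v _
    rw [realInner_comm]
    ring
  · intro v _
    have := realInner_self_nonneg (horizontal p.2.2 v.2.2)
    have := mul_self_nonneg (etaTilde a l p v + Q / ρ * kappa a l p v)
    positivity
  · intro v _ h1 h2 hv
    by_cases h3 : etaTilde a l p v = 0
    · have h4 : horizontal p.2.2 v.2.2 ≠ 0 := fun h4 =>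
        hv (eq_zero_of_forms hΞ.ne' h1 h2 h3 h4)
      have := realInner_self_pos h4
      rw [h1, h3]
      simp only [mul_zero, add_zero, zero_add]
      positivity
    · have := realInner_self_nonneg (horizontal p.2.2 v.2.2)
      have h3' : 0 < etaTilde a l p v * etaTilde a l p v := mul_self_pos.mpr h3
      rw [h1]
      simp only [mul_zero, add_zero]
      exact add_pos_of_pos_of_nonneg (mul_pos hρ h3') (mul_nonneg hC.le this)
  · intro s t
    -- η(e) = -(Q / ρ) s is the value at which the completed square vanishes.
    obtain ⟨e, he, h1, h2, h3, h4⟩ :=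
      exists_tangent_of_forms hΞ.ne' hp2 s t (-(Q / ρ) * s)
    refine ⟨e, he, h1, h2, fun v _ => ?_⟩
    rw [h1, h3, h4]
    simp

/-- The metric is Lorentzian where `Φ > 0` and `σ = 0`. -/
theorem isLorentzianOn_metricForm_of_horizonPoly_pos (hm : 1 ≤ m) (hΞ : 0 < 1 - a ^ 2 * l ^ 2)
    {ψ σ : ℝ → ℝ} {p : Amb m} (hp : p ∈ spacetime m a) (hΦ : 0 < horizonPoly m a l m₀ p.2.1)
    (hψ : 0 < ψ p.2.1) (hσ : σ p.2.1 = 0) :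
    IsLorentzianOn (metricForm m a l m₀ ψ σ p) (tangent p) := by
  obtain ⟨hp1, hp2⟩ := mem_spacetime_iff.mp hp
  have hX : 0 < p.2.1 + a ^ 2 := by linarith
  have hC : 0 < (p.2.1 + a ^ 2) / (1 - a ^ 2 * l ^ 2) := div_pos hX hΞ
  -- Here the κ, η block is the Lorentzian one; without a cross term, ψ dρ² goes into the positive
  -- part. This covers ρ ≤ 0, where the square in η cannot be completed.
  refine isLorentzianOn_of_decomposition (P := coeffP m a l m₀ p.2.1) (Q := coeffQ a l p.2.1)
    (R := p.2.1) (x := kappa a l p) (y := etaTilde a l p)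
    (N := fun u v => ψ p.2.1 * (u.2.1 * v.2.1) + (p.2.1 + a ^ 2) / (1 - a ^ 2 * l ^ 2) *
        realInner (horizontal p.2.2 u.2.2) (horizontal p.2.2 v.2.2)) ?_ ?_ ?_ ?_ ?_ ?_
  · have h := det_coeff (m₀ := m₀) (l := l) hm hp1
    by_contra hcon
    have := mul_nonneg (not_lt.mp hcon) (pow_pos hX (m - 1)).le
    linarith
  · intro u _ v _
    rw [metricForm_normalForm hΞ.ne' ψ σ hp2, hσ]
    ring
  · intro u _ v _
    rw [realInner_comm]
    ring
  · intro v _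
    have := realInner_self_nonneg (horizontal p.2.2 v.2.2)
    have := mul_self_nonneg v.2.1
    positivity
  · intro v _ h1 h3 hv
    by_cases h2 : v.2.1 = 0
    · have h4 : horizontal p.2.2 v.2.2 ≠ 0 := fun h4 =>
        hv (eq_zero_of_forms hΞ.ne' h1 h2 h3 h4)
      have := realInner_self_pos h4
      rw [h2]
      simp only [mul_zero, zero_add]
      positivity
    · have := realInner_self_nonneg (horizontal p.2.2 v.2.2)
      have h2' : 0 < v.2.1 * v.2.1 := mul_self_pos.mpr h2
      exact add_pos_of_pos_of_nonneg (mul_pos hψ h2') (mul_nonneg hC.le this)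
  · intro s t
    obtain ⟨e, he, h1, h2, h3, h4⟩ := exists_tangent_of_forms hΞ.ne' hp2 s 0 t
    refine ⟨e, he, h1, h3, fun v _ => ?_⟩
    rw [h2, h4]
    simp

/-- For dρ = 0 the terms with ψ and σ disappear, so only the κ, η block of determinant -Φ / U and
the positive horizontal part remain. -/
theorem isLorentzianOn_levelTangent (hm : 1 ≤ m) (hΞ : 0 < 1 - a ^ 2 * l ^ 2)
    {ψ σ : ℝ → ℝ} {p : Amb m} (hp : p ∈ spacetime m a)
    (hΦ : 0 < horizonPoly m a l m₀ p.2.1) :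
    IsLorentzianOn (metricForm m a l m₀ ψ σ p) (levelTangent p) := by
  obtain ⟨hp1, hp2⟩ := mem_spacetime_iff.mp hp
  have hX : 0 < p.2.1 + a ^ 2 := by linarith
  have hC : 0 < (p.2.1 + a ^ 2) / (1 - a ^ 2 * l ^ 2) := div_pos hX hΞ
  refine isLorentzianOn_of_decomposition (P := coeffP m a l m₀ p.2.1) (Q := coeffQ a l p.2.1)
    (R := p.2.1) (x := kappa a l p) (y := etaTilde a l p)
    (N := fun u v => (p.2.1 + a ^ 2) / (1 - a ^ 2 * l ^ 2) *
        realInner (horizontal p.2.2 u.2.2) (horizontal p.2.2 v.2.2)) ?_ ?_ ?_ ?_ ?_ ?_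
  · have h := det_coeff (m₀ := m₀) (l := l) hm hp1
    by_contra hcon
    have := mul_nonneg (not_lt.mp hcon) (pow_pos hX (m - 1)).le
    linarith
  · intro u hu v hv
    rw [metricForm_normalForm hΞ.ne' ψ σ hp2, (mem_levelTangent_iff.mp hu).2,
      (mem_levelTangent_iff.mp hv).2]
    ring
  · intro u _ v _
    rw [realInner_comm]
  · intro v _
    have := realInner_self_nonneg (horizontal p.2.2 v.2.2)
    positivity
  · intro v hv h1 h3 hv0
    have h4 : horizontal p.2.2 v.2.2 ≠ 0 := fun h4 =>
      hv0 (eq_zero_of_forms hΞ.ne' h1 (mem_levelTangent_iff.mp hv).2 h3 h4)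
    have := realInner_self_pos h4
    positivity
  · intro s t
    obtain ⟨e, he, h1, h2, h3, h4⟩ := exists_tangent_of_forms hΞ.ne' hp2 s 0 t
    refine ⟨e, mem_levelTangent_iff.mpr ⟨he, h2⟩, h1, h3, fun v _ => ?_⟩
    rw [h4]
    simp

/-- For ρ ≤ 0 one has Φ > 0 and the κ, η block serves. For ρ > 0 the product of Φ with the radial
coefficient is U / 4 > 0 for either sign of Φ, so regions with Φ < 0 are included. -/
theorem isLorentzianOn_kerrAdS (hm : 1 ≤ m) (hal : a ^ 2 * l ^ 2 < 1) (hm₀ : 0 < m₀)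
    {p : Amb m} (hp : p ∈ spacetime m a) (hΦ : horizonPoly m a l m₀ p.2.1 ≠ 0) :
    IsLorentzianOn (kerrAdS m a l m₀ p) (tangent p) := by
  have hΞ : 0 < 1 - a ^ 2 * l ^ 2 := by linarith
  have hX : 0 < p.2.1 + a ^ 2 := by linarith [(mem_spacetime_iff.mp hp).1]
  have hU : 0 < (p.2.1 + a ^ 2) ^ (m - 1) := pow_pos hX _
  rw [kerrAdS_eq_metricForm]
  rcases le_or_gt p.2.1 0 with hρ | hρ
  · have hΦ' := horizonPoly_pos_of_nonpos (m := m) hal hm₀ (mem_spacetime_iff.mp hp).1 hρ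
    exact isLorentzianOn_metricForm_of_horizonPoly_pos hm hΞ hp hΦ'
      (by unfold radialCoeff; positivity) rfl
  · refine isLorentzianOn_metricForm_of_pos hm hΞ hp hρ ?_
    have : horizonPoly m a l m₀ p.2.1 * radialCoeff m a l m₀ p.2.1 =
        (p.2.1 + a ^ 2) ^ (m - 1) / 4 := by
      unfold radialCoeff
      field_simp
    rw [this]
    simp only [ne_eq, OfNat.ofNat_ne_zero, not_false_eq_true, zero_pow, mul_zero, add_zero]
    positivity

end LorentzianMetrics

end KerrAdS

end

noncomputable section

namespace KerrAdS

theorem fderiv_apply_eq_of_hasDerivAt {E F : Type*} [NormedAddCommGroup E] [NormedSpace ℝ E]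
    [NormedAddCommGroup F] [NormedSpace ℝ F] {f : E → F} {x v : E} {w : F}
    (hf : DifferentiableAt ℝ f x) (h : HasDerivAt (fun t : ℝ => f (x + t • v)) w 0) :
    fderiv ℝ f x v = w := by
  rw [← hf.lineDeriv_eq_fderiv]
  exact h.deriv

/-! ### Comparison with the line element in the coordinates (τ, r, μ, φ) -/

section BoyerLindquist

variable {m : ℕ}

theorem fderiv_blMap (q X : BL m) : fderiv ℝ blMap q X =
    ((X.1, 2 * q.2.1 * X.2.1, fun i => ((X.2.2.1 i : ℂ) + q.2.2.1 i * X.2.2.2 i * Complex.I) *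
      Complex.exp (q.2.2.2 i * Complex.I)) : Amb m) := by
  refine fderiv_apply_eq_of_hasDerivAt ?_ ?_
  · have h : ContDiff ℝ 1 (blMap : BL m → Amb m) := by
      unfold blMap
      refine contDiff_fst.prodMk ((contDiff_fst.comp contDiff_snd).pow 2 |>.prodMk
        (contDiff_pi.mpr fun i => ?_))
      have h1 : ContDiff ℝ 1 (fun q : BL m => q.2.2.1 i) := by fun_prop
      have h2 : ContDiff ℝ 1 (fun q : BL m => q.2.2.2 i) := by fun_prop
      exact (Complex.ofRealCLM.contDiff.comp h1).mul
        (((Complex.ofRealCLM.contDiff.comp h2).mul contDiff_const).cexp)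
    exact h.differentiable (by norm_num) q
  · have lin : ∀ c d : ℝ, HasDerivAt (fun t : ℝ => c + t * d) d 0 := fun c d => by
      simpa using ((hasDerivAt_id (0 : ℝ)).mul_const d).const_add c
    refine (lin _ _).prodMk (HasDerivAt.prodMk ?_ (hasDerivAt_pi.mpr fun i => ?_))
    · exact ((lin q.2.1 X.2.1).fun_pow 2).congr_deriv (by simp)
    · have h1 := (lin (q.2.2.1 i) (X.2.2.1 i)).ofReal_comp
      have h2 := ((lin (q.2.2.2 i) (X.2.2.2 i)).ofReal_comp.mul_const Complex.I).cexp
      exact (h1.fun_mul h2).congr_deriv (by simp; ring)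

/-- With dz_i = (dμ_i + i μ_i dφ_i) e^{iφ_i}, the phases cancel: Im(conj z_i dz_i) = μ_i² dφ_i and
|dz_i|² = dμ_i² + μ_i² dφ_i². Moreover dρ = 2 r dr turns dρ² / 4 into r² dr². -/
theorem kerrAdS_blMap (hm : 1 ≤ m) {a l m₀ : ℝ} (q X : BL m)
    (hΦ : horizonPoly m a l m₀ (q.2.1 ^ 2) ≠ 0) :
    kerrAdS m a l m₀ (blMap q) (fderiv ℝ blMap q X) (fderiv ℝ blMap q X) =
      blLineElement m a l m₀ q X := by
  have hcs : ∀ t : ℝ, Real.cos t ^ 2 + Real.sin t ^ 2 = 1 := Real.cos_sq_add_sin_sq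
  have h1 : symp (blMap q).2.2 (fderiv ℝ blMap q X).2.2 =
      ∑ i, q.2.2.1 i ^ 2 * X.2.2.2 i := by
    rw [fderiv_blMap, symp_apply]
    refine Finset.sum_congr rfl fun i _ => ?_
    simp only [blMap, Complex.mul_re, Complex.mul_im, Complex.add_re, Complex.add_im,
      Complex.ofReal_re, Complex.ofReal_im, Complex.I_re, Complex.I_im, Complex.exp_ofReal_mul_I_re,
      Complex.exp_ofReal_mul_I_im]
    linear_combination (q.2.2.1 i ^ 2 * X.2.2.2 i) * hcs (q.2.2.2 i)
  have h2 : realInner (fderiv ℝ blMap q X).2.2 (fderiv ℝ blMap q X).2.2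
      + a * l ^ 2 * (X.1 * symp (blMap q).2.2 (fderiv ℝ blMap q X).2.2
        + X.1 * symp (blMap q).2.2 (fderiv ℝ blMap q X).2.2)
      + (a * l ^ 2) ^ 2 * (X.1 * X.1) * realInner (blMap q).2.2 (blMap q).2.2 =
      ∑ i, (X.2.2.1 i ^ 2 + q.2.2.1 i ^ 2 * (X.2.2.2 i + a * l ^ 2 * X.1) ^ 2) := by
    rw [h1, fderiv_blMap, realInner_apply, realInner_apply]
    simp only [Finset.mul_sum, ← Finset.sum_add_distrib]
    refine Finset.sum_congr rfl fun i _ => ?_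
    simp only [blMap, Complex.mul_re, Complex.mul_im, Complex.add_re, Complex.add_im,
      Complex.ofReal_re, Complex.ofReal_im, Complex.I_re, Complex.I_im, Complex.exp_ofReal_mul_I_re,
      Complex.exp_ofReal_mul_I_im]
    linear_combination (X.2.2.1 i ^ 2 + q.2.2.1 i ^ 2 * X.2.2.2 i ^ 2
      + (a * l ^ 2) ^ 2 * X.1 ^ 2 * q.2.2.1 i ^ 2) * hcs (q.2.2.2 i)
  have e1 : (fderiv ℝ blMap q X).1 = X.1 := by rw [fderiv_blMap]
  have e2 : (fderiv ℝ blMap q X).2.1 = 2 * q.2.1 * X.2.1 := by rw [fderiv_blMap]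
  have e3 : (blMap q).2.1 = q.2.1 ^ 2 := rfl
  rw [kerrAdS_eq_metricForm, metricForm_apply]
  simp only [kappa, e1, e2, e3]
  rw [h2, h1]
  have hpoly : (1 + l ^ 2 * q.2.1 ^ 2) * (q.2.1 ^ 2 + a ^ 2) * (q.2.1 ^ 2 + a ^ 2) ^ (m - 1)
      - 2 * m₀ * q.2.1 ^ 2 = horizonPoly m a l m₀ (q.2.1 ^ 2) := by
    rw [horizonPoly, mul_assoc, ← pow_succ', Nat.sub_add_cancel hm]
  simp only [blLineElement, radialCoeff]
  rw [hpoly]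
  field_simp
  ring

end BoyerLindquist

/-! ### Smoothness of the metrics -/

section Smoothness

variable {m : ℕ} {a l m₀ : ℝ}

theorem contDiff_symp {n : WithTop ℕ∞} (v : Fin m → ℂ) :
    ContDiff ℝ n (fun p : Amb m => symp p.2.2 v) := by
  have h := (LinearMap.toContinuousLinearMap (symp.flip v)).contDiff (n := n)
  exact h.comp (contDiff_snd.comp contDiff_snd)

theorem contDiff_realInner_self {n : WithTop ℕ∞} :
    ContDiff ℝ n (fun p : Amb m => realInner p.2.2 p.2.2) := by
  simp only [realInner_apply]
  refine ContDiff.sum fun i _ => ?_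
  have h : ContDiff ℝ n (fun p : Amb m => p.2.2 i) := by fun_prop
  have hre := Complex.reCLM.contDiff.comp h
  have him := Complex.imCLM.contDiff.comp h
  exact (hre.mul hre).add (him.mul him)

theorem contDiffOn_metricForm {ψ σ : ℝ → ℝ} {s : Set ℝ} (hs : s ⊆ Set.Ioi (-a ^ 2))
    (hψ : ContDiffOn ℝ ∞ ψ s) (hσ : ContDiffOn ℝ ∞ σ s) :
    ContDiffOn ℝ ∞ (metricForm m a l m₀ ψ σ) {p | p.2.1 ∈ s} := by
  refine contDiffOn_clm_apply.mpr fun u => contDiffOn_clm_apply.mpr fun v => ?_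
  simp only [metricForm_apply, kappa]
  have hr : ContDiff ℝ ∞ (fun p : Amb m => p.2.1) := by fun_prop
  have hψ' : ContDiffOn ℝ ∞ (fun p : Amb m => ψ p.2.1) {p | p.2.1 ∈ s} :=
    hψ.comp hr.contDiffOn fun p hp => hp
  have hσ' : ContDiffOn ℝ ∞ (fun p : Amb m => σ p.2.1) {p | p.2.1 ∈ s} :=
    hσ.comp hr.contDiffOn fun p hp => hp
  have hu := (contDiff_symp (m := m) (n := ∞) u.2.2).contDiffOn (s := {p : Amb m | p.2.1 ∈ s})
  have hv := (contDiff_symp (m := m) (n := ∞) v.2.2).contDiffOn (s := {p : Amb m | p.2.1 ∈ s})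
  have hz := (contDiff_realInner_self (m := m) (n := ∞)).contDiffOn
    (s := {p : Amb m | p.2.1 ∈ s})
  have hU : ∀ p ∈ {p : Amb m | p.2.1 ∈ s}, (p.2.1 + a ^ 2) ^ (m - 1) ≠ 0 := fun p hp => by
    have : -a ^ 2 < p.2.1 := hs hp
    exact pow_ne_zero _ (by linarith)
  have hM : ContDiffOn ℝ ∞ (fun p : Amb m => 2 * m₀ / (p.2.1 + a ^ 2) ^ (m - 1))
      {p | p.2.1 ∈ s} := contDiffOn_const.div (by fun_prop) hU
  have hκu := (contDiffOn_const (c := u.1)).sub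
    ((contDiffOn_const (c := a / (1 - a ^ 2 * l ^ 2))).mul hu)
  have hκv := (contDiffOn_const (c := v.1)).sub
    ((contDiffOn_const (c := a / (1 - a ^ 2 * l ^ 2))).mul hv)
  refine ((((ContDiff.contDiffOn (by fun_prop)).add (hψ'.mul contDiffOn_const)).add
    (ContDiffOn.mul (ContDiff.contDiffOn (by fun_prop)) ?_)).add (hM.mul (hκu.mul hκv))).sub
    (hσ'.mul ((contDiffOn_const.mul hκv).add (hκu.mul contDiffOn_const)))
  exact (contDiffOn_const.add (contDiffOn_const.mul ((contDiffOn_const.mul hv).add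
    (contDiffOn_const.mul hu)))).add (contDiffOn_const.mul hz)

theorem contDiffOn_radialCoeff :
    ContDiffOn ℝ ∞ (radialCoeff m a l m₀) {ρ | horizonPoly m a l m₀ ρ ≠ 0} := by
  unfold radialCoeff
  refine ContDiffOn.div (by fun_prop) (by unfold horizonPoly; fun_prop) fun ρ hρ => ?_
  exact mul_ne_zero (by norm_num) hρ

theorem contDiffOn_kerrAdS : ContDiffOn ℝ ∞ (kerrAdS m a l m₀)
    {p | -a ^ 2 < p.2.1 ∧ horizonPoly m a l m₀ p.2.1 ≠ 0} := by
  rw [kerrAdS_eq_metricForm]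
  exact contDiffOn_metricForm (s := {ρ | -a ^ 2 < ρ ∧ horizonPoly m a l m₀ ρ ≠ 0})
    (fun ρ hρ => hρ.1) (contDiffOn_radialCoeff.mono fun ρ hρ => hρ.2) contDiffOn_const

end Smoothness

/-- A smooth function on an open subset of the real line has a smooth antiderivative there. -/
theorem exists_antiderivative {s : Set ℝ} (hs : IsOpen s) {f : ℝ → ℝ}
    (hf : ContDiffOn ℝ ∞ f s) :
    ∃ F : ℝ → ℝ, ContDiffOn ℝ ∞ F s ∧ ∀ x ∈ s, HasDerivAt F (f x) x := by
  classical
  -- The integral starts from a chosen point of the component of `x` in `s`. This point is locally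
  -- constant, so near each `x` the function is an ordinary integral with fixed lower limit.
  let F : ℝ → ℝ := fun x => if hx : x ∈ s then ∫ t in (s.ordConnectedProj ⟨x, hx⟩)..x, f t else 0
  have hF : ∀ x ∈ s, HasDerivAt F (f x) x := by
    intro x hx
    set c := s.ordConnectedProj ⟨x, hx⟩ with hc
    have hcx : Set.uIcc c x ⊆ s := by
      rw [Set.uIcc_comm]
      exact Set.ordConnectedProj_mem_ordConnectedComponent s ⟨x, hx⟩
    have hint : IntervalIntegrable f MeasureTheory.volume c x :=
      (hf.continuousOn.mono hcx).intervalIntegrable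
    have hder := intervalIntegral.integral_hasDerivAt_right hint
      (hf.continuousOn.stronglyMeasurableAtFilter hs x hx)
      (hf.continuousOn.continuousAt (hs.mem_nhds hx))
    refine hder.congr_of_eventuallyEq ?_
    obtain ⟨ε, hε, hball⟩ := Metric.isOpen_iff.mp hs x hx
    filter_upwards [Metric.ball_mem_nhds x hε] with y hy
    have hy' : y ∈ s := hball hy
    have hseg : Set.uIcc y x ⊆ s := by
      refine Set.Subset.trans ?_ hball
      exact ((convex_ball x ε).ordConnected).uIcc_subset hy (Metric.mem_ball_self hε)
    have : s.ordConnectedProj ⟨y, hy'⟩ = c := Set.ordConnectedProj_eq.mpr hseg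
    simp only [F, dif_pos hy', this]
  refine ⟨F, ?_, hF⟩
  rw [contDiffOn_infty_iff_deriv_of_isOpen hs]
  exact ⟨fun x hx => (hF x hx).differentiableAt.differentiableWithinAt,
    hf.congr fun x hx => (hF x hx).deriv⟩

end KerrAdS

end

noncomputable section

namespace KerrAdS

/-! ### Extension of the metric across the horizons -/

section Extension

variable {m : ℕ} {a l m₀ : ℝ}

theorem continuous_horizonPoly : Continuous (horizonPoly m a l m₀) := by
  unfold horizonPoly
  fun_prop

/-- The coefficients of a metric which is regular at the horizons. -/
theorem exists_regular_coefficients (ha : a ≠ 0) (hal : a ^ 2 * l ^ 2 < 1) (hm₀ : 0 < m₀) :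
    ∃ ψ σ : ℝ → ℝ, ContDiffOn ℝ ∞ ψ (Set.Ioi (-a ^ 2)) ∧ ContDiffOn ℝ ∞ σ (Set.Ioi (-a ^ 2)) ∧
      (∀ ρ ≤ 0, ψ ρ = radialCoeff m a l m₀ ρ ∧ σ ρ = 0) ∧
      ∀ ρ > 0, horizonPoly m a l m₀ ρ * ψ ρ + ρ * (ρ + a ^ 2) ^ (m - 1) * σ ρ ^ 2 =
        (ρ + a ^ 2) ^ (m - 1) / 4 := by
  have h0 : 0 < horizonPoly m a l m₀ 0 := by
    simp only [horizonPoly, mul_zero, add_zero, one_mul, zero_add, sub_zero]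
    positivity
  -- Since Φ(0) = a^(2m) > 0, no horizon has |ρ| < ε. This leaves room for a cutoff rising from 0 to
  -- 1 between ε / 3 and 2 ε / 3.
  obtain ⟨ε, hε, hball⟩ := Metric.eventually_nhds_iff.mp
    (continuous_horizonPoly.continuousAt.eventually (lt_mem_nhds h0))
  let χ : ℝ → ℝ := fun ρ => Real.smoothTransition (3 * ρ / ε - 1)
  have hχ : ContDiff ℝ ∞ χ := Real.smoothTransition.contDiff.comp (by fun_prop)
  have hχ0 : ∀ ρ ≤ ε / 3, χ ρ = 0 := fun ρ hρ => by
    refine Real.smoothTransition.zero_of_nonpos ?_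
    rw [sub_nonpos, div_le_one hε]
    linarith
  have hχ1 : ∀ ρ, 2 * ε / 3 ≤ ρ → χ ρ = 1 := fun ρ hρ => by
    refine Real.smoothTransition.one_of_one_le ?_
    rw [le_sub_iff_add_le, le_div_iff₀ hε]
    linarith
  -- For χ = 0 these are the Boyer-Lindquist coefficients; for χ = 1 they give ψ = 0 and σ² = 1 /
  -- (4ρ). The quadratic relation holds for every value of χ in between.
  refine ⟨fun ρ => (1 - χ ρ ^ 2) * radialCoeff m a l m₀ ρ, fun ρ => χ ρ / (2 * √ρ), ?_, ?_, ?_, ?_⟩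
  · intro ρ hρ
    refine ContDiffAt.contDiffWithinAt ?_
    by_cases hΦ : horizonPoly m a l m₀ ρ = 0
    -- A horizon lies where χ is identically 1, so ψ vanishes in a neighbourhood and the pole of the
    -- radial coefficient does no harm.
    · have hge : 2 * ε / 3 < ρ := by
        by_contra hcon
        rcases le_or_gt ρ 0 with h | h
        · exact (horizonPoly_pos_of_nonpos (m := m) hal hm₀ hρ h).ne' hΦ
        · have : dist ρ 0 < ε := by
            rw [Real.dist_0_eq_abs, abs_lt]
            constructor <;> linarith
          exact (hball this).ne' hΦ
      refine (contDiffAt_const (c := (0 : ℝ))).congr_of_eventuallyEq ?_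
      filter_upwards [lt_mem_nhds hge] with y hy
      rw [hχ1 y hy.le]
      ring
    · have hopen : IsOpen {ρ | horizonPoly m a l m₀ ρ ≠ 0} :=
        isOpen_ne_fun continuous_horizonPoly continuous_const
      exact (contDiffAt_const.sub (hχ.contDiffAt.pow 2)).mul
        (contDiffOn_radialCoeff.contDiffAt (hopen.mem_nhds hΦ))
  · intro ρ _
    refine ContDiffAt.contDiffWithinAt ?_
    -- The square root is not smooth at 0, but σ vanishes identically for ρ below ε / 3.
    rcases lt_or_ge ρ (ε / 3) with h | h
    · refine (contDiffAt_const (c := (0 : ℝ))).congr_of_eventuallyEq ?_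
      filter_upwards [gt_mem_nhds h] with y hy
      rw [hχ0 y hy.le, zero_div]
    · have hρ : 0 < ρ := by linarith
      refine hχ.contDiffAt.div (contDiffAt_const.mul (Real.contDiffAt_sqrt hρ.ne')) ?_
      positivity
  · intro ρ hρ
    have : χ ρ = 0 := hχ0 ρ (by linarith)
    simp [this]
  · intro ρ hρ
    have hs : √ρ ^ 2 = ρ := Real.sq_sqrt hρ.le
    have hs0 : √ρ ≠ 0 := (Real.sqrt_pos.mpr hρ).ne'
    have h2 : ρ * (ρ + a ^ 2) ^ (m - 1) * (χ ρ / (2 * √ρ)) ^ 2 =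
        (ρ + a ^ 2) ^ (m - 1) / 4 * χ ρ ^ 2 := by
      rw [div_pow, mul_pow, hs]
      field_simp
      norm_num
    have h1 : horizonPoly m a l m₀ ρ * ((1 - χ ρ ^ 2) * radialCoeff m a l m₀ ρ) =
        (ρ + a ^ 2) ^ (m - 1) / 4 * (1 - χ ρ ^ 2) := by
      by_cases hΦ : horizonPoly m a l m₀ ρ = 0
      · have hge : 2 * ε / 3 ≤ ρ := by
          by_contra hcon
          have : dist ρ 0 < ε := by
            rw [Real.dist_0_eq_abs, abs_lt]
            constructor <;> linarith
          exact absurd hΦ (hball this).ne'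
        rw [hχ1 ρ hge]
        ring
      · unfold radialCoeff
        field_simp
    linear_combination h1 + h2

theorem fderiv_shift {F H : ℝ → ℝ} {F' H' : ℝ} {p : Amb m} (hF : HasDerivAt F F' p.2.1)
    (hH : HasDerivAt H H' p.2.1) (u : Amb m) : fderiv ℝ (shift F H) p u =
      (u.1 + F' * u.2.1, u.2.1, Complex.exp (H p.2.1 * Complex.I) •
        (u.2.2 + (H' * u.2.1) • (Complex.I • p.2.2))) := by
  have hρ : DifferentiableAt ℝ (fun p : Amb m => p.2.1) p := by fun_prop
  have hF1 : DifferentiableAt ℝ (fun p : Amb m => F p.2.1) p :=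
    DifferentiableAt.comp p hF.differentiableAt hρ
  have hH1 : DifferentiableAt ℝ (fun p : Amb m => H p.2.1) p :=
    DifferentiableAt.comp p hH.differentiableAt hρ
  have hE : DifferentiableAt ℝ (fun p : Amb m => Complex.exp (H p.2.1 * Complex.I)) p :=
    ((Complex.ofRealCLM.differentiableAt.comp p hH1).mul_const _).cexp
  refine fderiv_apply_eq_of_hasDerivAt ?_ ?_
  · have hz : DifferentiableAt ℝ (fun p : Amb m => p.2.2) p := by fun_prop
    exact (differentiableAt_fst.add hF1).prodMk (hρ.prodMk (hE.smul hz))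
  · have lin : ∀ c d : ℝ, HasDerivAt (fun t : ℝ => c + t * d) d 0 := fun c d => by
      simpa using ((hasDerivAt_id (0 : ℝ)).mul_const d).const_add c
    have hFt : HasDerivAt (fun t : ℝ => F (p.2.1 + t * u.2.1)) (F' * u.2.1) 0 :=
      HasDerivAt.comp (0 : ℝ) (by simpa using hF) (lin p.2.1 u.2.1)
    have hHt : HasDerivAt (fun t : ℝ => H (p.2.1 + t * u.2.1)) (H' * u.2.1) 0 :=
      HasDerivAt.comp (0 : ℝ) (by simpa using hH) (lin p.2.1 u.2.1)
    refine HasDerivAt.prodMk ((lin p.1 u.1).add hFt) ((lin _ _).prodMk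
      (hasDerivAt_pi.mpr fun i => ?_))
    have h1 := (hHt.ofReal_comp.mul_const Complex.I).cexp
    have h2 : HasDerivAt (fun t : ℝ => p.2.2 i + t • u.2.2 i) (u.2.2 i) 0 := by
      simpa using ((hasDerivAt_id (0 : ℝ)).smul_const (u.2.2 i)).const_add (p.2.2 i)
    refine (h1.fun_mul h2).congr_deriv ?_
    simp
    ring

theorem norm_exp_mul_I (t : ℝ) : ‖Complex.exp (t * Complex.I)‖ = 1 :=
  Complex.norm_exp_ofReal_mul_I t

/-- The change of coordinates which turns the Boyer-Lindquist metric into a metric which is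
regular at the horizons. -/
theorem metricForm_shift (hm : 1 ≤ m) (hΞ : 1 - a ^ 2 * l ^ 2 ≠ 0) {ψ σ F H : ℝ → ℝ}
    {F' H' q : ℝ} {p : Amb m} (hp : p ∈ spacetime m a)
    (hΦ : horizonPoly m a l m₀ p.2.1 ≠ 0) (hF : HasDerivAt F F' p.2.1)
    (hH : HasDerivAt H H' p.2.1)
    (hψ : horizonPoly m a l m₀ p.2.1 * ψ p.2.1
      + p.2.1 * (p.2.1 + a ^ 2) ^ (m - 1) * σ p.2.1 ^ 2 = (p.2.1 + a ^ 2) ^ (m - 1) / 4)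
    (hq : q * horizonPoly m a l m₀ p.2.1 = (p.2.1 + a ^ 2) ^ (m - 1) * σ p.2.1)
    (hF' : F' = -((1 - a ^ 2 * l ^ 2) * (p.2.1 * q)) + a * (coeffQ a l p.2.1 * q))
    (hH' : H' = coeffQ a l p.2.1 * q - a * l ^ 2 * F') (u v : Amb m) :
    metricForm m a l m₀ ψ σ (shift F H p) (fderiv ℝ (shift F H) p u) (fderiv ℝ (shift F H) p v) =
      kerrAdS m a l m₀ p u v := by
  obtain ⟨hp1, hp2⟩ := mem_spacetime_iff.mp hp
  have hc := norm_exp_mul_I (H p.2.1)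
  have hsh : (shift F H p).2.2 = Complex.exp (H p.2.1 * Complex.I) • p.2.2 := rfl
  have hρ : (shift F H p).2.1 = p.2.1 := rfl
  have hz : realInner (shift F H p).2.2 (shift F H p).2.2 = 1 := by
    rw [hsh, realInner_unit_smul hc, hp2]
  have hs : ∀ u : Amb m, symp (shift F H p).2.2 (fderiv ℝ (shift F H) p u).2.2 =
      symp p.2.2 u.2.2 + H' * u.2.1 := fun u => by
    rw [fderiv_shift hF hH, hsh, symp_unit_smul hc, map_add, map_smul, symp_smul_I, hp2,
      smul_eq_mul, mul_one]
  have h1 : ∀ u : Amb m, (fderiv ℝ (shift F H) p u).1 = u.1 + F' * u.2.1 := fun u => by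
    rw [fderiv_shift hF hH]
  have h2 : ∀ u : Amb m, (fderiv ℝ (shift F H) p u).2.1 = u.2.1 := fun u => by
    rw [fderiv_shift hF hH]
  -- F' and H' are chosen so that κ changes by -ρ q dρ and η by Q q dρ. The two contributions -Q ρ q
  -- and ρ Q q to the η dρ term then cancel.
  have hκ : ∀ u : Amb m, kappa a l (shift F H p) (fderiv ℝ (shift F H) p u) =
      kappa a l p u - p.2.1 * q * u.2.1 := fun u => by
    simp only [kappa, hs, h1, hH', hF']
    field_simp
    ring
  have hη : ∀ u : Amb m, etaTilde a l (shift F H p) (fderiv ℝ (shift F H) p u) =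
      etaTilde a l p u + coeffQ a l p.2.1 * q * u.2.1 := fun u => by
    simp only [etaTilde, hs, h1, hH']
    ring
  have hh : ∀ u : Amb m, horizontal (shift F H p).2.2 (fderiv ℝ (shift F H) p u).2.2 =
      Complex.exp (H p.2.1 * Complex.I) • horizontal p.2.2 u.2.2 := fun u => by
    rw [horizontal, hs, fderiv_shift hF hH, hsh, horizontal]
    ext i
    simp
    ring
  rw [kerrAdS_eq_metricForm, metricForm_normalForm hΞ ψ σ hz, metricForm_normalForm hΞ _ _ hp2]
  simp only [hκ, hη, hh, hρ, h2, realInner_unit_smul hc]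
  have hU : (p.2.1 + a ^ 2) ^ (m - 1) ≠ 0 := pow_ne_zero _ (by linarith)
  have hdet := det_coeff (m₀ := m₀) (l := l) hm hp1
  have hB : radialCoeff m a l m₀ p.2.1 * (4 * horizonPoly m a l m₀ p.2.1) =
      (p.2.1 + a ^ 2) ^ (m - 1) := by
    unfold radialCoeff
    field_simp
  -- The vanishing of the κ dρ term; by `det_coeff` this is what determines q = U σ / Φ.
  have hcross : coeffP m a l m₀ p.2.1 * (p.2.1 * q) - coeffQ a l p.2.1 * (coeffQ a l p.2.1 * q)
      + σ p.2.1 = 0 := by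
    refine mul_right_cancel₀ hU ?_
    linear_combination q * hdet - hq
  -- Once the cross term is removed, the coefficient of dρ² is ψ + ρ q σ.
  have hdiag : ψ p.2.1 + p.2.1 * q * σ p.2.1 = radialCoeff m a l m₀ p.2.1 := by
    refine mul_right_cancel₀ hΦ ?_
    linear_combination hψ + p.2.1 * σ p.2.1 * hq - hB / 4
  linear_combination (-(u.2.1 * kappa a l p v) - v.2.1 * kappa a l p u
    + p.2.1 * q * (u.2.1 * v.2.1)) * hcross + u.2.1 * v.2.1 * hdiag

/-- The metrics `metricForm` with coefficients which are regular at the horizons are metrics of the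
extended spacetime. -/
theorem isExtendedMetric_metricForm (hm : 1 ≤ m) (hal : a ^ 2 * l ^ 2 < 1) (hm₀ : 0 < m₀)
    {ψ σ : ℝ → ℝ} (hψs : ContDiffOn ℝ ∞ ψ (Set.Ioi (-a ^ 2)))
    (hσs : ContDiffOn ℝ ∞ σ (Set.Ioi (-a ^ 2)))
    (hnonpos : ∀ ρ ≤ 0, ψ ρ = radialCoeff m a l m₀ ρ ∧ σ ρ = 0)
    (hpos : ∀ ρ > 0, horizonPoly m a l m₀ ρ * ψ ρ + ρ * (ρ + a ^ 2) ^ (m - 1) * σ ρ ^ 2 =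
        (ρ + a ^ 2) ^ (m - 1) / 4) :
    IsExtendedMetric m a l m₀ (metricForm m a l m₀ ψ σ) := by
  have hΞ : 0 < 1 - a ^ 2 * l ^ 2 := by linarith
  refine ⟨contDiffOn_metricForm (s := Set.Ioi (-a ^ 2)) subset_rfl hψs hσs, fun p hp => ?_,
    fun p hp hρ u _ v _ => ?_, ?_⟩
  · have hX : 0 < p.2.1 + a ^ 2 := by linarith [(mem_spacetime_iff.mp hp).1]
    rcases le_or_gt p.2.1 0 with hρ | hρ
    · have hΦ := horizonPoly_pos_of_nonpos (m := m) hal hm₀ (mem_spacetime_iff.mp hp).1 hρ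
      refine isLorentzianOn_metricForm_of_horizonPoly_pos hm hΞ hp hΦ ?_ (hnonpos _ hρ).2
      rw [(hnonpos _ hρ).1]
      unfold radialCoeff
      positivity
    · refine isLorentzianOn_metricForm_of_pos hm hΞ hp hρ ?_
      rw [hpos _ hρ]
      positivity
  · rw [kerrAdS_eq_metricForm, metricForm_apply, metricForm_apply, (hnonpos _ hρ).1,
      (hnonpos _ hρ).2]
  · set s : Set ℝ := {ρ | -a ^ 2 < ρ ∧ horizonPoly m a l m₀ ρ ≠ 0} with hs
    have hopen : IsOpen s :=
      isOpen_Ioi.inter (isOpen_ne_fun continuous_horizonPoly continuous_const)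
    -- F' and H' involve 1 / Φ, so F and H are integrated separately on each component of the
    -- complement of the horizons.
    set q : ℝ → ℝ := fun ρ => (ρ + a ^ 2) ^ (m - 1) * σ ρ / horizonPoly m a l m₀ ρ with hq
    have hqs : ContDiffOn ℝ ∞ q s := by
      refine ContDiffOn.div (ContDiffOn.mul (by fun_prop) (hσs.mono fun ρ hρ => hρ.1))
        (by unfold horizonPoly; fun_prop) fun ρ hρ => hρ.2
    set f : ℝ → ℝ := fun ρ => -((1 - a ^ 2 * l ^ 2) * (ρ * q ρ)) + a * (coeffQ a l ρ * q ρ) with hf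
    have hQs : ContDiffOn ℝ ∞ (coeffQ a l) s := by
      unfold coeffQ
      fun_prop
    have hfs : ContDiffOn ℝ ∞ f s :=
      (contDiffOn_const.mul (contDiffOn_id.mul hqs)).neg.add (contDiffOn_const.mul (hQs.mul hqs))
    obtain ⟨F, hFs, hF⟩ := exists_antiderivative hopen hfs
    obtain ⟨H, hHs, hH⟩ := exists_antiderivative hopen
      ((hQs.mul hqs).sub ((contDiffOn_const (c := a * l ^ 2)).mul hfs))
    refine ⟨F, H, hFs, hHs, fun p hp hΦ u _ v _ => ?_⟩
    have hps : p.2.1 ∈ s := ⟨(mem_spacetime_iff.mp hp).1, hΦ⟩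
    refine metricForm_shift hm hΞ.ne' hp hΦ (hF _ hps) (hH _ hps) ?_ (q := q p.2.1) ?_ rfl rfl u v
    · rcases le_or_gt p.2.1 0 with hρ | hρ
      · rw [(hnonpos _ hρ).1, (hnonpos _ hρ).2]
        unfold radialCoeff
        field_simp
        ring
      · exact hpos _ hρ
    · simp only [hq]
      field_simp

end Extension

end KerrAdS

end

noncomputable section

namespace KerrAdS

/-! ### The metric in a coordinate patch -/

section LocalMetric

variable {m : ℕ} {a l m₀ : ℝ}

/-- A tangent vector is orthogonal to the unit vector z, so the mixed term drops out. -/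
theorem sum_norm_sq_patch {p : Amb m} (hp : realInner p.2.2 p.2.2 = 1) (x : tangent p) :
    ∑ i, ‖p.2.2 i + (x : Amb m).2.2 i‖ ^ 2 =
      1 + realInner (x : Amb m).2.2 (x : Amb m).2.2 := by
  have h := realInner_self (p.2.2 + (x : Amb m).2.2)
  simp only [Pi.add_apply] at h
  rw [← h]
  simp only [map_add, LinearMap.add_apply, hp, realInner_comm (x : Amb m).2.2 p.2.2,
    realInner_tangent]
  ring

theorem patch_eq {p : Amb m} (hp : realInner p.2.2 p.2.2 = 1) (x : tangent p) :
    patch p x = (p.1 + (x : Amb m).1, p.2.1 + (x : Amb m).2.1,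
      (√(1 + realInner (x : Amb m).2.2 (x : Amb m).2.2))⁻¹ • (p.2.2 + (x : Amb m).2.2)) := by
  rw [patch, sum_norm_sq_patch hp]

theorem patch_zero {p : Amb m} (hp : realInner p.2.2 p.2.2 = 1) : patch p 0 = p := by
  rw [patch_eq hp]
  simp

theorem fderiv_patch {p : Amb m} (hp : realInner p.2.2 p.2.2 = 1) (x u : tangent p) :
    fderiv ℝ (patch p) x u = ((u : Amb m).1, (u : Amb m).2.1,
      (√(1 + realInner (x : Amb m).2.2 (x : Amb m).2.2))⁻¹ • ((u : Amb m).2.2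
        - ((1 + realInner (x : Amb m).2.2 (x : Amb m).2.2)⁻¹
          * realInner (x : Amb m).2.2 (u : Amb m).2.2) • (p.2.2 + (x : Amb m).2.2))) := by
  have hpos : ∀ y : tangent p, 0 < 1 + realInner (y : Amb m).2.2 (y : Amb m).2.2 := fun y => by
    linarith [realInner_self_nonneg (y : Amb m).2.2]
  have hfun : patch p = fun x : tangent p => (p.1 + (x : Amb m).1, p.2.1 + (x : Amb m).2.1,
      (√(1 + realInner (x : Amb m).2.2 (x : Amb m).2.2))⁻¹ • (p.2.2 + (x : Amb m).2.2)) :=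
    funext (patch_eq hp)
  have hval : DifferentiableAt ℝ (fun y : tangent p => (y : Amb m)) x :=
    (tangent p).subtypeL.differentiableAt
  have hN : DifferentiableAt ℝ
      (fun y : tangent p => 1 + realInner (y : Amb m).2.2 (y : Amb m).2.2) x := by
    have h : DifferentiableAt ℝ (fun q : Amb m => realInner q.2.2 q.2.2) (x : Amb m) :=
      (contDiff_realInner_self (n := 1)).differentiable (by norm_num) _
    exact (h.comp x hval).const_add 1
  rw [hfun]
  refine fderiv_apply_eq_of_hasDerivAt ?_ ?_
  · have h1 : DifferentiableAt ℝ (fun y : tangent p => (y : Amb m).1) x := hval.fst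
    have h2 : DifferentiableAt ℝ (fun y : tangent p => (y : Amb m).2.1) x := hval.snd.fst
    have h3 : DifferentiableAt ℝ (fun y : tangent p => (y : Amb m).2.2) x := hval.snd.snd
    exact (h1.const_add _).prodMk ((h2.const_add _).prodMk
      (((hN.sqrt (hpos x).ne').inv (Real.sqrt_pos.mpr (hpos x)).ne').smul (h3.const_add _)))
  · have lin : ∀ c d : ℝ, HasDerivAt (fun t : ℝ => c + t * d) d 0 := fun c d => by
      simpa using ((hasDerivAt_id (0 : ℝ)).mul_const d).const_add c
    set w := (x : Amb m).2.2 with hw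
    set v := (u : Amb m).2.2 with hv
    have hn : HasDerivAt (fun t : ℝ => 1 + realInner (w + t • v) (w + t • v))
        (2 * realInner w v) 0 := by
      have e : (fun t : ℝ => 1 + realInner (w + t • v) (w + t • v)) =
          fun t : ℝ => (1 + realInner w w) + t * (2 * realInner w v) + t ^ 2 * realInner v v := by
        ext t
        simp only [map_add, LinearMap.add_apply, map_smul, LinearMap.smul_apply, smul_eq_mul,
          realInner_comm v w]
        ring
      rw [e]
      refine ((lin _ _).add (((hasDerivAt_id (0 : ℝ)).fun_pow 2).mul_const _)).congr_deriv ?_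
      simp
    have h0 : (1 + realInner (w + (0 : ℝ) • v) (w + (0 : ℝ) • v)) = 1 + realInner w w := by simp
    have hsq := (hn.sqrt (by rw [h0]; exact (hpos x).ne')).fun_inv
      (by rw [h0]; exact (Real.sqrt_pos.mpr (hpos x)).ne')
    rw [h0] at hsq
    refine ((lin _ _).const_add _).prodMk (((lin _ _).const_add _).prodMk ?_)
    have h2 : HasDerivAt (fun t : ℝ => p.2.2 + (w + t • v)) v 0 := by
      simpa using (((hasDerivAt_id (0 : ℝ)).smul_const v).const_add w).const_add p.2.2
    refine (hsq.fun_smul h2).congr_deriv ?_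
    have hr : √(1 + realInner w w) ≠ 0 := (Real.sqrt_pos.mpr (hpos x)).ne'
    have hr2 : √(1 + realInner w w) ^ 2 = 1 + realInner w w := Real.sq_sqrt (hpos x).le
    have hc : -(2 * realInner w v / (2 * √(1 + realInner w w))) / √(1 + realInner w w) ^ 2 =
        -((√(1 + realInner w w))⁻¹ * ((1 + realInner w w)⁻¹ * realInner w v)) := by
      rw [hr2]
      field_simp
    rw [hc, h0]
    simp only [zero_smul, add_zero, smul_sub, smul_smul, neg_smul]
    abel

variable (m a l m₀) in
/-- The coefficient of `dτ²` of the Boyer-Lindquist metric in terms of `dτ` and the azimuthal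
form. -/
def coeffA (ρ : ℝ) : ℝ :=
  -((1 + l ^ 2 * ρ) / (1 - a ^ 2 * l ^ 2))
    + (a * l ^ 2) ^ 2 * ((ρ + a ^ 2) / (1 - a ^ 2 * l ^ 2)) + 2 * m₀ / (ρ + a ^ 2) ^ (m - 1)

variable (a l) in
/-- The coefficient of the round metric of the sphere in the Boyer-Lindquist metric. -/
def coeffC (ρ : ℝ) : ℝ := (ρ + a ^ 2) / (1 - a ^ 2 * l ^ 2)

variable (m a l m₀) in
/-- The mixed coefficient of the Boyer-Lindquist metric in terms of `dτ` and the azimuthal form. -/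
def coeffD (ρ : ℝ) : ℝ :=
  a * l ^ 2 * ((ρ + a ^ 2) / (1 - a ^ 2 * l ^ 2))
    - a / (1 - a ^ 2 * l ^ 2) * (2 * m₀ / (ρ + a ^ 2) ^ (m - 1))

variable (m a l m₀) in
/-- The coefficient of the square of the azimuthal form of the Boyer-Lindquist metric. -/
def coeffE (ρ : ℝ) : ℝ :=
  (a / (1 - a ^ 2 * l ^ 2)) ^ 2 * (2 * m₀ / (ρ + a ^ 2) ^ (m - 1))

/-- A metric on the patch around `p` which is built from `dτ`, `dρ`, the round metric of the sphere
and its azimuthal form, with coefficients depending on `ρ`. -/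
def modelMetric (A B C D E : ℝ → ℝ) (p : Amb m) (x u v : tangent p) : ℝ :=
  A (p.2.1 + (x : Amb m).2.1) * ((u : Amb m).1 * (v : Amb m).1)
  + B (p.2.1 + (x : Amb m).2.1) * ((u : Amb m).2.1 * (v : Amb m).2.1)
  + C (p.2.1 + (x : Amb m).2.1) * ((1 + realInner (x : Amb m).2.2 (x : Amb m).2.2)⁻¹
      * realInner (u : Amb m).2.2 (v : Amb m).2.2
    - (1 + realInner (x : Amb m).2.2 (x : Amb m).2.2)⁻¹
      * (1 + realInner (x : Amb m).2.2 (x : Amb m).2.2)⁻¹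
      * (realInner (x : Amb m).2.2 (u : Amb m).2.2 * realInner (x : Amb m).2.2 (v : Amb m).2.2))
  + D (p.2.1 + (x : Amb m).2.1) * ((1 + realInner (x : Amb m).2.2 (x : Amb m).2.2)⁻¹
      * ((u : Amb m).1 * (symp p.2.2 (v : Amb m).2.2 + symp (x : Amb m).2.2 (v : Amb m).2.2)
        + (v : Amb m).1 * (symp p.2.2 (u : Amb m).2.2 + symp (x : Amb m).2.2 (u : Amb m).2.2)))
  + E (p.2.1 + (x : Amb m).2.1) * ((1 + realInner (x : Amb m).2.2 (x : Amb m).2.2)⁻¹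
      * (1 + realInner (x : Amb m).2.2 (x : Amb m).2.2)⁻¹
      * ((symp p.2.2 (u : Amb m).2.2 + symp (x : Amb m).2.2 (u : Amb m).2.2)
        * (symp p.2.2 (v : Amb m).2.2 + symp (x : Amb m).2.2 (v : Amb m).2.2)))

/-- The normalising square roots occur only in pairs, so the result is rational in 1 + |x|². The
radial correction in the derivative of the patch drops out of the contact form because `symp`
vanishes on the diagonal. -/
theorem localMetric_kerrAdS {p : Amb m} (hp : realInner p.2.2 p.2.2 = 1) (x u v : tangent p) :
    localMetric (kerrAdS m a l m₀) p x u v =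
      modelMetric (coeffA m a l m₀) (radialCoeff m a l m₀) (coeffC a l) (coeffD m a l m₀)
        (coeffE m a l m₀) p x u v := by
  have hpos : 0 < 1 + realInner (x : Amb m).2.2 (x : Amb m).2.2 := by
    linarith [realInner_self_nonneg (x : Amb m).2.2]
  rw [localMetric, ContinuousLinearMap.bilinearComp_apply, kerrAdS_eq_metricForm,
    metricForm_apply, patch_eq hp]
  simp only [kappa, fderiv_patch hp, zero_mul, sub_zero]
  set w := (x : Amb m).2.2 with hw
  have hs : (√(1 + realInner w w))⁻¹ * (√(1 + realInner w w))⁻¹ = (1 + realInner w w)⁻¹ := by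
    rw [← mul_inv, Real.mul_self_sqrt hpos.le]
  generalize (√(1 + realInner w w))⁻¹ = s at hs
  have hS : (1 + realInner w w)⁻¹ * (1 + realInner w w) = 1 := inv_mul_cancel₀ hpos.ne'
  have hu := realInner_tangent u
  have hv := realInner_tangent v
  have hx : realInner p.2.2 w = 0 := realInner_tangent x
  have hself : realInner (s • (p.2.2 + w)) (s • (p.2.2 + w)) = 1 := by
    simp only [map_smul, LinearMap.smul_apply, smul_eq_mul, map_add, LinearMap.add_apply, hp, hx,
      realInner_comm w p.2.2]
    linear_combination (1 + realInner w w) * hs + hS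
  have hsymp : ∀ u : tangent p, symp (s • (p.2.2 + w)) (s • ((u : Amb m).2.2
      - ((1 + realInner w w)⁻¹ * realInner w (u : Amb m).2.2) • (p.2.2 + w))) =
      (1 + realInner w w)⁻¹ * (symp p.2.2 (u : Amb m).2.2 + symp w (u : Amb m).2.2) := fun u => by
    rw [← hs, map_smul, LinearMap.map_smul₂, map_sub, map_smul, symp_self, map_add,
      LinearMap.add_apply]
    simp only [smul_eq_mul]
    ring
  have hinner : realInner
      (s • ((u : Amb m).2.2 - ((1 + realInner w w)⁻¹ * realInner w (u : Amb m).2.2) • (p.2.2 + w)))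
      (s • ((v : Amb m).2.2 - ((1 + realInner w w)⁻¹ * realInner w (v : Amb m).2.2) • (p.2.2 + w)))
      = (1 + realInner w w)⁻¹ * realInner (u : Amb m).2.2 (v : Amb m).2.2
        - (1 + realInner w w)⁻¹ * (1 + realInner w w)⁻¹
          * (realInner w (u : Amb m).2.2 * realInner w (v : Amb m).2.2) := by
    simp only [map_smul, LinearMap.smul_apply, smul_eq_mul, map_add, LinearMap.add_apply, map_sub,
      LinearMap.sub_apply, hp, hx, hu, hv, realInner_comm w p.2.2,
      realInner_comm (u : Amb m).2.2 p.2.2, realInner_comm (u : Amb m).2.2 w]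
    generalize (1 + realInner w w)⁻¹ = S at *
    rw [← hs] at *
    linear_combination (s * s * (s * s) * realInner w (u : Amb m).2.2
      * realInner w (v : Amb m).2.2) * hS
  rw [hself, hsymp, hsymp, hinner]
  simp only [modelMetric, coeffA, coeffC, coeffD, coeffE, ← hw]
  ring

end LocalMetric

end KerrAdS

end

noncomputable section

namespace KerrAdS

theorem HasJet.comp_deriv {V : Type*} [NormedAddCommGroup V] [NormedSpace ℝ V] {f : V → ℝ} {x : V}
    {c : ℝ} {d : V → ℝ} {h : V → V → ℝ} {φ : ℝ → ℝ} (hf : HasJet f x c d h)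
    (hφ : ContDiffAt ℝ 2 φ c) :
    HasJet (fun y => φ (f y)) x (φ c) (fun a => deriv φ c * d a)
      (fun b a => deriv φ c * h b a + deriv (deriv φ) c * d b * d a) := by
  refine hf.comp hφ ?_ ?_
  · filter_upwards [hφ.eventually (by simp)] with t ht
    exact (ht.differentiableAt (by norm_num)).hasDerivAt
  · have h2 : DifferentiableAt ℝ (fderiv ℝ φ) c :=
      (hφ.fderiv_right (m := 1) (by norm_num)).differentiableAt (by norm_num)
    exact (h2.clm_apply (differentiableAt_const 1)).hasDerivAt

/-! ### The second-order jet of the metric at the centre of a patch -/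

section ModelJets

variable {m : ℕ} {p : Amb m}

/-- The symmetric product `dτ θ` of `dτ` and the azimuthal form `θ` at `p`. -/
def tauTheta (p : Amb m) (u v : tangent p) : ℝ :=
  (u : Amb m).1 * symp p.2.2 (v : Amb m).2.2 + (v : Amb m).1 * symp p.2.2 (u : Amb m).2.2

/-- The square of the azimuthal form at `p`. -/
def thetaTheta (p : Amb m) (u v : tangent p) : ℝ :=
  symp p.2.2 (u : Amb m).2.2 * symp p.2.2 (v : Amb m).2.2

/-- The derivative of the product of `dτ` and the azimuthal form in the direction `b`. -/
def tauSymp (b u v : tangent p) : ℝ :=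
  (u : Amb m).1 * symp (b : Amb m).2.2 (v : Amb m).2.2
    + (v : Amb m).1 * symp (b : Amb m).2.2 (u : Amb m).2.2

/-- The derivative of the square of the azimuthal form in the direction `b`. -/
def thetaSymp (b u v : tangent p) : ℝ :=
  symp p.2.2 (u : Amb m).2.2 * symp (b : Amb m).2.2 (v : Amb m).2.2
    + symp p.2.2 (v : Amb m).2.2 * symp (b : Amb m).2.2 (u : Amb m).2.2

/-- The metric at the centre of the patch, with coefficients `A, …, E`. -/
def modelValue (A B C D E : ℝ) (u v : tangent p) : ℝ :=
  A * ((u : Amb m).1 * (v : Amb m).1) + B * ((u : Amb m).2.1 * (v : Amb m).2.1)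
    + C * realInner (u : Amb m).2.2 (v : Amb m).2.2 + D * tauTheta p u v + E * thetaTheta p u v

/-- The first derivatives of the metric at the centre of the patch. -/
def modelDeriv (A₁ B₁ C₁ D D₁ E E₁ : ℝ) (b u v : tangent p) : ℝ :=
  (b : Amb m).2.1 * modelValue A₁ B₁ C₁ D₁ E₁ u v + D * tauSymp b u v + E * thetaSymp b u v

/-- The second derivatives of the metric at the centre of the patch. -/
def modelHessian (A₂ B₂ C C₂ D D₁ D₂ E E₁ E₂ : ℝ) (b c u v : tangent p) : ℝ :=
  (b : Amb m).2.1 * (c : Amb m).2.1 * modelValue A₂ B₂ C₂ D₂ E₂ u v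
    + (b : Amb m).2.1 * (D₁ * tauSymp c u v + E₁ * thetaSymp c u v)
    + (c : Amb m).2.1 * (D₁ * tauSymp b u v + E₁ * thetaSymp b u v)
    - C * (2 * (realInner (b : Amb m).2.2 (c : Amb m).2.2
        * realInner (u : Amb m).2.2 (v : Amb m).2.2)
      + realInner (b : Amb m).2.2 (u : Amb m).2.2 * realInner (c : Amb m).2.2 (v : Amb m).2.2
      + realInner (c : Amb m).2.2 (u : Amb m).2.2 * realInner (b : Amb m).2.2 (v : Amb m).2.2)
    - 2 * D * realInner (b : Amb m).2.2 (c : Amb m).2.2 * tauTheta p u v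
    - 4 * E * realInner (b : Amb m).2.2 (c : Amb m).2.2 * thetaTheta p u v
    + E * (symp (b : Amb m).2.2 (u : Amb m).2.2 * symp (c : Amb m).2.2 (v : Amb m).2.2
      + symp (c : Amb m).2.2 (u : Amb m).2.2 * symp (b : Amb m).2.2 (v : Amb m).2.2)

theorem modelHessian_comm (A₂ B₂ C C₂ D D₁ D₂ E E₁ E₂ : ℝ) (b c u v : tangent p) :
    modelHessian A₂ B₂ C C₂ D D₁ D₂ E E₁ E₂ b c u v =
      modelHessian A₂ B₂ C C₂ D D₁ D₂ E E₁ E₂ c b u v := by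
  simp only [modelHessian, realInner_comm (b : Amb m).2.2 (c : Amb m).2.2]
  ring

/-- This is the expansion (1 + |x|²)⁻¹ = 1 - |x|² + …; the absence of a linear term is the advantage
of this patch. -/
theorem hasJet_sphere :
    HasJet (fun x : tangent p => (1 + realInner (x : Amb m).2.2 (x : Amb m).2.2)⁻¹) 0 1
      (fun _ => 0) (fun b c => -2 * realInner (b : Amb m).2.2 (c : Amb m).2.2) := by
  have hre : ∀ i, HasJet (fun x : tangent p => ((x : Amb m).2.2 i).re) 0 0
      (fun c => ((c : Amb m).2.2 i).re) (fun _ _ => 0) := fun i =>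
    (HasJet.linear (Complex.reLm ∘ₗ (LinearMap.proj i : (Fin m → ℂ) →ₗ[ℝ] ℂ) ∘ₗ
      LinearMap.snd ℝ ℝ (Fin m → ℂ) ∘ₗ LinearMap.snd ℝ ℝ (ℝ × (Fin m → ℂ)) ∘ₗ
      (tangent p).subtype) 0).congr (map_zero _) (fun _ => rfl) (fun _ _ => rfl)
  have him : ∀ i, HasJet (fun x : tangent p => ((x : Amb m).2.2 i).im) 0 0
      (fun c => ((c : Amb m).2.2 i).im) (fun _ _ => 0) := fun i =>
    (HasJet.linear (Complex.imLm ∘ₗ (LinearMap.proj i : (Fin m → ℂ) →ₗ[ℝ] ℂ) ∘ₗ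
      LinearMap.snd ℝ ℝ (Fin m → ℂ) ∘ₗ LinearMap.snd ℝ ℝ (ℝ × (Fin m → ℂ)) ∘ₗ
      (tangent p).subtype) 0).congr (map_zero _) (fun _ => rfl) (fun _ _ => rfl)
  have hN : HasJet (fun x : tangent p => realInner (x : Amb m).2.2 (x : Amb m).2.2) 0 0
      (fun _ => 0) (fun b c => 2 * realInner (b : Amb m).2.2 (c : Amb m).2.2) := by
    refine (HasJet.sum Finset.univ fun i _ =>
      ((hre i).mul (hre i)).add ((him i).mul (him i))).congr ?_ ?_ ?_
    · simp
    · simp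
    · intro b c
      rw [realInner_apply, Finset.mul_sum]
      exact Finset.sum_congr rfl fun i _ => by ring
  have hN1 := (HasJet.const 1 (0 : tangent p)).add hN
  have hφ : ContDiffAt ℝ 2 (fun t : ℝ => t⁻¹) (1 + 0) := contDiffAt_inv ℝ (by norm_num)
  refine (hN1.comp (φ := fun t => t⁻¹) (φ' := fun t => -(t ^ 2)⁻¹) (φ'' := 2) hφ ?_ ?_).congr
    ?_ ?_ ?_
  · filter_upwards [isOpen_ne.mem_nhds (show (1 + 0 : ℝ) ≠ 0 by norm_num)] with t ht
    exact hasDerivAt_inv ht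
  · refine (((hasDerivAt_id (1 + 0 : ℝ)).fun_pow 2).fun_inv (by norm_num)).fun_neg.congr_deriv ?_
    norm_num
  · norm_num
  · intro c
    ring
  · intro b c
    ring

theorem hasJet_modelMetric {A B C D E : ℝ → ℝ} (hA : ContDiffAt ℝ 2 A p.2.1)
    (hB : ContDiffAt ℝ 2 B p.2.1) (hC : ContDiffAt ℝ 2 C p.2.1) (hD : ContDiffAt ℝ 2 D p.2.1)
    (hE : ContDiffAt ℝ 2 E p.2.1) (u v : tangent p) :
    HasJet (fun x => modelMetric A B C D E p x u v) 0
      (modelValue (A p.2.1) (B p.2.1) (C p.2.1) (D p.2.1) (E p.2.1) u v)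
      (fun b => modelDeriv (deriv A p.2.1) (deriv B p.2.1) (deriv C p.2.1) (D p.2.1)
        (deriv D p.2.1) (E p.2.1) (deriv E p.2.1) b u v)
      (fun b c => modelHessian (deriv (deriv A) p.2.1) (deriv (deriv B) p.2.1) (C p.2.1)
        (deriv (deriv C) p.2.1) (D p.2.1) (deriv D p.2.1) (deriv (deriv D) p.2.1) (E p.2.1)
        (deriv E p.2.1) (deriv (deriv E) p.2.1) b c u v) := by
  have hr : HasJet (fun x : tangent p => p.2.1 + (x : Amb m).2.1) 0 p.2.1
      (fun b => (b : Amb m).2.1) (fun _ _ => 0) := by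
    have h : HasJet (fun x : tangent p => (x : Amb m).2.1) 0 0 (fun b => (b : Amb m).2.1)
        (fun _ _ => 0) := HasJet.linear (LinearMap.fst ℝ ℝ (Fin m → ℂ) ∘ₗ
      LinearMap.snd ℝ ℝ (ℝ × (Fin m → ℂ)) ∘ₗ (tangent p).subtype) 0
    exact ((HasJet.const p.2.1 0).add h).congr (by ring) (fun b => by ring) (fun b c => by ring)
  have hin : ∀ u : tangent p, HasJet (fun x : tangent p => realInner (x : Amb m).2.2 (u : Amb m).2.2)
      0 0 (fun b => realInner (b : Amb m).2.2 (u : Amb m).2.2) (fun _ _ => 0) := fun u => by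
    refine (HasJet.linear (realInner.flip (u : Amb m).2.2 ∘ₗ LinearMap.snd ℝ ℝ (Fin m → ℂ) ∘ₗ
      LinearMap.snd ℝ ℝ (ℝ × (Fin m → ℂ)) ∘ₗ (tangent p).subtype) 0).congr ?_ (fun _ => rfl)
      (fun _ _ => rfl)
    simp
  have hθ : ∀ u : tangent p, HasJet (fun x : tangent p =>
      symp p.2.2 (u : Amb m).2.2 + symp (x : Amb m).2.2 (u : Amb m).2.2)
      0 (symp p.2.2 (u : Amb m).2.2) (fun b => symp (b : Amb m).2.2 (u : Amb m).2.2)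
      (fun _ _ => 0) := fun u => by
    refine ((HasJet.const (symp p.2.2 (u : Amb m).2.2) 0).add
      (HasJet.linear (symp.flip (u : Amb m).2.2 ∘ₗ LinearMap.snd ℝ ℝ (Fin m → ℂ) ∘ₗ
      LinearMap.snd ℝ ℝ (ℝ × (Fin m → ℂ)) ∘ₗ (tangent p).subtype) 0)).congr ?_ (fun b => ?_)
      (fun _ _ => ?_)
    · simp
    · simp
    · simp
  have hS := hasJet_sphere (p := p)
  have c := fun c : ℝ => HasJet.const c (0 : tangent p)
  have key := (((((hr.comp_deriv hA).mul (c ((u : Amb m).1 * (v : Amb m).1))).add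
    ((hr.comp_deriv hB).mul (c ((u : Amb m).2.1 * (v : Amb m).2.1)))).add
    ((hr.comp_deriv hC).mul ((hS.mul (c (realInner (u : Amb m).2.2 (v : Amb m).2.2))).sub
      ((hS.mul hS).mul ((hin u).mul (hin v)))))).add
    ((hr.comp_deriv hD).mul (hS.mul (((c (u : Amb m).1).mul (hθ v)).add
      ((c (v : Amb m).1).mul (hθ u)))))).add
    ((hr.comp_deriv hE).mul ((hS.mul hS).mul ((hθ u).mul (hθ v))))
  refine key.congr ?_ (fun b => ?_) (fun b c => ?_)
  · simp only [modelValue, tauTheta, thetaTheta]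
    ring
  · simp only [modelDeriv, modelValue, tauTheta, thetaTheta, tauSymp, thetaSymp]
    ring
  · simp only [modelHessian, modelValue, tauTheta, thetaTheta, tauSymp, thetaSymp]
    ring

end ModelJets

end KerrAdS

end

noncomputable section

namespace KerrAdS

/-! ### Dependence of curvature on the germ of the metric -/

section Germs

variable {V : Type*} [NormedAddCommGroup V] [NormedSpace ℝ V]
  {G G' : V → V →L[ℝ] V →L[ℝ] ℝ} {x : V}

theorem riemannLow_congr (h : G =ᶠ[nhds x] G') : riemannLow G x = riemannLow G' x := by
  have hΓ : ∀ u v, (fun y => christoffel G y u v) =ᶠ[nhds x] fun y => christoffel G' y u v := by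
    intro u v
    filter_upwards [h, h.fderiv (𝕜 := ℝ)] with y hy hy'
    simp only [christoffel, christoffelFst, hy, hy']
  funext u v w z
  simp only [riemannLow, riemann, (hΓ _ _).fderiv_eq, (hΓ _ _).eq_of_nhds, h.eq_of_nhds]

theorem sectional_congr (h : G =ᶠ[nhds x] G') (u v : V) :
    sectional G x u v = sectional G' x u v := by
  simp only [sectional, riemannLow_congr h, h.eq_of_nhds]

theorem kretschmann_congr [FiniteDimensional ℝ V] {ι : Type*} [Fintype ι]
    (h : G =ᶠ[nhds x] G') (b : Module.Basis ι ℝ V) :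
    kretschmann G x b = kretschmann G' x b := by
  simp only [kretschmann, raisedBasis, riemannLow_congr h, h.eq_of_nhds]

/-- A metric which is Lorentzian at a point is nondegenerate there. -/
theorem isInvertible_of_nondegenerate [FiniteDimensional ℝ V] {B : V →L[ℝ] V →L[ℝ] ℝ}
    (h : ∀ u, (∀ v, B u v = 0) → u = 0) : B.IsInvertible := by
  have hinj : Function.Injective B.toLinearMap := by
    rw [injective_iff_map_eq_zero]
    intro u hu
    refine h u fun v => ?_
    have hu' : B u = 0 := hu
    rw [hu']
    rfl
  have hdim : Module.finrank ℝ V = Module.finrank ℝ (V →L[ℝ] ℝ) := by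
    rw [← (LinearMap.toContinuousLinearMap (𝕜 := ℝ) (E := V) (F' := ℝ)).finrank_eq]
    exact (Subspace.dual_finrank_eq).symm
  let e := LinearEquiv.ofInjectiveOfFinrankEq B.toLinearMap hinj hdim
  exact ⟨e.toContinuousLinearEquiv, by ext u v; rfl⟩

end Germs

/-! ### Sectional curvature of the latitudinal planes -/

section Curvature

variable {m : ℕ} {a l m₀ : ℝ} {p : Amb m}

theorem localMetric_zero (hp : realInner p.2.2 p.2.2 = 1) (g : MetricField m) (u v : tangent p) :
    localMetric g p 0 u v = g p u v := by
  have h : ∀ u : tangent p, fderiv ℝ (patch p) 0 u = u := fun u => by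
    rw [fderiv_patch hp]
    simp
  rw [localMetric, ContinuousLinearMap.bilinearComp_apply, patch_zero hp, h, h]

/-- A nonzero vector in the kernel would be orthogonal to the timelike vector `e`, hence have
positive square, yet it is orthogonal to itself. -/
theorem isInvertible_localMetric (hp : realInner p.2.2 p.2.2 = 1) {g : MetricField m}
    (hg : IsLorentzianOn (g p) (tangent p)) : (localMetric g p 0).IsInvertible := by
  refine isInvertible_of_nondegenerate fun u hu => ?_
  obtain ⟨hs, e, he, _, hpos⟩ := hg
  by_contra hne
  have hne' : (u : Amb m) ≠ 0 := fun h => hne (Subtype.ext h)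
  have h1 : g p e u = 0 := by
    rw [hs e he u u.2, ← hu ⟨e, he⟩, localMetric_zero hp]
  have h2 := hpos u u.2 h1 hne'
  rw [← localMetric_zero hp g u u, hu u] at h2
  exact lt_irrefl _ h2

theorem contDiffAt_coeffs (hρ : -a ^ 2 < p.2.1) :
    ContDiffAt ℝ 2 (coeffA m a l m₀) p.2.1 ∧ ContDiffAt ℝ 2 (coeffC a l) p.2.1 ∧
      ContDiffAt ℝ 2 (coeffD m a l m₀) p.2.1 ∧ ContDiffAt ℝ 2 (coeffE m a l m₀) p.2.1 := by
  have hM : ContDiffAt ℝ 2 (fun ρ : ℝ => 2 * m₀ / (ρ + a ^ 2) ^ (m - 1)) p.2.1 := by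
    refine contDiffAt_const.div (by fun_prop) (pow_ne_zero _ ?_)
    linarith
  have hC : ContDiffAt ℝ 2 (coeffC a l) p.2.1 := by
    unfold coeffC
    fun_prop
  refine ⟨?_, hC, (contDiffAt_const.mul hC).sub (contDiffAt_const.mul hM),
    contDiffAt_const.mul hM⟩
  refine ContDiffAt.add (ContDiffAt.add (by fun_prop) (contDiffAt_const.mul hC)) hM

theorem contDiffAt_radialCoeff {n : ℕ∞} {ρ : ℝ} (hΦ : horizonPoly m a l m₀ ρ ≠ 0) :
    ContDiffAt ℝ n (radialCoeff m a l m₀) ρ := by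
  have hopen : IsOpen {ρ | horizonPoly m a l m₀ ρ ≠ 0} :=
    isOpen_ne_fun continuous_horizonPoly continuous_const
  exact (contDiffOn_radialCoeff.contDiffAt (hopen.mem_nhds hΦ)).of_le (mod_cast le_top)

/-- The derivatives of the Boyer-Lindquist metric at the centre of a patch. -/
theorem hasJet_localMetric (hp : p ∈ spacetime m a) (hΦ : horizonPoly m a l m₀ p.2.1 ≠ 0)
    (u v : tangent p) :
    HasJet (fun x => localMetric (kerrAdS m a l m₀) p x u v) 0
      (modelValue (coeffA m a l m₀ p.2.1) (radialCoeff m a l m₀ p.2.1) (coeffC a l p.2.1)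
        (coeffD m a l m₀ p.2.1) (coeffE m a l m₀ p.2.1) u v)
      (fun b => modelDeriv (deriv (coeffA m a l m₀) p.2.1) (deriv (radialCoeff m a l m₀) p.2.1)
        (deriv (coeffC a l) p.2.1) (coeffD m a l m₀ p.2.1) (deriv (coeffD m a l m₀) p.2.1)
        (coeffE m a l m₀ p.2.1) (deriv (coeffE m a l m₀) p.2.1) b u v)
      (fun b c => modelHessian (deriv (deriv (coeffA m a l m₀)) p.2.1)
        (deriv (deriv (radialCoeff m a l m₀)) p.2.1) (coeffC a l p.2.1)
        (deriv (deriv (coeffC a l)) p.2.1) (coeffD m a l m₀ p.2.1)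
        (deriv (coeffD m a l m₀) p.2.1) (deriv (deriv (coeffD m a l m₀)) p.2.1)
        (coeffE m a l m₀ p.2.1) (deriv (coeffE m a l m₀) p.2.1)
        (deriv (deriv (coeffE m a l m₀)) p.2.1) b c u v) := by
  obtain ⟨hp1, hp2⟩ := mem_spacetime_iff.mp hp
  obtain ⟨hA, hC, hD, hE⟩ := contDiffAt_coeffs (l := l) (m₀ := m₀) hp1
  simp only [localMetric_kerrAdS hp2]
  exact hasJet_modelMetric hA (contDiffAt_radialCoeff (n := 2) hΦ) hC hD hE u v

theorem localMetric_kerrAdS_symm (x u v : tangent p) :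
    localMetric (kerrAdS m a l m₀) p x u v = localMetric (kerrAdS m a l m₀) p x v u := by
  simp only [localMetric, ContinuousLinearMap.bilinearComp_apply, kerrAdS_eq_metricForm]
  exact metricForm_symm _ _ _ _ _

theorem riemannLow_kerrAdS (hm : 1 ≤ m) (hal : a ^ 2 * l ^ 2 < 1) (hm₀ : 0 < m₀)
    (hp : p ∈ spacetime m a) (hΦ : horizonPoly m a l m₀ p.2.1 ≠ 0) (u v w z : tangent p) :
    riemannLow (localMetric (kerrAdS m a l m₀) p) 0 u v w z =
      (metricHessian (localMetric (kerrAdS m a l m₀) p) 0 u w v z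
        - metricHessian (localMetric (kerrAdS m a l m₀) p) 0 u z v w
        - metricHessian (localMetric (kerrAdS m a l m₀) p) 0 v w u z
        + metricHessian (localMetric (kerrAdS m a l m₀) p) 0 v z u w) / 2
      - christoffelFst (localMetric (kerrAdS m a l m₀) p) 0 u z
          (christoffel (localMetric (kerrAdS m a l m₀) p) 0 v w)
      + christoffelFst (localMetric (kerrAdS m a l m₀) p) 0 v z
          (christoffel (localMetric (kerrAdS m a l m₀) p) 0 u w) := by
  have hjet := hasJet_localMetric (l := l) (m₀ := m₀) hp hΦ
  have hG := contDiffAt_of_hasJet hjet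
  refine riemannLow_eq hG (isInvertible_localMetric (mem_spacetime_iff.mp hp).2
    (isLorentzianOn_kerrAdS hm hal hm₀ hp hΦ)) localMetric_kerrAdS_symm
    (fun b c u v => ?_) u v w z
  rw [metricHessian_of_hasJet hjet hG, metricHessian_of_hasJet hjet hG]
  exact modelHessian_comm _ _ _ _ _ _ _ _ _ _ b c u v

theorem deriv_coeffC (ρ : ℝ) : deriv (coeffC a l) ρ = 1 / (1 - a ^ 2 * l ^ 2) := by
  unfold coeffC
  simp

/-- The sectional curvature of the Boyer-Lindquist metric for the planes tangent to the latitudinal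
spheres. -/
theorem sectionalAt_kerrAdS_of_latitudinal (hm : 1 ≤ m) (hal : a ^ 2 * l ^ 2 < 1) (hm₀ : 0 < m₀)
    (hp : p ∈ spacetime m a) (hΦ : horizonPoly m a l m₀ p.2.1 ≠ 0) {u v : tangent p}
    (hu1 : (u : Amb m).1 = 0) (hu2 : (u : Amb m).2.1 = 0) (hu3 : symp p.2.2 (u : Amb m).2.2 = 0)
    (hv1 : (v : Amb m).1 = 0) (hv2 : (v : Amb m).2.1 = 0) (hv3 : symp p.2.2 (v : Amb m).2.2 = 0)
    (huv : symp (u : Amb m).2.2 (v : Amb m).2.2 = 0) (hli : LinearIndependent ℝ ![u, v]) :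
    sectionalAt (kerrAdS m a l m₀) p u v =
      -l ^ 2 + 2 * m₀ * p.2.1 / (p.2.1 + a ^ 2) ^ (m + 1) := by
  obtain ⟨hp1, hp2⟩ := mem_spacetime_iff.mp hp
  have hΞ : 0 < 1 - a ^ 2 * l ^ 2 := by linarith
  have hX : 0 < p.2.1 + a ^ 2 := by linarith
  have hjet := hasJet_localMetric (l := l) (m₀ := m₀) hp hΦ
  have hG := contDiffAt_of_hasJet hjet
  have hd := fderiv_metric_of_hasJet hjet (hG.differentiableAt (by norm_num))
  have hinv := isInvertible_localMetric hp2 (isLorentzianOn_kerrAdS hm hal hm₀ hp hΦ)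
  have hvu : symp (v : Amb m).2.2 (u : Amb m).2.2 = 0 := by rw [symp_antisymm, huv, neg_zero]
  set G := localMetric (kerrAdS m a l m₀) p with hGdef
  have hB : radialCoeff m a l m₀ p.2.1 ≠ 0 := by
    unfold radialCoeff
    positivity
  -- The coordinate vector ∂_ρ, whose metric dual is a multiple of dρ; the Christoffel vectors below
  -- are multiples of it.
  let e : tangent p := ⟨((0, 1, 0) : Amb m), by rw [mem_tangent_iff]; simp⟩
  have he : ∀ w : tangent p, G 0 e w = radialCoeff m a l m₀ p.2.1 * (w : Amb m).2.1 := fun w => by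
    rw [(hjet e w).val]
    simp [modelValue, tauTheta, thetaTheta, e]
  -- All terms with `symp` vanish, so only the ρ-derivative of the coefficient of the round metric
  -- contributes.
  have hfst : ∀ x y : tangent p, (x : Amb m).1 = 0 → (x : Amb m).2.1 = 0 →
      symp p.2.2 (x : Amb m).2.2 = 0 → (y : Amb m).1 = 0 → (y : Amb m).2.1 = 0 →
      symp p.2.2 (y : Amb m).2.2 = 0 → symp (x : Amb m).2.2 (y : Amb m).2.2 = 0 →
      ∀ w : tangent p, christoffelFst G 0 x y w = -(1 / (2 * (1 - a ^ 2 * l ^ 2))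
        * realInner (x : Amb m).2.2 (y : Amb m).2.2) * (w : Amb m).2.1 := by
    intro x y hx1 hx2 hx3 hy1 hy2 hy3 hxy w
    have hyx : symp (y : Amb m).2.2 (x : Amb m).2.2 = 0 := by rw [symp_antisymm, hxy, neg_zero]
    rw [christoffelFst_apply, hd, hd, hd]
    simp only [modelDeriv, modelValue, tauTheta, thetaTheta, tauSymp, thetaSymp, hx1, hx2, hx3, hy1,
      hy2, hy3, hxy, hyx, deriv_coeffC]
    field_simp
    ring
  have hsnd : ∀ x y : tangent p, (x : Amb m).1 = 0 → (x : Amb m).2.1 = 0 →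
      symp p.2.2 (x : Amb m).2.2 = 0 → (y : Amb m).1 = 0 → (y : Amb m).2.1 = 0 →
      symp p.2.2 (y : Amb m).2.2 = 0 → symp (x : Amb m).2.2 (y : Amb m).2.2 = 0 →
      christoffel G 0 x y = (-(1 / (2 * (1 - a ^ 2 * l ^ 2))
        * realInner (x : Amb m).2.2 (y : Amb m).2.2) / radialCoeff m a l m₀ p.2.1) • e := by
    intro x y hx1 hx2 hx3 hy1 hy2 hy3 hxy
    have : christoffelFst G 0 x y = G 0 ((-(1 / (2 * (1 - a ^ 2 * l ^ 2))
        * realInner (x : Amb m).2.2 (y : Amb m).2.2) / radialCoeff m a l m₀ p.2.1) • e) := by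
      ext w
      rw [hfst x y hx1 hx2 hx3 hy1 hy2 hy3 hxy, map_smul, smul_apply, he, smul_eq_mul]
      field_simp
    rw [christoffel, this, inverse_apply_of_isInvertible hinv]
  set s := realInner (u : Amb m).2.2 (u : Amb m).2.2 with hs
  set q := realInner (v : Amb m).2.2 (v : Amb m).2.2 with hq
  set n := realInner (u : Amb m).2.2 (v : Amb m).2.2 with hn
  have hn' : realInner (v : Amb m).2.2 (u : Amb m).2.2 = n := realInner_comm _ _
  -- A Gauss equation: the first term is the curvature of a round sphere scaled by the coefficient
  -- of the round metric, the second comes from its second fundamental form in the direction ∂_ρ.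
  have hRm : riemannLow G 0 u v v u = (coeffC a l p.2.1
      - 1 / (4 * (1 - a ^ 2 * l ^ 2) ^ 2 * radialCoeff m a l m₀ p.2.1)) * (s * q - n ^ 2) := by
    rw [riemannLow_kerrAdS hm hal hm₀ hp hΦ, ← hGdef,
      hsnd v v hv1 hv2 hv3 hv1 hv2 hv3 (symp_self _),
      hsnd u v hu1 hu2 hu3 hv1 hv2 hv3 huv, map_smul, map_smul,
      hfst u u hu1 hu2 hu3 hu1 hu2 hu3 (symp_self _),
      hfst v u hv1 hv2 hv3 hu1 hu2 hu3 hvu]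
    simp only [metricHessian_of_hasJet hjet hG, modelHessian, modelValue, tauTheta, thetaTheta,
      tauSymp, thetaSymp, hu1, hu2, hu3, hv1, hv2, hv3, huv, hvu, symp_self, ← hs, ← hq, ← hn, hn',
      e, smul_eq_mul]
    field_simp
    ring
  have hGv : ∀ x y : tangent p, (x : Amb m).1 = 0 → (x : Amb m).2.1 = 0 →
      symp p.2.2 (x : Amb m).2.2 = 0 → (y : Amb m).1 = 0 →
      G 0 x y = coeffC a l p.2.1 * realInner (x : Amb m).2.2 (y : Amb m).2.2 := by
    intro x y hx1 hx2 hx3 hy1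
    rw [(hjet x y).val]
    simp [modelValue, tauTheta, thetaTheta, hx1, hx2, hx3, hy1]
  -- The Gram determinant is nonzero because |s v - n u|² = s (s q - n²), and this vector is nonzero
  -- by independence.
  have hdet : s * q - n ^ 2 ≠ 0 := by
    intro h0
    have hu0 : (u : Amb m).2.2 ≠ 0 := by
      intro h
      refine hli.ne_zero 0 (Subtype.ext ?_)
      exact Prod.ext hu1 (Prod.ext hu2 h)
    have hspos : 0 < s := realInner_self_pos hu0
    have hzero : s • (v : Amb m).2.2 - n • (u : Amb m).2.2 = 0 := by
      by_contra hne
      have := realInner_self_pos hne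
      simp only [map_sub, map_smul, LinearMap.sub_apply, LinearMap.smul_apply, smul_eq_mul, ← hs,
        ← hq, ← hn, hn'] at this
      nlinarith
    have hlin : (-n) • u + s • v = 0 := by
      refine Subtype.ext (Prod.ext ?_ (Prod.ext ?_ ?_))
      · simp [hu1, hv1]
      · simp [hu2, hv2]
      · refine Eq.trans ?_ hzero
        simp
        abel
    have := (LinearIndependent.pair_iff.mp hli (-n) s hlin).2
    exact hspos.ne' this
  rw [sectionalAt, sectional, ← hGdef, hRm, hGv u u hu1 hu2 hu3 hu1, hGv v v hv1 hv2 hv3 hv1,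
    hGv u v hu1 hu2 hu3 hv1, ← hs, ← hq, ← hn]
  have hCne : coeffC a l p.2.1 ≠ 0 := by
    unfold coeffC
    positivity
  have e1 : coeffC a l p.2.1 * s * (coeffC a l p.2.1 * q) - (coeffC a l p.2.1 * n) ^ 2 =
      coeffC a l p.2.1 ^ 2 * (s * q - n ^ 2) := by ring
  rw [e1, mul_div_mul_right _ _ hdet]
  obtain ⟨k, rfl⟩ : ∃ k, m = k + 1 := ⟨m - 1, by omega⟩
  simp only [radialCoeff, coeffC, Nat.add_sub_cancel]
  have hU : (p.2.1 + a ^ 2) ^ k ≠ 0 := pow_ne_zero _ hX.ne'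
  have hXne := hX.ne'
  have hΞne := hΞ.ne'
  have e2 : 1 / (4 * (1 - a ^ 2 * l ^ 2) ^ 2 * ((p.2.1 + a ^ 2) ^ k
      / (4 * horizonPoly (k + 1) a l m₀ p.2.1))) =
      horizonPoly (k + 1) a l m₀ p.2.1 / ((1 - a ^ 2 * l ^ 2) ^ 2 * (p.2.1 + a ^ 2) ^ k) := by
    field_simp
  rw [e2, horizonPoly, pow_succ, pow_succ, pow_succ]
  field_simp
  ring

end Curvature

end KerrAdS

end

noncomputable section

namespace KerrAdS

/-! ### Symmetries and multilinearity of the curvature tensor -/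

section CurvatureSymmetries

variable {V : Type*} [NormedAddCommGroup V] [NormedSpace ℝ V] [FiniteDimensional ℝ V]
  {G : V → V →L[ℝ] V →L[ℝ] ℝ} {x : V}

theorem christoffelFst_comm (hG : DifferentiableAt ℝ G x) (hsymm : ∀ y u v, G y u v = G y v u)
    (u v : V) : christoffelFst G x u v = christoffelFst G x v u := by
  ext w
  rw [christoffelFst_apply, christoffelFst_apply, fderiv_metric_symm hG hsymm w u v]
  ring

theorem apply_inverse_comm (hinv : (G x).IsInvertible) (hsymm : ∀ y u v, G y u v = G y v u)
    (α β : V →L[ℝ] ℝ) : α ((G x).inverse β) = β ((G x).inverse α) := by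
  conv_lhs => rw [← apply_inverse_of_isInvertible hinv α]
  conv_rhs => rw [← apply_inverse_of_isInvertible hinv β]
  exact hsymm _ _ _

theorem metricHessian_symm (hG : ContDiffAt ℝ 2 G x) (hsymm : ∀ y u v, G y u v = G y v u)
    (b a u v : V) : metricHessian G x b a u v = metricHessian G x b a v u := by
  refine congrArg (fun A : V →L[ℝ] ℝ => A b) (Filter.EventuallyEq.fderiv_eq ?_)
  filter_upwards [hG.eventually (by simp)] with y hy
  exact fderiv_metric_symm (hy.differentiableAt (by norm_num)) hsymm a u v

/-- The curvature tensor is antisymmetric in its first two arguments. -/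
theorem riemannLow_antisymm (u v w z : V) : riemannLow G x u v w z = -riemannLow G x v u w z := by
  have : riemann G x u v w = -riemann G x v u w := by
    simp only [riemann]
    abel
  rw [riemannLow, this, map_neg, neg_apply, riemannLow]

/-- The curvature tensor is antisymmetric in its last two arguments. -/
theorem riemannLow_antisymm' (hG : ContDiffAt ℝ 2 G x) (hinv : (G x).IsInvertible)
    (hsymm : ∀ y u v, G y u v = G y v u)
    (hschwarz : ∀ a b u v, metricHessian G x a b u v = metricHessian G x b a u v) (u v w z : V) :
    riemannLow G x u v w z = -riemannLow G x u v z w := by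
  rw [riemannLow_eq hG hinv hsymm hschwarz, riemannLow_eq hG hinv hsymm hschwarz]
  simp only [christoffel]
  rw [apply_inverse_comm hinv hsymm (christoffelFst G x u z),
    apply_inverse_comm hinv hsymm (christoffelFst G x v z)]
  ring

/-- The curvature tensor is symmetric under the exchange of its two pairs of arguments. -/
theorem riemannLow_pair_symm (hG : ContDiffAt ℝ 2 G x) (hinv : (G x).IsInvertible)
    (hsymm : ∀ y u v, G y u v = G y v u)
    (hschwarz : ∀ a b u v, metricHessian G x a b u v = metricHessian G x b a u v) (u v w z : V) :
    riemannLow G x u v w z = riemannLow G x w z u v := by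
  have hs := metricHessian_symm hG hsymm
  have hc := christoffelFst_comm (hG.differentiableAt (by norm_num)) hsymm
  rw [riemannLow_eq hG hinv hsymm hschwarz, riemannLow_eq hG hinv hsymm hschwarz]
  simp only [christoffel]
  rw [apply_inverse_comm hinv hsymm (christoffelFst G x u z), hc v w, hc u z, hc v z, hc u w,
    hschwarz w u, hschwarz w v, hschwarz z u, hschwarz z v, hs u w v z, hs u z v w, hs v w u z,
    hs v z u w]
  ring

theorem isLinearMap_riemannLow_fourth (u v w : V) :
    IsLinearMap ℝ (fun z => riemannLow G x u v w z) :=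
  (G x (riemann G x u v w)).toLinearMap.isLinear

/-- Linearity in the last argument is immediate from the definition; antisymmetry and pair symmetry
carry it to the other three. -/
theorem isLinearMap_riemannLow_third (hG : ContDiffAt ℝ 2 G x) (hinv : (G x).IsInvertible)
    (hsymm : ∀ y u v, G y u v = G y v u)
    (hschwarz : ∀ a b u v, metricHessian G x a b u v = metricHessian G x b a u v) (u v z : V) :
    IsLinearMap ℝ (fun w => riemannLow G x u v w z) := by
  have h := isLinearMap_riemannLow_fourth (G := G) (x := x) u v z
  refine ⟨fun y y' => ?_, fun c y => ?_⟩
  all_goals simp only [riemannLow_antisymm' hG hinv hsymm hschwarz u v _ z]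
  · rw [h.map_add, neg_add]
  · rw [h.map_smul, smul_neg]

theorem isLinearMap_riemannLow_second (hG : ContDiffAt ℝ 2 G x) (hinv : (G x).IsInvertible)
    (hsymm : ∀ y u v, G y u v = G y v u)
    (hschwarz : ∀ a b u v, metricHessian G x a b u v = metricHessian G x b a u v) (u w z : V) :
    IsLinearMap ℝ (fun v => riemannLow G x u v w z) := by
  simp only [fun v => riemannLow_pair_symm hG hinv hsymm hschwarz u v w z]
  exact isLinearMap_riemannLow_fourth w z u

theorem isLinearMap_riemannLow_first (hG : ContDiffAt ℝ 2 G x) (hinv : (G x).IsInvertible)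
    (hsymm : ∀ y u v, G y u v = G y v u)
    (hschwarz : ∀ a b u v, metricHessian G x a b u v = metricHessian G x b a u v) (v w z : V) :
    IsLinearMap ℝ (fun u => riemannLow G x u v w z) := by
  simp only [fun u => riemannLow_pair_symm hG hinv hsymm hschwarz u v w z]
  exact isLinearMap_riemannLow_third hG hinv hsymm hschwarz w z v

end CurvatureSymmetries

/-! ### Basis independence of the Kretschmann scalar -/

section Contraction

variable {V : Type*} [NormedAddCommGroup V] [NormedSpace ℝ V] [FiniteDimensional ℝ V]
  {G : V → V →L[ℝ] V →L[ℝ] ℝ} {x : V} {ι κ : Type*} [Fintype ι] [Fintype κ]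

theorem _root_.IsLinearMap.map_sum_smul {W : Type*} [AddCommGroup W] [Module ℝ W] {f : W → ℝ}
    (hf : IsLinearMap ℝ f) (s : Finset κ) (c : κ → ℝ) (v : κ → W) :
    f (∑ k ∈ s, c k • v k) = ∑ k ∈ s, c k * f (v k) := by
  have h : f (∑ k ∈ s, c k • v k) = hf.mk' f (∑ k ∈ s, c k • v k) := rfl
  rw [h, map_sum]
  exact Finset.sum_congr rfl fun k _ => hf.map_smul _ _

/-- The metric contraction of a bilinear form does not depend on the basis. -/
theorem contraction_eq (b : Module.Basis ι ℝ V) (b' : Module.Basis κ ℝ V) {F : V → V → ℝ}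
    (h1 : ∀ y, IsLinearMap ℝ (fun z => F z y)) (h2 : ∀ y, IsLinearMap ℝ (F y)) :
    ∑ i, F (b i) (raisedBasis G x b i) = ∑ j, F (b' j) (raisedBasis G x b' j) := by
  -- The raised vectors transform with the transpose of the matrix that expresses `b` in `b'`, so
  -- the two sums can be interchanged.
  have hr : ∀ j, raisedBasis G x b' j = ∑ i, b'.coord j (b i) • raisedBasis G x b i := fun j => by
    have : LinearMap.toContinuousLinearMap (b'.coord j) =
        ∑ i, b'.coord j (b i) • LinearMap.toContinuousLinearMap (b.coord i) := by
      ext v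
      have h := congrArg (b'.coord j) (b.sum_repr v)
      rw [map_sum] at h
      simp only [map_smul, smul_eq_mul, Module.Basis.coord_apply] at h
      simpa [mul_comm] using h.symm
    rw [raisedBasis, this, map_sum]
    simp only [map_smul, raisedBasis]
  have hb : ∀ i, b i = ∑ j, b'.coord j (b i) • b' j := fun i => by
    conv_lhs => rw [← b'.sum_repr (b i)]
    simp
  calc ∑ i, F (b i) (raisedBasis G x b i)
      = ∑ i, ∑ j, b'.coord j (b i) * F (b' j) (raisedBasis G x b i) := by
        refine Finset.sum_congr rfl fun i _ => ?_
        conv_lhs => rw [hb i]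
        exact (h1 _).map_sum_smul _ _ _
    _ = ∑ j, ∑ i, b'.coord j (b i) * F (b' j) (raisedBasis G x b i) := Finset.sum_comm
    _ = ∑ j, F (b' j) (raisedBasis G x b' j) := by
        refine Finset.sum_congr rfl fun j _ => ?_
        rw [hr j, (h2 _).map_sum_smul]

theorem _root_.IsLinearMap.fun_const_mul {W : Type*} [AddCommGroup W] [Module ℝ W] {f : W → ℝ}
    (hf : IsLinearMap ℝ f) (c : ℝ) : IsLinearMap ℝ (fun y => c * f y) :=
  ⟨fun y z => by rw [hf.map_add, mul_add],
    fun t y => by rw [hf.map_smul, smul_eq_mul, smul_eq_mul]; ring⟩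

theorem _root_.IsLinearMap.fun_mul_const {W : Type*} [AddCommGroup W] [Module ℝ W] {f : W → ℝ}
    (hf : IsLinearMap ℝ f) (c : ℝ) : IsLinearMap ℝ (fun y => f y * c) :=
  ⟨fun y z => by rw [hf.map_add, add_mul],
    fun t y => by rw [hf.map_smul, smul_eq_mul, smul_eq_mul]; ring⟩

theorem _root_.IsLinearMap.fun_sum {W : Type*} [AddCommGroup W] [Module ℝ W] {f : κ → W → ℝ}
    (hf : ∀ k, IsLinearMap ℝ (f k)) : IsLinearMap ℝ (fun y => ∑ k, f k y) :=
  ⟨fun y z => by rw [← Finset.sum_add_distrib]; exact Finset.sum_congr rfl fun k _ => (hf k).map_add y z,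
    fun t y => by
      rw [Finset.smul_sum]
      exact Finset.sum_congr rfl fun k _ => (hf k).map_smul t y⟩

/-- The four contracted index pairs are moved to the new basis one at a time, each by
`contraction_eq` for the bilinear form obtained by freezing the other arguments. -/
theorem kretschmann_eq_of_basis (hG : ContDiffAt ℝ 2 G x) (hinv : (G x).IsInvertible)
    (hsymm : ∀ y u v, G y u v = G y v u)
    (hschwarz : ∀ a b u v, metricHessian G x a b u v = metricHessian G x b a u v)
    (b : Module.Basis ι ℝ V) (b' : Module.Basis κ ℝ V) :
    kretschmann G x b = kretschmann G x b' := by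
  have l1 := isLinearMap_riemannLow_first hG hinv hsymm hschwarz
  have l2 := isLinearMap_riemannLow_second hG hinv hsymm hschwarz
  have l3 := isLinearMap_riemannLow_third hG hinv hsymm hschwarz
  have l4 := isLinearMap_riemannLow_fourth (G := G) (x := x)
  unfold kretschmann
  set T := riemannLow G x with hT
  calc _ = ∑ i, ∑ j, ∑ k, ∑ n', T (b i) (b j) (b k) (b' n')
          * T (raisedBasis G x b i) (raisedBasis G x b j) (raisedBasis G x b k)
            (raisedBasis G x b' n') := by
        refine Finset.sum_congr rfl fun i _ => Finset.sum_congr rfl fun j _ =>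
          Finset.sum_congr rfl fun k _ => ?_
        exact contraction_eq b b' (F := fun y z => T (b i) (b j) (b k) y
          * T (raisedBasis G x b i) (raisedBasis G x b j) (raisedBasis G x b k) z)
          (fun y => (l4 _ _ _).fun_mul_const _) (fun y => (l4 _ _ _).fun_const_mul _)
    _ = ∑ i, ∑ j, ∑ k', ∑ n', T (b i) (b j) (b' k') (b' n')
          * T (raisedBasis G x b i) (raisedBasis G x b j) (raisedBasis G x b' k')
            (raisedBasis G x b' n') := by
        refine Finset.sum_congr rfl fun i _ => Finset.sum_congr rfl fun j _ => ?_
        exact contraction_eq b b' (F := fun y z => ∑ n', T (b i) (b j) y (b' n')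
          * T (raisedBasis G x b i) (raisedBasis G x b j) z (raisedBasis G x b' n'))
          (fun y => IsLinearMap.fun_sum fun n => (l3 _ _ _).fun_mul_const _)
          (fun y => IsLinearMap.fun_sum fun n => (l3 _ _ _).fun_const_mul _)
    _ = ∑ i, ∑ j', ∑ k', ∑ n', T (b i) (b' j') (b' k') (b' n')
          * T (raisedBasis G x b i) (raisedBasis G x b' j') (raisedBasis G x b' k')
            (raisedBasis G x b' n') := by
        refine Finset.sum_congr rfl fun i _ => ?_
        exact contraction_eq b b' (F := fun y z => ∑ k', ∑ n', T (b i) y (b' k') (b' n')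
          * T (raisedBasis G x b i) z (raisedBasis G x b' k') (raisedBasis G x b' n'))
          (fun y => IsLinearMap.fun_sum fun k => IsLinearMap.fun_sum fun n =>
            (l2 _ _ _).fun_mul_const _)
          (fun y => IsLinearMap.fun_sum fun k => IsLinearMap.fun_sum fun n =>
            (l2 _ _ _).fun_const_mul _)
    _ = _ := by
        exact contraction_eq b b' (F := fun y z => ∑ j', ∑ k', ∑ n', T y (b' j') (b' k') (b' n')
          * T z (raisedBasis G x b' j') (raisedBasis G x b' k') (raisedBasis G x b' n'))
          (fun y => IsLinearMap.fun_sum fun j => IsLinearMap.fun_sum fun k =>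
            IsLinearMap.fun_sum fun n => (l1 _ _ _).fun_mul_const _)
          (fun y => IsLinearMap.fun_sum fun j => IsLinearMap.fun_sum fun k =>
            IsLinearMap.fun_sum fun n => (l1 _ _ _).fun_const_mul _)

end Contraction

end KerrAdS

end

noncomputable section

namespace KerrAdS

/-! ### The curvature tensor in dimension five, in a frame -/

section FrameTensors

/-- The components of `dτ` in the frame. -/
def frameTau (a l : ℝ) : Fin 5 → ℝ := ![1 - a ^ 2 * l ^ 2, 0, a, 0, 0]

/-- The components of the azimuthal form in the frame. -/
def frameTheta (a l : ℝ) : Fin 5 → ℝ :=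
  ![-(a * l ^ 2 * (1 - a ^ 2 * l ^ 2)), 0, 1 - a ^ 2 * l ^ 2, 0, 0]

/-- The components of `dρ` in the frame. -/
def frameRho : Fin 5 → ℝ := ![0, 1, 0, 0, 0]

/-- The components of the symplectic form in the frame. -/
def frameSymp : Fin 5 → Fin 5 → ℝ :=
  ![![0, 0, 0, 0, 0], ![0, 0, 0, 0, 0], ![0, 0, 0, 0, 0], ![0, 0, 0, 0, 1], ![0, 0, 0, -1, 0]]

/-- A symmetric form with the symmetries of the metric. -/
def frameForm (P Q R B C : ℝ) : Fin 5 → Fin 5 → ℝ :=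
  ![![P, 0, Q, 0, 0], ![0, B, 0, 0, 0], ![Q, 0, R, 0, 0], ![0, 0, 0, C, 0], ![0, 0, 0, 0, C]]

/-- The components of the round metric of the sphere in the frame. -/
def frameInner (a l : ℝ) (i j : Fin 5) : ℝ :=
  frameTheta a l i * frameTheta a l j + frameForm 0 0 0 0 1 i j

/-- The Christoffel symbols of the first kind in the frame. -/
def frameChristoffel (g₁ : Fin 5 → Fin 5 → ℝ) (lam : Fin 5 → ℝ) (i j k : Fin 5) : ℝ :=
  (frameRho i * g₁ j k + frameRho j * g₁ i k - frameRho k * g₁ i j) / 2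
    + frameSymp i k * lam j + frameSymp j k * lam i

/-- The second derivatives of the metric in the frame. -/
def frameHessian (a l C E : ℝ) (g₂ : Fin 5 → Fin 5 → ℝ) (lam lam₁ : Fin 5 → ℝ)
    (b c i j : Fin 5) : ℝ :=
  frameRho b * frameRho c * g₂ i j
    + frameRho b * (frameSymp c j * lam₁ i + frameSymp c i * lam₁ j)
    + frameRho c * (frameSymp b j * lam₁ i + frameSymp b i * lam₁ j)
    - 2 * frameInner a l b c * (C * frameInner a l i j + frameTheta a l i * lam j
      + lam i * frameTheta a l j)
    - C * (frameInner a l b i * frameInner a l c j + frameInner a l c i * frameInner a l b j)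
    + E * (frameSymp b i * frameSymp c j + frameSymp c i * frameSymp b j)

/-- The inverse metric in the frame. -/
def framePair (P Q R N C : ℝ) (α β : Fin 5 → ℝ) : ℝ :=
  -(R * (α 0 * β 0) - Q * (α 0 * β 2 + α 2 * β 0) + P * (α 2 * β 2)) / N
    + 4 * N * (α 1 * β 1) + (α 3 * β 3 + α 4 * β 4) / C

/-- The curvature tensor in terms of the derivatives of the metric in a frame. -/
def frameRiemann (h : Fin 5 → Fin 5 → Fin 5 → Fin 5 → ℝ) (γ : Fin 5 → Fin 5 → Fin 5 → ℝ)
    (pr : (Fin 5 → ℝ) → (Fin 5 → ℝ) → ℝ) (i j k n : Fin 5) : ℝ :=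
  (h i k j n - h i n j k - h j k i n + h j n i k) / 2 - pr (γ i n) (γ j k) + pr (γ j n) (γ i k)

/-- The first and the second index of the pairs `i < j`. -/
def pairFst : Fin 10 → Fin 5 := ![0, 0, 0, 0, 1, 1, 1, 2, 2, 3]

/-- The second index of the pairs `i < j`. -/
def pairSnd : Fin 10 → Fin 5 := ![1, 2, 3, 4, 2, 3, 4, 3, 4, 4]

/-- The curvature which is not due to the cosmological constant, up to a factor. -/
def frameWeyl (a X P Q R N B C : ℝ) : Fin 10 → Fin 10 → ℝ :=
  ![![2 * X * B * P + 2, 0, 0, 0, -(2 * X * B * Q), 0, 0, 0, 0, -(4 * a * C)],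
    ![0, -(2 * X * N), 0, 0, 0, 0, 0, 0, 0, 0],
    ![0, 0, -(C * (2 * X * P + 4 * N)), 0, 0, 0, -(2 * a * C), -(2 * X * Q * C), 0, 0],
    ![0, 0, 0, -(C * (2 * X * P + 4 * N)), 0, 2 * a * C, 0, 0, -(2 * X * Q * C), 0],
    ![-(2 * X * B * Q), 0, 0, 0, 2 * X * B * R, 0, 0, 0, 0, 0],
    ![0, 0, 0, 2 * a * C, 0, 2 * (R - a ^ 2) * B * C, 0, 0, 0, 0],
    ![0, 0, -(2 * a * C), 0, 0, 0, 2 * (R - a ^ 2) * B * C, 0, 0, 0],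
    ![0, 0, -(2 * X * Q * C), 0, 0, 0, 0, -(2 * X * R * C), 0, 0],
    ![0, 0, 0, -(2 * X * Q * C), 0, 0, 0, 0, -(2 * X * R * C), 0],
    ![-(4 * a * C), 0, 0, 0, 0, 0, 0, 0, 0, 2 * (3 * a ^ 2 - R) * C ^ 2]]

-- Here X = ρ + a², N = Φ / X, and N₁, P₁, P₂, Q₁ stand for the ρ-derivatives of N, P, Q. The result
-- is a tensor of constant curvature -l² plus a multiple of m₀ / X³. The second derivative B₂ of the
-- radial coefficient is arbitrary because it cancels by antisymmetry.
set_option maxHeartbeats 4000000 in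
theorem frameRiemann_eq {a l m₀ X N B₂ : ℝ} (hX : X ≠ 0) (hΞ : 1 - a ^ 2 * l ^ 2 ≠ 0)
    (hN : N ≠ 0) (hNX : N = (1 + l ^ 2 * (X - a ^ 2)) * X - 2 * m₀ * (X - a ^ 2) / X)
    {N₁ P P₁ P₂ Q Q₁ : ℝ}
    (hN₁ : N₁ = l ^ 2 * X + (1 + l ^ 2 * (X - a ^ 2)) - 2 * m₀ * a ^ 2 / X ^ 2)
    (hP : P = -(1 + l ^ 2 * (X - a ^ 2)) * (1 - a ^ 2 * l ^ 2) + 2 * m₀ / X)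
    (hP₁ : P₁ = -l ^ 2 * (1 - a ^ 2 * l ^ 2) - 2 * m₀ / X ^ 2)
    (hP₂ : P₂ = 4 * m₀ / X ^ 3)
    (hQ : Q = -(a * (1 + l ^ 2 * (X - a ^ 2)))) (hQ₁ : Q₁ = -(a * l ^ 2)) (I J : Fin 10) :
    frameRiemann (frameHessian a l (X / (1 - a ^ 2 * l ^ 2))
        ((a / (1 - a ^ 2 * l ^ 2)) ^ 2 * (2 * m₀ / X)) (frameForm P₂ 0 0 B₂ 0)
        ![a * l ^ 2 * X - a / (1 - a ^ 2 * l ^ 2) * (2 * m₀ / X), 0,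
          a * (a * l ^ 2) * X / (1 - a ^ 2 * l ^ 2), 0, 0]
        ![a * l ^ 2 + a / (1 - a ^ 2 * l ^ 2) * (2 * m₀ / X ^ 2), 0,
          a * (a * l ^ 2) / (1 - a ^ 2 * l ^ 2), 0, 0])
      (frameChristoffel (frameForm P₁ Q₁ 1 (-(N₁ / (4 * N ^ 2))) (1 / (1 - a ^ 2 * l ^ 2)))
        ![a * l ^ 2 * X - a / (1 - a ^ 2 * l ^ 2) * (2 * m₀ / X), 0,
          a * (a * l ^ 2) * X / (1 - a ^ 2 * l ^ 2), 0, 0])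
      (framePair P Q (X - a ^ 2) N (X / (1 - a ^ 2 * l ^ 2)))
      (pairFst I) (pairSnd I) (pairFst J) (pairSnd J) =
    -l ^ 2 * (frameForm P Q (X - a ^ 2) (1 / (4 * N)) (X / (1 - a ^ 2 * l ^ 2))
          (pairFst I) (pairSnd J)
        * frameForm P Q (X - a ^ 2) (1 / (4 * N)) (X / (1 - a ^ 2 * l ^ 2)) (pairSnd I) (pairFst J)
      - frameForm P Q (X - a ^ 2) (1 / (4 * N)) (X / (1 - a ^ 2 * l ^ 2)) (pairFst I) (pairFst J)
        * frameForm P Q (X - a ^ 2) (1 / (4 * N)) (X / (1 - a ^ 2 * l ^ 2)) (pairSnd I) (pairSnd J))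
      + m₀ / X ^ 3 * frameWeyl a X P Q (X - a ^ 2) N (1 / (4 * N)) (X / (1 - a ^ 2 * l ^ 2)) I J := by
  have hΞ' : 1 - l ^ 2 * a ^ 2 ≠ 0 := by rwa [mul_comm]
  fin_cases I <;> fin_cases J
  all_goals
    simp only [frameRiemann, frameHessian, frameChristoffel, framePair, frameInner, frameTheta,
      frameForm, frameSymp, frameRho, pairFst, pairSnd, frameWeyl, Fin.isValue, Fin.zero_eta, Fin.mk_one, Fin.reduceFinMk, Matrix.cons_val,
      Matrix.cons_val_zero, Matrix.cons_val_one, mul_zero, zero_mul, add_zero, zero_add, sub_zero,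
      zero_sub, mul_one, one_mul, sub_self, neg_zero, zero_div, mul_neg, neg_mul, neg_neg]
  all_goals
    try simp only [hN₁, hP, hP₁, hP₂, hQ, hQ₁]
    first
    | (field_simp; ring1)
    | (field_simp; rw [hNX]; field_simp; ring1)

end FrameTensors

end KerrAdS

end

noncomputable section

namespace KerrAdS

/-! ### The Kretschmann scalar as the trace of a squared operator -/

section MixedContraction

variable {V : Type*} [NormedAddCommGroup V] [NormedSpace ℝ V] [FiniteDimensional ℝ V]
  {G : V → V →L[ℝ] V →L[ℝ] ℝ} {x : V} {ι : Type*} [Fintype ι]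

/-- The metric contraction of a bilinear form is symmetric. -/
theorem contraction_comm (hinv : (G x).IsInvertible) (hsymm : ∀ y u v, G y u v = G y v u)
    (b : Module.Basis ι ℝ V) {F : V → V → ℝ}
    (h1 : ∀ y, IsLinearMap ℝ (fun z => F z y)) (h2 : ∀ y, IsLinearMap ℝ (F y)) :
    ∑ i, F (b i) (raisedBasis G x b i) = ∑ i, F (raisedBasis G x b i) (b i) := by
  have hr : ∀ i, raisedBasis G x b i = ∑ j, b.coord j (raisedBasis G x b i) • b j := fun i => by
    conv_lhs => rw [← b.sum_repr (raisedBasis G x b i)]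
    simp
  have hs : ∀ i j, b.coord j (raisedBasis G x b i) = b.coord i (raisedBasis G x b j) := fun i j =>
    apply_inverse_comm hinv hsymm (LinearMap.toContinuousLinearMap (b.coord j))
      (LinearMap.toContinuousLinearMap (b.coord i))
  calc ∑ i, F (b i) (raisedBasis G x b i)
      = ∑ i, ∑ j, b.coord j (raisedBasis G x b i) * F (b i) (b j) := by
        refine Finset.sum_congr rfl fun i _ => ?_
        conv_lhs => rw [hr i]
        exact (h2 _).map_sum_smul _ _ _
    _ = ∑ j, ∑ i, b.coord i (raisedBasis G x b j) * F (b i) (b j) := by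
        rw [Finset.sum_comm]
        exact Finset.sum_congr rfl fun j _ => Finset.sum_congr rfl fun i _ => by rw [hs]
    _ = ∑ j, F (raisedBasis G x b j) (b j) := by
        refine Finset.sum_congr rfl fun j _ => ?_
        conv_rhs => rw [hr j]
        exact ((h1 _).map_sum_smul _ _ _).symm

/-- The Kretschmann scalar as the trace of the square of the curvature operator. -/
theorem kretschmann_eq_trace (hG : ContDiffAt ℝ 2 G x) (hinv : (G x).IsInvertible)
    (hsymm : ∀ y u v, G y u v = G y v u)
    (hschwarz : ∀ a b u v, metricHessian G x a b u v = metricHessian G x b a u v)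
    (b : Module.Basis ι ℝ V) :
    kretschmann G x b = ∑ i, ∑ j, ∑ k, ∑ n,
      riemannLow G x (b i) (b j) (raisedBasis G x b k) (raisedBasis G x b n) *
        riemannLow G x (b k) (b n) (raisedBasis G x b i) (raisedBasis G x b j) := by
  have l3 := isLinearMap_riemannLow_third hG hinv hsymm hschwarz
  have l4 := isLinearMap_riemannLow_fourth (G := G) (x := x)
  unfold kretschmann
  refine Finset.sum_congr rfl fun i _ => Finset.sum_congr rfl fun j _ => ?_
  simp only [riemannLow_pair_symm hG hinv hsymm hschwarz (b _) (b _) (raisedBasis G x b i)]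
  set T := riemannLow G x with hT
  calc _ = ∑ k, ∑ n, T (b i) (b j) (b k) (raisedBasis G x b n)
          * T (raisedBasis G x b i) (raisedBasis G x b j) (raisedBasis G x b k) (b n) := by
        refine Finset.sum_congr rfl fun k _ => ?_
        exact contraction_comm hinv hsymm b (F := fun y z => T (b i) (b j) (b k) y
          * T (raisedBasis G x b i) (raisedBasis G x b j) (raisedBasis G x b k) z)
          (fun y => (l4 _ _ _).fun_mul_const _) (fun y => (l4 _ _ _).fun_const_mul _)
    _ = _ := by
        exact contraction_comm hinv hsymm b (F := fun y z => ∑ n,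
          T (b i) (b j) y (raisedBasis G x b n)
            * T (raisedBasis G x b i) (raisedBasis G x b j) z (b n))
          (fun y => IsLinearMap.fun_sum fun n => (l3 _ _ _).fun_mul_const _)
          (fun y => IsLinearMap.fun_sum fun n => (l3 _ _ _).fun_const_mul _)

end MixedContraction

/-! ### The curvature operator on two-forms in an adapted frame -/

section AdaptedFrame

variable {V : Type*} [NormedAddCommGroup V] [NormedSpace ℝ V] [FiniteDimensional ℝ V]
  {G : V → V →L[ℝ] V →L[ℝ] ℝ} {x : V} {f : Module.Basis (Fin 5) ℝ V} {P Q R N C : ℝ}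

/-- In the frame the metric splits into the κ, η block of determinant -N and the diagonal entries 1
/ (4N), C, C. The proposed vector, obtained by inverting blockwise, is checked by pairing it with
the frame. -/
theorem inverse_apply_of_frame (hinv : (G x).IsInvertible)
    (hf : ∀ i j, G x (f i) (f j) = frameForm P Q R (1 / (4 * N)) C i j)
    (hN : N ≠ 0) (hC : C ≠ 0) (hdet : P * R - Q ^ 2 = -N) (β : V →L[ℝ] ℝ) :
    (G x).inverse β = (-(R * β (f 0) - Q * β (f 2)) / N) • f 0 + (4 * N * β (f 1)) • f 1
      + (-(P * β (f 2) - Q * β (f 0)) / N) • f 2 + (β (f 3) / C) • f 3 + (β (f 4) / C) • f 4 := by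
  set v := (-(R * β (f 0) - Q * β (f 2)) / N) • f 0 + (4 * N * β (f 1)) • f 1
      + (-(P * β (f 2) - Q * β (f 0)) / N) • f 2 + (β (f 3) / C) • f 3 + (β (f 4) / C) • f 4
    with hv
  have h : G x v = β := by
    refine ContinuousLinearMap.coe_injective (f.ext fun j => ?_)
    rw [hv]
    fin_cases j
    all_goals
      simp [hf, frameForm]
      try field_simp
    · linear_combination -β (f 0) * hdet
    · linear_combination -β (f 2) * hdet
  rw [← h, inverse_apply_of_isInvertible hinv]

theorem pairing_of_frame (hinv : (G x).IsInvertible)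
    (hf : ∀ i j, G x (f i) (f j) = frameForm P Q R (1 / (4 * N)) C i j)
    (hN : N ≠ 0) (hC : C ≠ 0) (hdet : P * R - Q ^ 2 = -N) (α β : V →L[ℝ] ℝ) :
    α ((G x).inverse β) = framePair P Q R N C (fun i => α (f i)) (fun i => β (f i)) := by
  rw [inverse_apply_of_frame hinv hf hN hC hdet]
  simp only [map_add, map_smul, smul_eq_mul, framePair]
  ring

/-- The contraction of a two-form with the inverse metric in both arguments. -/
def raisePair (P Q R N C : ℝ) (w : Fin 10 → ℝ) : Fin 10 → ℝ :=
  ![-(4 * (R * w 0 + Q * w 4)), -(w 1 / N), -((R * w 2 - Q * w 7) / (N * C)),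
    -((R * w 3 - Q * w 8) / (N * C)), -(4 * (Q * w 0 + P * w 4)), 4 * N / C * w 5,
    4 * N / C * w 6, -((P * w 7 - Q * w 2) / (N * C)), -((P * w 8 - Q * w 3) / (N * C)),
    w 9 / C ^ 2]

theorem apply_raisedBasis_of_frame (hinv : (G x).IsInvertible)
    (hf : ∀ i j, G x (f i) (f j) = frameForm P Q R (1 / (4 * N)) C i j)
    (hN : N ≠ 0) (hC : C ≠ 0) (hdet : P * R - Q ^ 2 = -N) (w : V →ₗ[ℝ] V →ₗ[ℝ] ℝ)
    (hw : ∀ u v, w u v = -w v u) (J : Fin 10) :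
    w (raisedBasis G x f (pairFst J)) (raisedBasis G x f (pairSnd J)) =
      raisePair P Q R N C (fun K => w (f (pairFst K)) (f (pairSnd K))) J := by
  have hr := fun i => inverse_apply_of_frame hinv hf hN hC hdet
    (LinearMap.toContinuousLinearMap (f.coord i))
  have h0 : ∀ u, w u u = 0 := fun u => by linarith [hw u u]
  have h10 := hw (f 1) (f 0)
  have h20 := hw (f 2) (f 0)
  have h21 := hw (f 2) (f 1)
  simp only [raisedBasis, hr]
  fin_cases J
  all_goals
    simp [pairFst, pairSnd, raisePair, h0, -map_neg, h10, h20, h21]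
    try field_simp
    try ring1
  -- The remaining pair is (0, 2), where the 2 × 2 minor is the inverse determinant of the κ, η
  -- block.
  linear_combination w (f 0) (f 2) * hdet

theorem sum_pairs {φ : Fin 5 → Fin 5 → ℝ} (h0 : ∀ i, φ i i = 0) (hs : ∀ i j, φ i j = φ j i) :
    ∑ i, ∑ j, φ i j = 2 * ∑ I, φ (pairFst I) (pairSnd I) := by
  simp [Fin.sum_univ_succ, pairFst, pairSnd, h0, hs 1 0, hs 2 0, hs 2 1, hs 3 0, hs 3 1, hs 3 2,
    hs 4 0, hs 4 1, hs 4 2, hs 4 3]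
  ring

/-- By antisymmetry each of the two index pairs can be restricted to increasing indices at the cost
of a factor 2, which gives the 4. -/
theorem kretschmann_eq_sum_pairs (hG : ContDiffAt ℝ 2 G x) (hinv : (G x).IsInvertible)
    (hsymm : ∀ y u v, G y u v = G y v u)
    (hschwarz : ∀ a b u v, metricHessian G x a b u v = metricHessian G x b a u v)
    (hf : ∀ i j, G x (f i) (f j) = frameForm P Q R (1 / (4 * N)) C i j)
    (hN : N ≠ 0) (hC : C ≠ 0) (hdet : P * R - Q ^ 2 = -N) {T : Fin 10 → Fin 10 → ℝ}
    (hT : ∀ I J, riemannLow G x (f (pairFst I)) (f (pairSnd I)) (f (pairFst J)) (f (pairSnd J)) =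
      T I J) :
    kretschmann G x f =
      4 * ∑ I, ∑ J, raisePair P Q R N C (T I) J * raisePair P Q R N C (T J) I := by
  have ha := riemannLow_antisymm (G := G) (x := x)
  have ha' := riemannLow_antisymm' hG hinv hsymm hschwarz
  have ha0 : ∀ u w z, riemannLow G x u u w z = 0 := fun u w z => by linarith [ha u u w z]
  have ha0' : ∀ u v w, riemannLow G x u v w w = 0 := fun u v w => by linarith [ha' u v w w]
  have hraise : ∀ I J, riemannLow G x (f (pairFst I)) (f (pairSnd I))
      (raisedBasis G x f (pairFst J)) (raisedBasis G x f (pairSnd J)) =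
      raisePair P Q R N C (T I) J := fun I J => by
    have l3 := isLinearMap_riemannLow_third hG hinv hsymm hschwarz (f (pairFst I)) (f (pairSnd I))
    have l4 := isLinearMap_riemannLow_fourth (G := G) (x := x) (f (pairFst I)) (f (pairSnd I))
    rw [show T I = fun K => T I K from rfl]
    simp only [← hT]
    exact apply_raisedBasis_of_frame hinv hf hN hC hdet
      (LinearMap.mk₂ ℝ (fun w z => riemannLow G x (f (pairFst I)) (f (pairSnd I)) w z)
        (fun y y' z => (l3 z).map_add y y') (fun c y z => (l3 z).map_smul c y)
        (fun y z z' => (l4 y).map_add z z') (fun c y z => (l4 y).map_smul c z))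
      (fun u v => ha' _ _ u v) J
  rw [kretschmann_eq_trace hG hinv hsymm hschwarz, sum_pairs, Finset.mul_sum, Finset.mul_sum]
  · refine Finset.sum_congr rfl fun I _ => ?_
    rw [sum_pairs]
    · simp only [hraise]
      ring
    · intro k
      rw [ha0', zero_mul]
    · intro k n
      rw [ha' _ _ (raisedBasis G x f k), ha (f k)]
      ring
  · intro i
    simp [ha0]
  · intro i j
    refine Finset.sum_congr rfl fun k _ => Finset.sum_congr rfl fun n _ => ?_
    rw [ha (f i), ha' _ _ (raisedBasis G x f i)]
    ring

/-- The trace-free part of the curvature operator, up to a factor. -/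
def frameMixed (a X Q R N C : ℝ) : Fin 10 → Fin 10 → ℝ :=
  ![![2 * X - 8 * R, 0, 0, 0, -(8 * Q), 0, 0, 0, 0, -(4 * a / C)],
    ![0, 2 * X, 0, 0, 0, 0, 0, 0, 0, 0],
    ![0, 0, 4 * R - 2 * X, 0, 0, 0, -(8 * a * N), -(4 * Q), 0, 0],
    ![0, 0, 0, 4 * R - 2 * X, 0, 8 * a * N, 0, 0, -(4 * Q), 0],
    ![0, 0, 0, 0, 2 * X, 0, 0, 0, 0, 0],
    ![0, 0, 0, -(2 * a * R / N), 0, 2 * (R - a ^ 2), 0, 0, 2 * a * Q / N, 0],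
    ![0, 0, 2 * a * R / N, 0, 0, 0, 2 * (R - a ^ 2), -(2 * a * Q / N), 0, 0],
    ![0, 0, 0, 0, 0, 0, 0, -(2 * X), 0, 0],
    ![0, 0, 0, 0, 0, 0, 0, 0, -(2 * X), 0],
    ![16 * a * C * R, 0, 0, 0, 16 * a * C * Q, 0, 0, 0, 0, 2 * (3 * a ^ 2 - R)]]

set_option maxHeartbeats 4000000 in
theorem raisePair_frameWeyl {a X : ℝ} (hN : N ≠ 0) (hC : C ≠ 0) (hdet : P * R - Q ^ 2 = -N)
    (I J : Fin 10) :
    raisePair P Q R N C (frameWeyl a X P Q R N (1 / (4 * N)) C I) J = frameMixed a X Q R N C I J := by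
  fin_cases I <;> fin_cases J
  all_goals
    simp only [raisePair, frameWeyl, frameMixed, Fin.isValue, Fin.zero_eta, Fin.mk_one, Fin.reduceFinMk, Matrix.cons_val,
      Matrix.cons_val_zero, Matrix.cons_val_one, mul_zero, add_zero, sub_zero,
      zero_sub, sub_self, neg_zero, zero_div, mul_neg, neg_neg]
  all_goals
    field_simp
    first
    | done
    | ring1
    | exact Or.inl (by ring1)
    | linear_combination X * hdet
    | linear_combination -X * hdet
    | linear_combination 2 * X * hdet
    | linear_combination -2 * X * hdet

-- The constant curvature tensor acts on two-forms as minus the identity, so the part with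
-- coefficient -l² contributes l² on the diagonal.
set_option maxHeartbeats 4000000 in
theorem raisePair_frameForm (hN : N ≠ 0) (hC : C ≠ 0) (hdet : P * R - Q ^ 2 = -N)
    (I J : Fin 10) :
    raisePair P Q R N C (fun K =>
      frameForm P Q R (1 / (4 * N)) C (pairFst I) (pairSnd K)
        * frameForm P Q R (1 / (4 * N)) C (pairSnd I) (pairFst K)
      - frameForm P Q R (1 / (4 * N)) C (pairFst I) (pairFst K)
        * frameForm P Q R (1 / (4 * N)) C (pairSnd I) (pairSnd K)) J = if I = J then -1 else 0 := by
  fin_cases I <;> fin_cases J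
  all_goals
    simp only [raisePair, frameForm, pairFst, pairSnd, Fin.reduceEq, if_true, if_false, Fin.isValue, Fin.zero_eta, Fin.mk_one, Fin.reduceFinMk, Matrix.cons_val,
      Matrix.cons_val_zero, Matrix.cons_val_one, mul_zero, zero_mul, add_zero, sub_zero,
      zero_sub, sub_self, neg_zero, zero_div, mul_neg]
  all_goals
    field_simp
    first
    | done
    | ring1
    | exact Or.inl (by ring1)
    | linear_combination hdet

/-- The trace of the square of l² + μ W on a space of dimension 10: the identity gives 10 l⁴, the
mixed term vanishes since X = R + a² makes W trace-free, and the rest is tr W². -/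
theorem sum_frameMixed {a l μ X : ℝ} (hN : N ≠ 0) (hC : C ≠ 0) (hX : X = R + a ^ 2) :
    ∑ I, ∑ J, ((if I = J then l ^ 2 else 0) + μ * frameMixed a X Q R N C I J)
      * ((if J = I then l ^ 2 else 0) + μ * frameMixed a X Q R N C J I) =
    24 * μ ^ 2 * (3 * a ^ 2 - R) * (a ^ 2 - 3 * R) + 10 * l ^ 4 := by
  simp [Fin.sum_univ_succ, frameMixed]
  field_simp
  rw [hX]
  ring

end AdaptedFrame

end KerrAdS

end

noncomputable section

namespace KerrAdS

/-! ### A frame of the five-dimensional spacetime -/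

section Frame

/-- The vector of `ℂ²` orthogonal to `z`. -/
def perp (z : Fin 2 → ℂ) : Fin 2 → ℂ := ![-starRingEnd ℂ (z 1), starRingEnd ℂ (z 0)]

theorem realInner_perp (z : Fin 2 → ℂ) : realInner z (perp z) = 0 := by
  simp [realInner_apply, perp]
  ring

theorem symp_perp (z : Fin 2 → ℂ) : symp z (perp z) = 0 := by
  simp [symp_apply, perp]
  ring

theorem realInner_perp_perp (z : Fin 2 → ℂ) : realInner (perp z) (perp z) = realInner z z := by
  simp [realInner_apply, perp]
  ring

/-- For |z| = 1 the vectors z, i z, z^⊥, i z^⊥ form a real orthonormal basis of ℂ², and the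
component along z is zero. -/
theorem eq_perp_decomposition {z w : Fin 2 → ℂ} (hz : realInner z z = 1) (hw : realInner z w = 0) :
    w = symp z w • (Complex.I • z) + realInner (perp z) w • perp z
      + symp (perp z) w • (Complex.I • perp z) := by
  simp only [realInner_apply, Fin.sum_univ_two] at hz hw
  funext i
  fin_cases i
  all_goals
    simp only [realInner_apply, symp_apply, perp, Fin.sum_univ_two]
    apply Complex.ext
  all_goals simp [Matrix.vecHead, Matrix.vecTail]
  · linear_combination (z 0).re * hw - (w 0).re * hz
  · linear_combination (z 0).im * hw - (w 0).im * hz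
  · linear_combination (z 1).re * hw - (w 1).re * hz
  · linear_combination (z 1).im * hw - (w 1).im * hz

variable {a l : ℝ} {p : Amb 2}

variable (a l p) in
/-- The vectors of the frame. -/
def frameVec : Fin 5 → Amb 2 :=
  ![(1 - a ^ 2 * l ^ 2, 0, -(a * l ^ 2 * (1 - a ^ 2 * l ^ 2)) • (Complex.I • p.2.2)),
    (0, 1, 0), (a, 0, (1 - a ^ 2 * l ^ 2) • (Complex.I • p.2.2)),
    (0, 0, perp p.2.2), (0, 0, Complex.I • perp p.2.2)]

theorem frameVec_fst (i : Fin 5) : (frameVec a l p i).1 = frameTau a l i := by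
  fin_cases i <;> rfl

theorem frameVec_snd_fst (i : Fin 5) : (frameVec a l p i).2.1 = frameRho i := by
  fin_cases i <;> rfl

theorem symp_frameVec (hp : realInner p.2.2 p.2.2 = 1) (i : Fin 5) :
    symp p.2.2 (frameVec a l p i).2.2 = frameTheta a l i := by
  fin_cases i <;> simp [frameVec, frameTheta, symp_smul_I, hp, symp_perp, realInner_perp]

theorem frameVec_mem (i : Fin 5) : frameVec a l p i ∈ tangent p := by
  rw [mem_tangent_iff]
  fin_cases i <;> simp [frameVec, realInner_smul_I, symp_self, symp_perp, realInner_perp]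

theorem symp_frameVec_frameVec (hp : realInner p.2.2 p.2.2 = 1) (i j : Fin 5) :
    symp (frameVec a l p i).2.2 (frameVec a l p j).2.2 = frameSymp i j := by
  have h1 := symp_antisymm (perp p.2.2) p.2.2
  have h2 := realInner_comm (perp p.2.2) p.2.2
  rw [symp_perp] at h1
  rw [realInner_perp] at h2
  fin_cases i <;> fin_cases j <;>
    simp [frameVec, frameSymp, symp_smul_I, symp_I_smul, realInner_smul_I, realInner_I_smul, hp,
      symp_perp, realInner_perp, realInner_perp_perp, symp_self, h1, h2]

theorem realInner_frameVec (hp : realInner p.2.2 p.2.2 = 1) (i j : Fin 5) :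
    realInner (frameVec a l p i).2.2 (frameVec a l p j).2.2 = frameInner a l i j := by
  have h1 := symp_antisymm (perp p.2.2) p.2.2
  have h2 := realInner_comm (perp p.2.2) p.2.2
  rw [symp_perp] at h1
  rw [realInner_perp] at h2
  fin_cases i <;> fin_cases j <;>
    simp [frameVec, frameInner, frameTheta, frameForm, symp_smul_I, symp_I_smul, realInner_smul_I,
      realInner_I_smul, hp, symp_perp, realInner_perp, realInner_perp_perp, symp_self, h1, h2]
  ring

/-- The vectors are dual to κ, dρ, η and the two horizontal coordinates. Hence these forms supply
the coefficients of an arbitrary tangent vector in the spanning argument. -/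
theorem exists_frame (hΞ : 1 - a ^ 2 * l ^ 2 ≠ 0) (hp : realInner p.2.2 p.2.2 = 1) :
    ∃ f : Module.Basis (Fin 5) ℝ (tangent p), ∀ i, (f i : Amb 2) = frameVec a l p i := by
  have h1 := symp_antisymm (perp p.2.2) p.2.2
  have h2 := realInner_comm (perp p.2.2) p.2.2
  rw [symp_perp] at h1
  rw [realInner_perp] at h2
  let e : Fin 5 → tangent p := fun i => ⟨frameVec a l p i, frameVec_mem i⟩
  have hli : LinearIndependent ℝ e := by
    rw [Fintype.linearIndependent_iff]
    intro g hg
    have hv : ∑ i, g i • frameVec a l p i = 0 := by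
      have := congrArg (Subtype.val) hg
      simpa [e] using this
    have e1 := congrArg (fun v : Amb 2 => v.1) hv
    have e2 := congrArg (fun v : Amb 2 => v.2.1) hv
    have e3 := congrArg (fun v : Amb 2 => symp p.2.2 v.2.2) hv
    have e4 := congrArg (fun v : Amb 2 => realInner (perp p.2.2) v.2.2) hv
    have e5 := congrArg (fun v : Amb 2 => symp (perp p.2.2) v.2.2) hv
    simp only [Fin.sum_univ_five] at e1 e2 e3 e4 e5
    simp [frameVec, symp_smul_I, realInner_smul_I, hp, symp_perp, realInner_perp,
      realInner_perp_perp, symp_self, h1, h2] at e1 e2 e3 e4 e5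
    have h02 : g 2 = a * l ^ 2 * g 0 := by
      apply mul_right_cancel₀ hΞ
      linear_combination e3
    have h0 : g 0 = 0 := by
      rw [h02] at e1
      linear_combination e1
    intro i
    fin_cases i
    · exact h0
    · exact e2
    · simpa [h0] using h02
    · exact e4
    · exact e5
  have hspan : ⊤ ≤ Submodule.span ℝ (Set.range e) := by
    intro u _
    have hu : u = (kappa a l p u) • e 0 + (u : Amb 2).2.1 • e 1 + (etaTilde a l p u) • e 2
        + realInner (perp p.2.2) (u : Amb 2).2.2 • e 3
        + symp (perp p.2.2) (u : Amb 2).2.2 • e 4 := by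
      refine Subtype.ext (Prod.ext ?_ (Prod.ext ?_ ?_))
      · simp [e, frameVec, kappa, etaTilde]
        field_simp
        ring
      · simp [e, frameVec]
      · have hc : symp p.2.2 (u : Amb 2).2.2 =
            -(kappa a l p u * (a * l ^ 2 * (1 - a ^ 2 * l ^ 2)))
              + etaTilde a l p u * (1 - a ^ 2 * l ^ 2) := by
          simp only [kappa, etaTilde]
          field_simp
          ring
        refine (eq_perp_decomposition hp (realInner_tangent u)).trans ?_
        rw [hc]
        simp [e, frameVec, smul_smul, add_smul]
    have hmem : ∀ i, e i ∈ Submodule.span ℝ (Set.range e) := fun i =>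
      Submodule.subset_span ⟨i, rfl⟩
    rw [hu]
    exact add_mem (add_mem (add_mem (add_mem (Submodule.smul_mem _ _ (hmem 0))
      (Submodule.smul_mem _ _ (hmem 1))) (Submodule.smul_mem _ _ (hmem 2)))
      (Submodule.smul_mem _ _ (hmem 3))) (Submodule.smul_mem _ _ (hmem 4))
  exact ⟨Module.Basis.mk hli hspan, fun i => by rw [Module.Basis.mk_apply]⟩

end Frame

/-! ### The jet of the metric in the frame -/

section FrameJets

variable {a l : ℝ} {p : Amb 2} {f : Fin 5 → tangent p}

theorem modelValue_frame (hp : realInner p.2.2 p.2.2 = 1)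
    (hf : ∀ i, (f i : Amb 2) = frameVec a l p i) (A B C D E : ℝ) (i j : Fin 5) :
    modelValue A B C D E (f i) (f j) =
      frameForm
        ((1 - a ^ 2 * l ^ 2) ^ 2 * (A + (a * l ^ 2) ^ 2 * (C + E) - 2 * (a * l ^ 2) * D))
        ((1 - a ^ 2 * l ^ 2) * (a * A - a * l ^ 2 * (1 - a ^ 2 * l ^ 2) * (C + E)
          + (1 - 2 * (a ^ 2 * l ^ 2)) * D))
        (a ^ 2 * A + (1 - a ^ 2 * l ^ 2) ^ 2 * (C + E) + 2 * a * (1 - a ^ 2 * l ^ 2) * D) B C i j := by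
  simp only [modelValue, tauTheta, thetaTheta, hf, frameVec_fst, frameVec_snd_fst,
    symp_frameVec hp, realInner_frameVec hp]
  fin_cases i <;> fin_cases j <;> simp [frameTau, frameRho, frameTheta, frameInner, frameForm] <;>
    ring

theorem modelDeriv_frame (hp : realInner p.2.2 p.2.2 = 1)
    (hf : ∀ i, (f i : Amb 2) = frameVec a l p i) (A₁ B₁ C₁ D D₁ E E₁ : ℝ) (b i j : Fin 5) :
    modelDeriv A₁ B₁ C₁ D D₁ E E₁ (f b) (f i) (f j) =
      frameRho b * modelValue A₁ B₁ C₁ D₁ E₁ (f i) (f j)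
        + frameSymp b j * (D * frameTau a l i + E * frameTheta a l i)
        + frameSymp b i * (D * frameTau a l j + E * frameTheta a l j) := by
  simp only [modelDeriv, tauSymp, thetaSymp, hf, frameVec_fst, frameVec_snd_fst,
    symp_frameVec hp, symp_frameVec_frameVec hp]
  ring

theorem modelHessian_frame (hp : realInner p.2.2 p.2.2 = 1)
    (hf : ∀ i, (f i : Amb 2) = frameVec a l p i) (A₂ B₂ C C₂ D D₁ D₂ E E₁ E₂ : ℝ)
    (b c i j : Fin 5) :
    modelHessian A₂ B₂ C C₂ D D₁ D₂ E E₁ E₂ (f b) (f c) (f i) (f j) =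
      frameHessian a l C E (fun i j => modelValue A₂ B₂ C₂ D₂ E₂ (f i) (f j))
        (fun i => D * frameTau a l i + E * frameTheta a l i)
        (fun i => D₁ * frameTau a l i + E₁ * frameTheta a l i) b c i j := by
  simp only [modelHessian, frameHessian, tauSymp, thetaSymp, tauTheta, thetaTheta, hf,
    frameVec_fst, frameVec_snd_fst, symp_frameVec hp, symp_frameVec_frameVec hp,
    realInner_frameVec hp]
  ring

theorem frameSymp_antisymm (i j : Fin 5) : frameSymp i j = -frameSymp j i := by
  fin_cases i <;> fin_cases j <;> simp [frameSymp]

end FrameJets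

/-! ### Derivatives of the metric coefficients in dimension five -/

section Coefficients

variable {a : ℝ}

/-- For m = 2 every coefficient apart from the radial one is an affine function of ρ plus a multiple
of 1 / (ρ + a²), so this and the next formula treat them all. -/
theorem deriv_affine_add_inv (α β γ : ℝ) {ρ : ℝ} (hρ : ρ + a ^ 2 ≠ 0) :
    deriv (fun t : ℝ => α + β * t + γ * (t + a ^ 2)⁻¹) ρ = β - γ / (ρ + a ^ 2) ^ 2 := by
  have h := (((hasDerivAt_id ρ).const_mul β).const_add α).add
    ((((hasDerivAt_id ρ).add_const (a ^ 2)).fun_inv hρ).const_mul γ)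
  refine h.deriv.trans ?_
  simp
  ring

theorem deriv_deriv_affine_add_inv (α β γ : ℝ) {ρ : ℝ} (hρ : ρ + a ^ 2 ≠ 0) :
    deriv (deriv (fun t : ℝ => α + β * t + γ * (t + a ^ 2)⁻¹)) ρ = 2 * γ / (ρ + a ^ 2) ^ 3 := by
  have hev : deriv (fun t : ℝ => α + β * t + γ * (t + a ^ 2)⁻¹) =ᶠ[nhds ρ]
      fun t => β - γ * ((t + a ^ 2) ^ 2)⁻¹ := by
    have hopen : IsOpen {t : ℝ | t + a ^ 2 ≠ 0} :=
      isOpen_ne_fun (by fun_prop) continuous_const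
    filter_upwards [hopen.mem_nhds hρ] with t ht
    rw [deriv_affine_add_inv α β γ ht, div_eq_mul_inv]
  rw [hev.deriv_eq]
  have h := (((((hasDerivAt_id ρ).add_const (a ^ 2)).fun_pow 2).fun_inv
    (pow_ne_zero 2 hρ)).const_mul γ).const_sub β
  refine h.deriv.trans ?_
  simp
  field_simp

/-- The radial coefficient is 1 / (4N), and N₁ is the derivative of N. Its second derivative is left
unevaluated since it drops out of the curvature. -/
theorem deriv_radialCoeff_two {l m₀ ρ N N₁ : ℝ} (hρ : ρ + a ^ 2 ≠ 0)
    (hΦ : horizonPoly 2 a l m₀ ρ ≠ 0)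
    (hN : N = horizonPoly 2 a l m₀ ρ / (ρ + a ^ 2))
    (hN₁ : N₁ = l ^ 2 * (ρ + a ^ 2) + (1 + l ^ 2 * ρ) - 2 * m₀ * a ^ 2 / (ρ + a ^ 2) ^ 2) :
    deriv (radialCoeff 2 a l m₀) ρ = -(N₁ / (4 * N ^ 2)) := by
  have hΦ' : HasDerivAt (horizonPoly 2 a l m₀)
      (l ^ 2 * (ρ + a ^ 2) ^ 2 + (1 + l ^ 2 * ρ) * (2 * (ρ + a ^ 2)) - 2 * m₀) ρ := by
    have h := ((((hasDerivAt_id ρ).const_mul (l ^ 2)).const_add 1).fun_mul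
      (((hasDerivAt_id ρ).add_const (a ^ 2)).fun_pow 2)).fun_sub
      ((hasDerivAt_id ρ).const_mul (2 * m₀))
    refine h.congr_deriv ?_
    simp
  have hu : HasDerivAt (fun t : ℝ => (t + a ^ 2) ^ (2 - 1)) 1 ρ := by
    simpa using (hasDerivAt_id ρ).add_const (a ^ 2)
  have h := hu.fun_div (hΦ'.const_mul 4) (mul_ne_zero (by norm_num) hΦ)
  refine h.deriv.trans ?_
  have e : N₁ = ((l ^ 2 * (ρ + a ^ 2) ^ 2 + (1 + l ^ 2 * ρ) * (2 * (ρ + a ^ 2)) - 2 * m₀)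
      * (ρ + a ^ 2) - horizonPoly 2 a l m₀ ρ) / (ρ + a ^ 2) ^ 2 := by
    rw [hN₁, horizonPoly]
    field_simp
    ring
  rw [hN, e]
  generalize horizonPoly 2 a l m₀ ρ = Φ at hΦ
  field_simp
  ring

end Coefficients

end KerrAdS

end

noncomputable section

namespace KerrAdS

/-! ### The Kretschmann scalar in dimension five -/

section Kretschmann

variable {a l m₀ : ℝ}

theorem coeffA_two : coeffA 2 a l m₀ = fun t =>
    (-1 + (a * l ^ 2) ^ 2 * a ^ 2) / (1 - a ^ 2 * l ^ 2)
      + (-l ^ 2 + (a * l ^ 2) ^ 2) / (1 - a ^ 2 * l ^ 2) * t + 2 * m₀ * (t + a ^ 2)⁻¹ := by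
  funext t
  simp only [coeffA, Nat.add_one_sub_one, pow_one]
  ring

theorem coeffC_eq : coeffC a l = fun t =>
    a ^ 2 / (1 - a ^ 2 * l ^ 2) + 1 / (1 - a ^ 2 * l ^ 2) * t + 0 * (t + a ^ 2)⁻¹ := by
  funext t
  simp only [coeffC]
  ring

theorem coeffD_two : coeffD 2 a l m₀ = fun t =>
    a * l ^ 2 * a ^ 2 / (1 - a ^ 2 * l ^ 2) + a * l ^ 2 / (1 - a ^ 2 * l ^ 2) * t
      + -(a / (1 - a ^ 2 * l ^ 2) * (2 * m₀)) * (t + a ^ 2)⁻¹ := by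
  funext t
  simp only [coeffD, Nat.add_one_sub_one, pow_one]
  ring

theorem coeffE_two : coeffE 2 a l m₀ = fun t =>
    0 + 0 * t + (a / (1 - a ^ 2 * l ^ 2)) ^ 2 * (2 * m₀) * (t + a ^ 2)⁻¹ := by
  funext t
  simp only [coeffE, Nat.add_one_sub_one, pow_one]
  ring

theorem frameForm_congr {P P' Q Q' R R' B B' C C' : ℝ} (hP : P = P') (hQ : Q = Q') (hR : R = R')
    (hB : B = B') (hC : C = C') : frameForm P Q R B C = frameForm P' Q' R' B' C' := by
  subst hP hQ hR hB hC
  rfl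

/-- The curvature of the five-dimensional Boyer-Lindquist metric in the frame. -/
theorem exists_frame_riemannLow (hal : a ^ 2 * l ^ 2 < 1) (hm₀ : 0 < m₀) {p : Amb 2}
    (hp : p ∈ spacetime 2 a) (hΦ : horizonPoly 2 a l m₀ p.2.1 ≠ 0) {X N P Q C : ℝ}
    (hX : X = p.2.1 + a ^ 2) (hN : N = horizonPoly 2 a l m₀ p.2.1 / X)
    (hP : P = -(1 + l ^ 2 * (X - a ^ 2)) * (1 - a ^ 2 * l ^ 2) + 2 * m₀ / X)
    (hQ : Q = -(a * (1 + l ^ 2 * (X - a ^ 2)))) (hC : C = X / (1 - a ^ 2 * l ^ 2)) :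
    ∃ f : Module.Basis (Fin 5) ℝ (tangent p),
      (∀ i j, localMetric (kerrAdS 2 a l m₀) p 0 (f i) (f j) =
        frameForm P Q (X - a ^ 2) (1 / (4 * N)) C i j) ∧
      ∀ I J, riemannLow (localMetric (kerrAdS 2 a l m₀) p) 0 (f (pairFst I)) (f (pairSnd I))
          (f (pairFst J)) (f (pairSnd J)) =
        -l ^ 2 * (frameForm P Q (X - a ^ 2) (1 / (4 * N)) C (pairFst I) (pairSnd J)
            * frameForm P Q (X - a ^ 2) (1 / (4 * N)) C (pairSnd I) (pairFst J)
          - frameForm P Q (X - a ^ 2) (1 / (4 * N)) C (pairFst I) (pairFst J)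
            * frameForm P Q (X - a ^ 2) (1 / (4 * N)) C (pairSnd I) (pairSnd J))
          + m₀ / X ^ 3 * frameWeyl a X P Q (X - a ^ 2) N (1 / (4 * N)) C I J := by
  obtain ⟨hp1, hp2⟩ := mem_spacetime_iff.mp hp
  have hΞ : 1 - a ^ 2 * l ^ 2 ≠ 0 := by
    have : 0 < 1 - a ^ 2 * l ^ 2 := by linarith
    exact this.ne'
  have hX0 : X ≠ 0 := by
    have : 0 < X := by linarith
    exact this.ne'
  have hρX : p.2.1 + a ^ 2 ≠ 0 := hX ▸ hX0
  have hρ : p.2.1 = X - a ^ 2 := by linarith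
  have hN0 : N ≠ 0 := hN ▸ div_ne_zero hΦ hX0
  have hNX : N = (1 + l ^ 2 * (X - a ^ 2)) * X - 2 * m₀ * (X - a ^ 2) / X := by
    rw [hN, horizonPoly, hρ]
    field_simp
    ring
  have hC0 : C ≠ 0 := hC ▸ div_ne_zero hX0 hΞ
  have hdet : P * (X - a ^ 2) - Q ^ 2 = -N := by
    rw [hP, hQ, hNX]
    field_simp
    ring
  obtain ⟨f, hf⟩ := exists_frame hΞ hp2
  refine ⟨f, ?_⟩
  have hjet := hasJet_localMetric (l := l) (m₀ := m₀) hp hΦ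
  have hG := contDiffAt_of_hasJet hjet
  have hd := fderiv_metric_of_hasJet hjet (hG.differentiableAt (by norm_num))
  have hh := metricHessian_of_hasJet hjet hG
  have hinv := isInvertible_localMetric hp2
    (isLorentzianOn_kerrAdS one_le_two hal hm₀ hp hΦ)
  obtain ⟨N₁, hN₁⟩ : ∃ N₁, N₁ = l ^ 2 * X + (1 + l ^ 2 * (X - a ^ 2)) - 2 * m₀ * a ^ 2 / X ^ 2 :=
    ⟨_, rfl⟩
  have hB : radialCoeff 2 a l m₀ p.2.1 = 1 / (4 * N) := by
    rw [radialCoeff, hN, hX]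
    field_simp
    norm_num
  have hB₁ : deriv (radialCoeff 2 a l m₀) p.2.1 = -(N₁ / (4 * N ^ 2)) :=
    deriv_radialCoeff_two hρX hΦ (hN.trans (by rw [hX])) (by rw [hN₁, ← hρ, hX])
  have hA₁ := deriv_affine_add_inv ((-1 + (a * l ^ 2) ^ 2 * a ^ 2) / (1 - a ^ 2 * l ^ 2))
    ((-l ^ 2 + (a * l ^ 2) ^ 2) / (1 - a ^ 2 * l ^ 2)) (2 * m₀) hρX
  have hA₂ := deriv_deriv_affine_add_inv ((-1 + (a * l ^ 2) ^ 2 * a ^ 2) / (1 - a ^ 2 * l ^ 2))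
    ((-l ^ 2 + (a * l ^ 2) ^ 2) / (1 - a ^ 2 * l ^ 2)) (2 * m₀) hρX
  have hC₁ := deriv_affine_add_inv (a ^ 2 / (1 - a ^ 2 * l ^ 2)) (1 / (1 - a ^ 2 * l ^ 2)) 0 hρX
  have hC₂ := deriv_deriv_affine_add_inv (a ^ 2 / (1 - a ^ 2 * l ^ 2)) (1 / (1 - a ^ 2 * l ^ 2)) 0
    hρX
  have hD₁ := deriv_affine_add_inv (a * l ^ 2 * a ^ 2 / (1 - a ^ 2 * l ^ 2))
    (a * l ^ 2 / (1 - a ^ 2 * l ^ 2)) (-(a / (1 - a ^ 2 * l ^ 2) * (2 * m₀))) hρX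
  have hD₂ := deriv_deriv_affine_add_inv (a * l ^ 2 * a ^ 2 / (1 - a ^ 2 * l ^ 2))
    (a * l ^ 2 / (1 - a ^ 2 * l ^ 2)) (-(a / (1 - a ^ 2 * l ^ 2) * (2 * m₀))) hρX
  have hE₁ := deriv_affine_add_inv 0 0 ((a / (1 - a ^ 2 * l ^ 2)) ^ 2 * (2 * m₀)) hρX
  have hE₂ := deriv_deriv_affine_add_inv 0 0 ((a / (1 - a ^ 2 * l ^ 2)) ^ 2 * (2 * m₀)) hρX
  rw [← coeffA_two, ← hX] at hA₁ hA₂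
  rw [← coeffC_eq, ← hX] at hC₁ hC₂
  rw [← coeffD_two, ← hX] at hD₁ hD₂
  rw [← coeffE_two, ← hX] at hE₁ hE₂
  have hA₀ : coeffA 2 a l m₀ p.2.1 = -((1 + l ^ 2 * (X - a ^ 2)) / (1 - a ^ 2 * l ^ 2))
      + (a * l ^ 2) ^ 2 * (X / (1 - a ^ 2 * l ^ 2)) + 2 * m₀ / X := by
    rw [coeffA, ← hX, hρ, Nat.add_one_sub_one, pow_one]
  have hC₀ : coeffC a l p.2.1 = X / (1 - a ^ 2 * l ^ 2) := by
    rw [coeffC, ← hX]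
  have hD₀ : coeffD 2 a l m₀ p.2.1 = a * l ^ 2 * (X / (1 - a ^ 2 * l ^ 2))
      - a / (1 - a ^ 2 * l ^ 2) * (2 * m₀ / X) := by
    rw [coeffD, ← hX, Nat.add_one_sub_one, pow_one]
  have hE₀ : coeffE 2 a l m₀ p.2.1 = (a / (1 - a ^ 2 * l ^ 2)) ^ 2 * (2 * m₀ / X) := by
    rw [coeffE, ← hX, Nat.add_one_sub_one, pow_one]
  have hval : ∀ i j, localMetric (kerrAdS 2 a l m₀) p 0 (f i) (f j) =
      frameForm P Q (X - a ^ 2) (1 / (4 * N)) C i j := fun i j => by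
    rw [(hjet _ _).val, modelValue_frame hp2 hf]
    refine congrFun (congrFun (frameForm_congr ?_ ?_ ?_ hB (hC₀.trans hC.symm)) i) j
    · rw [hP, hA₀, hC₀, hD₀, hE₀]
      field_simp
      ring
    · rw [hQ, hA₀, hC₀, hD₀, hE₀]
      field_simp
      ring
    · rw [hA₀, hC₀, hD₀, hE₀]
      field_simp
      ring
  refine ⟨hval, fun I J => ?_⟩
  set lam : Fin 5 → ℝ := ![a * l ^ 2 * X - a / (1 - a ^ 2 * l ^ 2) * (2 * m₀ / X), 0,
    a * (a * l ^ 2) * X / (1 - a ^ 2 * l ^ 2), 0, 0] with hlam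
  set lam₁ : Fin 5 → ℝ := ![a * l ^ 2 + a / (1 - a ^ 2 * l ^ 2) * (2 * m₀ / X ^ 2), 0,
    a * (a * l ^ 2) / (1 - a ^ 2 * l ^ 2), 0, 0] with hlam₁
  -- The form D dτ + E θ multiplies the symplectic form in the first derivatives of the metric;
  -- these are its components in the frame.
  have elam : (fun i => coeffD 2 a l m₀ p.2.1 * frameTau a l i
      + coeffE 2 a l m₀ p.2.1 * frameTheta a l i) = lam := by
    funext i
    rw [hD₀, hE₀, hlam]
    fin_cases i <;> simp [frameTau, frameTheta] <;> field_simp <;> ring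
  have elam₁ : (fun i => deriv (coeffD 2 a l m₀) p.2.1 * frameTau a l i
      + deriv (coeffE 2 a l m₀) p.2.1 * frameTheta a l i) = lam₁ := by
    funext i
    rw [hD₁, hE₁, hlam₁]
    fin_cases i <;> simp [frameTau, frameTheta] <;> field_simp <;> ring
  have hvalue₁ : ∀ i j, modelValue (deriv (coeffA 2 a l m₀) p.2.1)
      (deriv (radialCoeff 2 a l m₀) p.2.1) (deriv (coeffC a l) p.2.1)
      (deriv (coeffD 2 a l m₀) p.2.1) (deriv (coeffE 2 a l m₀) p.2.1) (f i) (f j) =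
      frameForm (-l ^ 2 * (1 - a ^ 2 * l ^ 2) - 2 * m₀ / X ^ 2) (-(a * l ^ 2)) 1
        (-(N₁ / (4 * N ^ 2))) (1 / (1 - a ^ 2 * l ^ 2)) i j := fun i j => by
    rw [modelValue_frame hp2 hf]
    refine congrFun (congrFun (frameForm_congr ?_ ?_ ?_ hB₁ (deriv_coeffC _)) i) j
    all_goals
      rw [hA₁, hC₁, hD₁, hE₁]
      field_simp
      ring
  have hvalue₂ : (fun i j => modelValue (deriv (deriv (coeffA 2 a l m₀)) p.2.1)
      (deriv (deriv (radialCoeff 2 a l m₀)) p.2.1) (deriv (deriv (coeffC a l)) p.2.1)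
      (deriv (deriv (coeffD 2 a l m₀)) p.2.1) (deriv (deriv (coeffE 2 a l m₀)) p.2.1)
      (f i) (f j)) =
      frameForm (4 * m₀ / X ^ 3) 0 0 (deriv (deriv (radialCoeff 2 a l m₀)) p.2.1) 0 := by
    funext i j
    rw [modelValue_frame hp2 hf]
    refine congrFun (congrFun (frameForm_congr ?_ ?_ ?_ rfl ?_) i) j
    all_goals
      simp only [hA₂, hC₂, hD₂, hE₂]
      field_simp
      try ring1
  have hhess : ∀ b c i j, metricHessian (localMetric (kerrAdS 2 a l m₀) p) 0 (f b) (f c) (f i) (f j)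
      = frameHessian a l (X / (1 - a ^ 2 * l ^ 2)) ((a / (1 - a ^ 2 * l ^ 2)) ^ 2 * (2 * m₀ / X))
        (frameForm (4 * m₀ / X ^ 3) 0 0 (deriv (deriv (radialCoeff 2 a l m₀)) p.2.1) 0) lam lam₁
        b c i j := fun b c i j => by
    rw [hh, modelHessian_frame hp2 hf, hvalue₂, elam, elam₁, hC₀, hE₀]
  have hfst : ∀ i j k, christoffelFst (localMetric (kerrAdS 2 a l m₀) p) 0 (f i) (f j) (f k) =
      frameChristoffel (frameForm (-l ^ 2 * (1 - a ^ 2 * l ^ 2) - 2 * m₀ / X ^ 2) (-(a * l ^ 2)) 1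
        (-(N₁ / (4 * N ^ 2))) (1 / (1 - a ^ 2 * l ^ 2))) lam i j k := fun i j k => by
    rw [christoffelFst_apply, hd, hd, hd]
    simp only [modelDeriv_frame hp2 hf, hvalue₁, fun i => congrFun elam i, frameChristoffel]
    rw [frameSymp_antisymm k i, frameSymp_antisymm k j, frameSymp_antisymm j i]
    ring
  have hpair : ∀ i j k n, christoffelFst (localMetric (kerrAdS 2 a l m₀) p) 0 (f i) (f j)
      (christoffel (localMetric (kerrAdS 2 a l m₀) p) 0 (f k) (f n)) =
      framePair P Q (X - a ^ 2) N C
        (frameChristoffel (frameForm (-l ^ 2 * (1 - a ^ 2 * l ^ 2) - 2 * m₀ / X ^ 2) (-(a * l ^ 2))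
          1 (-(N₁ / (4 * N ^ 2))) (1 / (1 - a ^ 2 * l ^ 2))) lam i j)
        (frameChristoffel (frameForm (-l ^ 2 * (1 - a ^ 2 * l ^ 2) - 2 * m₀ / X ^ 2) (-(a * l ^ 2))
          1 (-(N₁ / (4 * N ^ 2))) (1 / (1 - a ^ 2 * l ^ 2))) lam k n) := fun i j k n => by
    rw [christoffel, pairing_of_frame hinv hval hN0 hC0 hdet]
    simp only [hfst]
  rw [riemannLow_kerrAdS one_le_two hal hm₀ hp hΦ]
  simp only [hhess, hpair]
  have key := frameRiemann_eq (a := a) (l := l) (m₀ := m₀)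
    (B₂ := deriv (deriv (radialCoeff 2 a l m₀)) p.2.1) hX0 hΞ hN0 hNX hN₁ hP rfl rfl hQ rfl I J
  rw [← hC] at key ⊢
  exact key

/-- The Kretschmann scalar of the five-dimensional Boyer-Lindquist metric. -/
theorem kretschmannAt_kerrAdS (hal : a ^ 2 * l ^ 2 < 1) (hm₀ : 0 < m₀) {p : Amb 2}
    (hp : p ∈ spacetime 2 a) (hΦ : horizonPoly 2 a l m₀ p.2.1 ≠ 0)
    (b : Module.Basis (Fin (2 * 2 + 1)) ℝ (tangent p)) :
    kretschmannAt (kerrAdS 2 a l m₀) p b =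
      96 * m₀ ^ 2 * (3 * a ^ 2 - p.2.1) * (a ^ 2 - 3 * p.2.1) / (p.2.1 + a ^ 2) ^ 6
        + 40 * l ^ 4 := by
  obtain ⟨hp1, hp2⟩ := mem_spacetime_iff.mp hp
  have hΞ : 1 - a ^ 2 * l ^ 2 ≠ 0 := by
    have : 0 < 1 - a ^ 2 * l ^ 2 := by linarith
    exact this.ne'
  obtain ⟨X, hX⟩ : ∃ X, X = p.2.1 + a ^ 2 := ⟨_, rfl⟩
  obtain ⟨N, hN⟩ : ∃ N, N = horizonPoly 2 a l m₀ p.2.1 / X := ⟨_, rfl⟩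
  obtain ⟨P, hP⟩ : ∃ P, P = -(1 + l ^ 2 * (X - a ^ 2)) * (1 - a ^ 2 * l ^ 2) + 2 * m₀ / X :=
    ⟨_, rfl⟩
  obtain ⟨Q, hQ⟩ : ∃ Q, Q = -(a * (1 + l ^ 2 * (X - a ^ 2))) := ⟨_, rfl⟩
  obtain ⟨C, hC⟩ : ∃ C, C = X / (1 - a ^ 2 * l ^ 2) := ⟨_, rfl⟩
  have hX0 : X ≠ 0 := by
    have : 0 < X := by linarith
    exact this.ne'
  have hρ : p.2.1 = X - a ^ 2 := by linarith
  have hN0 : N ≠ 0 := hN ▸ div_ne_zero hΦ hX0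
  have hC0 : C ≠ 0 := hC ▸ div_ne_zero hX0 hΞ
  have hdet : P * (X - a ^ 2) - Q ^ 2 = -N := by
    rw [hP, hQ, hN, horizonPoly, hρ]
    field_simp
    ring
  obtain ⟨f, hval, hR⟩ := exists_frame_riemannLow hal hm₀ hp hΦ hX hN hP hQ hC
  have hjet := hasJet_localMetric (l := l) (m₀ := m₀) hp hΦ
  have hG := contDiffAt_of_hasJet hjet
  have hinv := isInvertible_localMetric hp2
    (isLorentzianOn_kerrAdS one_le_two hal hm₀ hp hΦ)
  have hschwarz : ∀ b c u v, metricHessian (localMetric (kerrAdS 2 a l m₀) p) 0 b c u v =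
      metricHessian (localMetric (kerrAdS 2 a l m₀) p) 0 c b u v := fun b c u v => by
    rw [metricHessian_of_hasJet hjet hG, metricHessian_of_hasJet hjet hG]
    exact modelHessian_comm _ _ _ _ _ _ _ _ _ _ b c u v
  -- Raising is linear, so the constant curvature part and the trace-free part of the operator can
  -- be raised separately.
  have hmixed : ∀ I J, raisePair P Q (X - a ^ 2) N C (fun K =>
      -l ^ 2 * (frameForm P Q (X - a ^ 2) (1 / (4 * N)) C (pairFst I) (pairSnd K)
            * frameForm P Q (X - a ^ 2) (1 / (4 * N)) C (pairSnd I) (pairFst K)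
          - frameForm P Q (X - a ^ 2) (1 / (4 * N)) C (pairFst I) (pairFst K)
            * frameForm P Q (X - a ^ 2) (1 / (4 * N)) C (pairSnd I) (pairSnd K))
          + m₀ / X ^ 3 * frameWeyl a X P Q (X - a ^ 2) N (1 / (4 * N)) C I K) J =
      (if I = J then l ^ 2 else 0) + m₀ / X ^ 3 * frameMixed a X Q (X - a ^ 2) N C I J :=
      fun I J => by
    rw [← raisePair_frameWeyl hN0 hC0 hdet]
    have h := raisePair_frameForm hN0 hC0 hdet I J
    have hlin : ∀ (s t : ℝ) (w w' : Fin 10 → ℝ),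
        raisePair P Q (X - a ^ 2) N C (fun K => s * w K + t * w' K) J =
        s * raisePair P Q (X - a ^ 2) N C w J + t * raisePair P Q (X - a ^ 2) N C w' J := by
      intro s t w w'
      fin_cases J <;> simp [raisePair] <;> ring
    rw [hlin, h]
    split_ifs <;> ring
  rw [kretschmannAt, kretschmann_eq_of_basis hG hinv localMetric_kerrAdS_symm hschwarz b f,
    kretschmann_eq_sum_pairs hG hinv localMetric_kerrAdS_symm hschwarz hval hN0 hC0 hdet hR]
  simp only [hmixed]
  rw [sum_frameMixed hN0 hC0 (by ring), ← hX, hρ]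
  field_simp
  ring

end Kretschmann

end KerrAdS

end

noncomputable section

namespace KerrAdS

/-! ### The singularity of the extended spacetime -/

section Singularity

variable {m : ℕ} {a l m₀ : ℝ} {ψ σ : ℝ → ℝ} {p : Amb m}

/-- The condition ρ < 0 persists near the centre of the patch, so the two metrics have the same germ
there and therefore the same curvature. -/
theorem localMetric_metricForm_eventuallyEq
    (hnonpos : ∀ ρ ≤ 0, ψ ρ = radialCoeff m a l m₀ ρ ∧ σ ρ = 0) (hρ : p.2.1 < 0) :
    localMetric (metricForm m a l m₀ ψ σ) p =ᶠ[nhds 0] localMetric (kerrAdS m a l m₀) p := by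
  have hc : Continuous fun x : tangent p => p.2.1 + (x : Amb m).2.1 := by fun_prop
  have h0 : p.2.1 + ((0 : tangent p) : Amb m).2.1 < 0 := by simpa using hρ
  filter_upwards [(hc.tendsto 0).eventually (gt_mem_nhds h0)] with x hx
  have h : metricForm m a l m₀ ψ σ (patch p x) = kerrAdS m a l m₀ (patch p x) := by
    have hx' : (patch p x).2.1 ≤ 0 := hx.le
    obtain ⟨h1, h2⟩ := hnonpos _ hx'
    simp only [kerrAdS_eq_metricForm, metricForm, h1, h2]
  simp only [localMetric, h]

/-- Vectors with the same phases φ_i have real Hermitian products, so the latitudinal directions and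
the position vector are mutually isotropic. -/
theorem symp_latitudinal (φ μ ν : Fin m → ℝ) :
    symp (latitudinal φ μ).2.2 (latitudinal φ ν).2.2 = 0 := by
  rw [symp_apply]
  refine Finset.sum_eq_zero fun i _ => ?_
  simp [latitudinal]
  ring

theorem exists_bound_sectionalAt (hm : 1 ≤ m) (ha : a ≠ 0) (hal : a ^ 2 * l ^ 2 < 1)
    (hm₀ : 0 < m₀) (hnonpos : ∀ ρ ≤ 0, ψ ρ = radialCoeff m a l m₀ ρ ∧ σ ρ = 0) (K : ℝ) :
    ∃ δ > 0, ∀ p ∈ spacetime m a, p.2.1 < -a ^ 2 + δ →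
      ∀ μ φ ν₁ ν₂ : Fin m → ℝ, p.2.2 = (latitudinal φ μ).2.2 →
        ∀ u v : tangent p, (u : Amb m) = latitudinal φ ν₁ → (v : Amb m) = latitudinal φ ν₂ →
          LinearIndependent ℝ ![u, v] →
            K ≤ |sectionalAt (metricForm m a l m₀ ψ σ) p u v| := by
  have ha2 : 0 < a ^ 2 := by positivity
  have hK : 0 < |K| + 1 := by positivity
  -- With X = ρ + a²: X < 1 gives X^(m+1) ≤ X, X < a² / 2 gives 2 m₀ ρ ≤ -m₀ a², and the last bound
  -- pushes the quotient below -(|K| + 1).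
  refine ⟨min 1 (min (a ^ 2 / 2) (m₀ * a ^ 2 / (|K| + 1))), by positivity, ?_⟩
  intro p hp hpδ μ φ ν₁ ν₂ hz u v hu hv hli
  obtain ⟨hp1, -⟩ := mem_spacetime_iff.mp hp
  have h1 : p.2.1 + a ^ 2 < 1 := by
    linarith [min_le_left 1 (min (a ^ 2 / 2) (m₀ * a ^ 2 / (|K| + 1)))]
  have h23 : p.2.1 + a ^ 2 < min (a ^ 2 / 2) (m₀ * a ^ 2 / (|K| + 1)) := by
    linarith [min_le_right 1 (min (a ^ 2 / 2) (m₀ * a ^ 2 / (|K| + 1)))]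
  have h2 := h23.trans_le (min_le_left _ _)
  have h3 := (lt_div_iff₀ hK).mp (h23.trans_le (min_le_right _ _))
  have hX : 0 < p.2.1 + a ^ 2 := by linarith
  have hρ : p.2.1 < 0 := by linarith
  have hΦ := (horizonPoly_pos_of_nonpos (m := m) hal hm₀ hp1 hρ.le).ne'
  rw [sectionalAt, sectional_congr (localMetric_metricForm_eventuallyEq hnonpos hρ), ← sectionalAt,
    sectionalAt_kerrAdS_of_latitudinal hm hal hm₀ hp hΦ (by rw [hu]; rfl) (by rw [hu]; rfl)
      (by rw [hu, hz]; exact symp_latitudinal _ _ _) (by rw [hv]; rfl) (by rw [hv]; rfl)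
      (by rw [hv, hz]; exact symp_latitudinal _ _ _)
      (by rw [hu, hv]; exact symp_latitudinal _ _ _) hli]
  have hpow : (p.2.1 + a ^ 2) ^ (m + 1) ≤ p.2.1 + a ^ 2 :=
    pow_le_of_le_one hX.le h1.le (Nat.succ_ne_zero m)
  have hpow0 : 0 < (p.2.1 + a ^ 2) ^ (m + 1) := pow_pos hX _
  have h4 : 2 * m₀ * p.2.1 / (p.2.1 + a ^ 2) ^ (m + 1) ≤ -(|K| + 1) := by
    rw [div_le_iff₀ hpow0]
    nlinarith
  rw [abs_of_nonpos (by nlinarith [sq_nonneg l])]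
  linarith [le_abs_self K, sq_nonneg l]

theorem exists_bound_kretschmannAt {ψ σ : ℝ → ℝ} (ha : a ≠ 0) (hal : a ^ 2 * l ^ 2 < 1)
    (hm₀ : 0 < m₀) (hnonpos : ∀ ρ ≤ 0, ψ ρ = radialCoeff 2 a l m₀ ρ ∧ σ ρ = 0) (K : ℝ) :
    ∃ δ > 0, ∀ p ∈ spacetime 2 a, p.2.1 < -a ^ 2 + δ →
      ∀ b : Module.Basis (Fin (2 * 2 + 1)) ℝ (tangent p),
        K ≤ kretschmannAt (metricForm 2 a l m₀ ψ σ) p b := by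
  have ha2 : 0 < a ^ 2 := by positivity
  have hK : 0 < |K| + 1 := by positivity
  -- X < a² makes ρ negative, hence (3a² - ρ)(a² - 3ρ) ≥ 3a⁴ and the numerator is at least 288 m₀²
  -- a⁴; the last bound compares this with (|K| + 1) X, and X⁶ ≤ X as X < 1.
  refine ⟨min 1 (min (a ^ 2) (288 * m₀ ^ 2 * a ^ 4 / (|K| + 1))), by positivity, ?_⟩
  intro p hp hpδ b
  obtain ⟨hp1, -⟩ := mem_spacetime_iff.mp hp
  have h1 : p.2.1 + a ^ 2 < 1 := by
    linarith [min_le_left 1 (min (a ^ 2) (288 * m₀ ^ 2 * a ^ 4 / (|K| + 1)))]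
  have h23 : p.2.1 + a ^ 2 < min (a ^ 2) (288 * m₀ ^ 2 * a ^ 4 / (|K| + 1)) := by
    linarith [min_le_right 1 (min (a ^ 2) (288 * m₀ ^ 2 * a ^ 4 / (|K| + 1)))]
  have h2 := h23.trans_le (min_le_left _ _)
  have h3 := (lt_div_iff₀ hK).mp (h23.trans_le (min_le_right _ _))
  have hX : 0 < p.2.1 + a ^ 2 := by linarith
  have hρ : p.2.1 < 0 := by linarith
  have hΦ := (horizonPoly_pos_of_nonpos (m := 2) hal hm₀ hp1 hρ.le).ne'
  rw [kretschmannAt, kretschmann_congr (localMetric_metricForm_eventuallyEq hnonpos hρ),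
    ← kretschmannAt, kretschmannAt_kerrAdS hal hm₀ hp hΦ]
  have hpow : (p.2.1 + a ^ 2) ^ 6 ≤ p.2.1 + a ^ 2 := pow_le_of_le_one hX.le h1.le (by norm_num)
  have hpow0 : 0 < (p.2.1 + a ^ 2) ^ 6 := pow_pos hX _
  have h4 : 3 * a ^ 4 ≤ (3 * a ^ 2 - p.2.1) * (a ^ 2 - 3 * p.2.1) := by nlinarith
  have h5 : |K| + 1 ≤
      96 * m₀ ^ 2 * (3 * a ^ 2 - p.2.1) * (a ^ 2 - 3 * p.2.1) / (p.2.1 + a ^ 2) ^ 6 := by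
    rw [le_div_iff₀ hpow0]
    calc (|K| + 1) * (p.2.1 + a ^ 2) ^ 6 ≤ (|K| + 1) * (p.2.1 + a ^ 2) := by gcongr
      _ ≤ 96 * m₀ ^ 2 * (3 * a ^ 4) := by linarith
      _ ≤ 96 * m₀ ^ 2 * ((3 * a ^ 2 - p.2.1) * (a ^ 2 - 3 * p.2.1)) := by gcongr
      _ = _ := by ring
  have h6 : 0 ≤ 40 * l ^ 4 := by positivity
  linarith [le_abs_self K]

end Singularity

end KerrAdS

end

end

theorem lemma2p6 (m : ℕ) (hm : 2 ≤ m) (a l m₀ : ℝ) (ha : a ≠ 0) (hl : 0 < l)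
    (hal : a ^ 2 * l ^ 2 < 1) (hm₀ : 0 < m₀) :
    -- for `r > 0` the metric `kerrAdS` is the Boyer-Lindquist metric in the coordinate `ρ = r²`
    (∀ q X : KerrAdS.BL m, 0 < q.2.1 → KerrAdS.horizonPoly m a l m₀ (q.2.1 ^ 2) ≠ 0 →
      KerrAdS.kerrAdS m a l m₀ (KerrAdS.blMap q)
          (fderiv ℝ KerrAdS.blMap q X) (fderiv ℝ KerrAdS.blMap q X) =
        KerrAdS.blLineElement m a l m₀ q X) ∧
    -- it is smooth and Lorentzian for all `ρ > -a²` off the horizons, and there are no horizons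
    -- with `-a² < ρ ≤ 0`
    ContDiffOn ℝ ∞ (KerrAdS.kerrAdS m a l m₀)
      {p | -a ^ 2 < p.2.1 ∧ KerrAdS.horizonPoly m a l m₀ p.2.1 ≠ 0} ∧
    (∀ p ∈ KerrAdS.spacetime m a, KerrAdS.horizonPoly m a l m₀ p.2.1 ≠ 0 →
      KerrAdS.IsLorentzianOn (KerrAdS.kerrAdS m a l m₀ p) (KerrAdS.tangent p)) ∧
    (∀ ρ : ℝ, -a ^ 2 < ρ → ρ ≤ 0 → 0 < KerrAdS.horizonPoly m a l m₀ ρ) ∧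
    -- for `m = 2`, the Kretschmann scalar
    (m = 2 → ∀ p ∈ KerrAdS.spacetime m a, KerrAdS.horizonPoly m a l m₀ p.2.1 ≠ 0 →
      ∀ b : Module.Basis (Fin (2 * m + 1)) ℝ (KerrAdS.tangent p),
        KerrAdS.kretschmannAt (KerrAdS.kerrAdS m a l m₀) p b =
          96 * m₀ ^ 2 * (3 * a ^ 2 - p.2.1) * (a ^ 2 - 3 * p.2.1) / (p.2.1 + a ^ 2) ^ 6
            + 40 * l ^ 4) ∧
    -- the extended spacetime and its timelike curvature singularity in `ρ = -a²`
    ∃ g : KerrAdS.MetricField m, KerrAdS.IsExtendedMetric m a l m₀ g ∧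
      (∀ p ∈ KerrAdS.spacetime m a, 0 < KerrAdS.horizonPoly m a l m₀ p.2.1 →
        KerrAdS.IsLorentzianOn (g p) (KerrAdS.levelTangent p)) ∧
      (3 ≤ m → ∀ C : ℝ, ∃ δ > 0, ∀ p ∈ KerrAdS.spacetime m a, p.2.1 < -a ^ 2 + δ →
        ∀ μ φ ν₁ ν₂ : Fin m → ℝ, p.2.2 = (KerrAdS.latitudinal φ μ).2.2 →
          ∀ u v : KerrAdS.tangent p, (u : KerrAdS.Amb m) = KerrAdS.latitudinal φ ν₁ →
            (v : KerrAdS.Amb m) = KerrAdS.latitudinal φ ν₂ → LinearIndependent ℝ ![u, v] →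
              C ≤ |KerrAdS.sectionalAt g p u v|) ∧
      (m = 2 → ∀ C : ℝ, ∃ δ > 0, ∀ p ∈ KerrAdS.spacetime m a, p.2.1 < -a ^ 2 + δ →
        ∀ b : Module.Basis (Fin (2 * m + 1)) ℝ (KerrAdS.tangent p),
          C ≤ KerrAdS.kretschmannAt g p b) := by
  have hm1 : 1 ≤ m := by omega
  have hΞ : 0 < 1 - a ^ 2 * l ^ 2 := by linarith
  refine ⟨fun q X _ hΦ => KerrAdS.kerrAdS_blMap hm1 q X hΦ, KerrAdS.contDiffOn_kerrAdS,
    fun p hp hΦ => KerrAdS.isLorentzianOn_kerrAdS hm1 hal hm₀ hp hΦ,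
    fun ρ h1 h2 => KerrAdS.horizonPoly_pos_of_nonpos hal hm₀ h1 h2, ?_, ?_⟩
  · rintro rfl p hp hΦ b
    exact KerrAdS.kretschmannAt_kerrAdS hal hm₀ hp hΦ b
  · obtain ⟨ψ, σ, hψs, hσs, hnonpos, hpos⟩ :=
      KerrAdS.exists_regular_coefficients (m := m) (l := l) ha hal hm₀
    refine ⟨KerrAdS.metricForm m a l m₀ ψ σ,
      KerrAdS.isExtendedMetric_metricForm hm1 hal hm₀ hψs hσs hnonpos hpos,
      fun p hp hΦ => KerrAdS.isLorentzianOn_levelTangent hm1 hΞ hp hΦ,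
      fun _ K => KerrAdS.exists_bound_sectionalAt hm1 ha hal hm₀ hnonpos K, ?_⟩
    rintro rfl K
    exact KerrAdS.exists_bound_kretschmannAt ha hal hm₀ hnonpos K
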